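/- **Conventions.** Let $K$ be a field of characteristic $0$ and let $q\in K^\times$ not be a root of unity. Let $M,N\ge 0$ be integers with $M+N\ge 1$. For $1\le i\le M+N$ put $\bar i=0$ if $i\le M$, $\bar i=1$ if $i>M$, and $q_i=q^{1-2\bar i}$. Let $$R(z,w)=\sum_i(zq_i-wq_i^{-1})E_{ii}\otimes E_{ii}+(z-w)\sum_{i\ne j}E_{ii}\otimes E_{jj}+z\sum_{i<j}(q_j-q_j^{-1})E_{ij}\otimes E_{ji}+w\sum_{i>j}(q_j-q_j^{-1})E_{ij}\otimes E_{ji},$$ and let $R(z/w)=f(z/w)\,R(z,w)/(zq-wq^{-1})$, expanded as a power series in $w/z$. Here $f(x)$ is, for $M\neq N$, the unique formal series in $x^{-1}$ with constant term $1$ such that $f(xq^{2N-2M})=f(x)\frac{(1-xq^{-2})(1-xq^{2N-2M+2})}{(1-x)(1-xq^{2N-2M})}$, and $f=1$ if $M=N$. The quantum affine superalgebra $\mathrm U_q(\widehat{\mathfrak{gl}}_{M|N})$ is the superalgebra over $K$ generated by ${l^{\pm}_{ij}}^{(r)}$ ($1\le i,j\le M+N$, $r\ge 0$, of parity $\bar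 i+\bar j$) and an invertible even central element $q^c$. With $L^\pm(z)=\sum_{i,j} l^\pm_{ij}(z)\otimes E_{ij}$ and $l^\pm_{ij}(z)=\sum_{r\ge0}{l^\pm_{ij}}^{(r)}z^{\mp r}$, the defining relations are ${l^+_{ji}}^{(0)}={l^-_{ij}}^{(0)}=0$ for $i<j$, ${l^-_{ii}}^{(0)}{l^+_{ii}}^{(0)}={l^+_{ii}}^{(0)}{l^-_{ii}}^{(0)}=1$, and $$R(z/w)L^\pm_1(z)L^\pm_2(w)=L^\pm_2(w)L^\pm_1(z)R(z/w),\qquad R(zq^c/w)L^+_1(z)L^-_2(w)=L^-_2(w)L^+_1(z)R(zq^{-c}/w).$$ All tensor products, and hence all matrix products and inverses, are graded. So $(a\otimes E_{ij})(b\otimes E_{jk})=(-1)^{(\bar i+\bar j)(\bar j+\bar k)}ab\otimes E_{ik}$ for $b$ of parity $\bar j+\bar k$. For $A=\sum a_{ij}\otimes E_{ij}$ let $A^{st}=\sum(-1)^{\bar i(\bar i+\bar j)}a_{ji}\otimes E_{ij}$. Put $$D=\mathrm{diag}\big[q^{-2},q^{-4},\dots,q^{-2M},q^{-2M},q^{-2M+2},\dots,q^{-2M+2N-2}\big].$$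 The quantum Berezinian is $$B_q(L^{\pm}(z))=\sum_{\sigma\in S_M}(-q)^{-l(\sigma)}L^{\pm}(z)_{\sigma(1),1}\cdots L^{\pm}(zq^{2M-2})_{\sigma(M),M}\sum_{\tau\in S_N}(-q)^{-l(\tau)}\big(L^{\pm}(zq^{2M-2})^{-1}\big)_{M+1,M+\tau(1)}\cdots\big(L^{\pm}(zq^{2M-2N})^{-1}\big)_{M+N,M+\tau(N)} .$$ **Theorem (Liouville-type theorem).** For each choice of sign, the matrix $L^\pm(z)$ is invertible. There is exactly one series $\mathfrak z^\pm(z)$ in $z^{\mp1}$ with coefficients in $\mathrm U_q(\widehat{\mathfrak{gl}}_{M|N})$ such that $$L^{\pm}(zq^{2N-2M})^{st}D\,(L^{\pm}(z)^{-1})^{st}=\mathfrak z^{\pm}(z)D\quad\text{and}\quad (L^{\pm}(z)^{-1})^{st}D^{-1}L^{\pm}(zq^{2N-2M})^{st}=\mathfrak z^{\pm}(z)D^{-1},$$ and this series satisfies $$B_q(L^{\pm}(zq^{-2}))=\mathfrak z^{\pm}(zq^{2M-2N-2})\,B_q(L^{\pm}(z)).$$ -/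

import Mathlib

open PowerSeries

namespace QuantumAffineSuper

/-! ### Supermatrices

Indices run over `Fin (M + N)`; the first `M` are even and the last `N` are odd. -/

/-- The parity of an index. -/
def par {M N : ℕ} (i : Fin (M + N)) : ℕ := if (i : ℕ) < M then 0 else 1

/-- `SuperMat M N A` consists of the elements `∑ a_ij ⊗ E_ij` of the graded tensor product
`A ⊗ End ℂ^{M|N}` of a superalgebra `A` with the endomorphism superalgebra, where `a_ij` has the
parity of `E_ij`.  It is represented by the array of the `a_ij`. -/
def SuperMat (M N : ℕ) (A : Type*) := Matrix (Fin (M + N)) (Fin (M + N)) A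

namespace SuperMat

variable {M N : ℕ} {A : Type*}

@[ext]
theorem ext {X Y : SuperMat M N A} (h : ∀ i j, X i j = Y i j) : X = Y :=
  funext fun i => funext fun j => h i j

instance [AddCommGroup A] : AddCommGroup (SuperMat M N A) :=
  inferInstanceAs (AddCommGroup (Matrix (Fin (M + N)) (Fin (M + N)) A))

instance {K : Type*} [Semiring K] [AddCommGroup A] [Module K A] : Module K (SuperMat M N A) :=
  inferInstanceAs (Module K (Matrix (Fin (M + N)) (Fin (M + N)) A))

instance [Zero A] [One A] : One (SuperMat M N A) :=
  ⟨fun i j => if i = j then 1 else 0⟩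

/-- The product of the graded tensor product:
`(a ⊗ E_ij) (b ⊗ E_jk) = (-1)^{(i + j)(j + k)} a b ⊗ E_ik`. -/
instance [Ring A] : Mul (SuperMat M N A) :=
  ⟨fun X Y i k => ∑ j, (-1) ^ ((par i + par j) * (par j + par k)) * (X i j * Y j k)⟩

theorem add_apply [AddCommGroup A] (X Y : SuperMat M N A) (i j : Fin (M + N)) :
    (X + Y) i j = X i j + Y i j := rfl

theorem zero_apply [AddCommGroup A] (i j : Fin (M + N)) : (0 : SuperMat M N A) i j = 0 := rfl

theorem one_apply [Zero A] [One A] (i j : Fin (M + N)) :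
    (1 : SuperMat M N A) i j = if i = j then 1 else 0 := rfl

theorem mul_apply [Ring A] (X Y : SuperMat M N A) (i k : Fin (M + N)) :
    (X * Y) i k = ∑ j, (-1) ^ ((par i + par j) * (par j + par k)) * (X i j * Y j k) := rfl

theorem par_cases (i : Fin (M + N)) : par i = 0 ∨ par i = 1 := by
  unfold par; split_ifs <;> simp

theorem sign_self [Ring A] (i k : Fin (M + N)) :
    (-1 : A) ^ ((par i + par i) * (par i + par k)) = 1 := by
  rcases par_cases i with h | h <;> rcases par_cases k with h' | h' <;> norm_num [h, h']

theorem sign_self' [Ring A] (i k : Fin (M + N)) :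
    (-1 : A) ^ ((par i + par k) * (par k + par k)) = 1 := by
  rcases par_cases i with h | h <;> rcases par_cases k with h' | h' <;> norm_num [h, h']

theorem sign_assoc [Ring A] (i j k l : Fin (M + N)) :
    (-1 : A) ^ ((par i + par k) * (par k + par l)) * (-1) ^ ((par i + par j) * (par j + par k)) =
      (-1) ^ ((par i + par j) * (par j + par l)) * (-1) ^ ((par j + par k) * (par k + par l)) := by
  rcases par_cases i with h | h <;> rcases par_cases j with h2 | h2 <;>
    rcases par_cases k with h3 | h3 <;> rcases par_cases l with h4 | h4 <;>
    norm_num [h, h2, h3, h4]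

theorem neg_pow_left_comm [Ring A] (a : A) (n : ℕ) (b : A) :
    a * ((-1) ^ n * b) = (-1) ^ n * (a * b) := by
  rw [← mul_assoc, ← mul_assoc, ((Commute.neg_one_right a).pow_right n).eq]

instance [Ring A] : Ring (SuperMat M N A) :=
  { (inferInstance : AddCommGroup (SuperMat M N A)),
    (inferInstance : One (SuperMat M N A)),
    (inferInstance : Mul (SuperMat M N A)) with
    left_distrib := fun X Y Z => by
      ext i k
      simp only [mul_apply, add_apply, mul_add, Finset.sum_add_distrib]
    right_distrib := fun X Y Z => by
      ext i k
      simp only [mul_apply, add_apply, add_mul, mul_add, Finset.sum_add_distrib]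
    zero_mul := fun X => by
      ext i k
      simp [mul_apply, zero_apply]
    mul_zero := fun X => by
      ext i k
      simp [mul_apply, zero_apply]
    one_mul := fun X => by
      ext i k
      rw [mul_apply, Finset.sum_eq_single i]
      · rw [sign_self, one_apply, if_pos rfl, one_mul, one_mul]
      · intro j _ hj
        rw [one_apply, if_neg (Ne.symm hj), zero_mul, mul_zero]
      · simp
    mul_one := fun X => by
      ext i k
      rw [mul_apply, Finset.sum_eq_single k]
      · rw [sign_self', one_apply, if_pos rfl, mul_one, one_mul]
      · intro j _ hj
        rw [one_apply, if_neg hj, mul_zero, mul_zero]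
      · simp
    mul_assoc := fun X Y Z => by
      ext i l
      simp only [mul_apply, Finset.sum_mul, Finset.mul_sum]
      rw [Finset.sum_comm]
      refine Finset.sum_congr rfl fun j _ => Finset.sum_congr rfl fun k _ => ?_
      rw [neg_pow_left_comm, ← mul_assoc ((-1 : A) ^ ((par i + par j) * (par j + par l))),
        ← sign_assoc]
      simp only [mul_assoc] }

/-- The supertranspose `A^st = ∑ (-1)^{i (i + j)} a_ji E_ij`. -/
def st [Ring A] (X : SuperMat M N A) : SuperMat M N A :=
  fun i j => (-1) ^ (par i * (par i + par j)) * X j i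

end SuperMat

/-! ### The two-fold graded tensor product `A ⊗ End ℂ^{M|N} ⊗ End ℂ^{M|N}`

The element `∑ u ⊗ E_ab ⊗ E_cd` is represented by the array with entry `u` in row `(a, c)` and
column `(b, d)`; all elements used below are even. -/

/-- Arrays of coefficients of `E_ab ⊗ E_cd`. -/
abbrev Mat₂ (M N : ℕ) (A : Type*) :=
  Matrix (Fin (M + N) × Fin (M + N)) (Fin (M + N) × Fin (M + N)) A

/-- The graded product:
`(u ⊗ E_ae ⊗ E_cg) (v ⊗ E_eb ⊗ E_gd)` is `u v ⊗ E_ab ⊗ E_cd` up to the sign that comes from moving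
`v` past `E_ae ⊗ E_cg` and `E_eb` past `E_cg`. -/
def superMul₂ {M N : ℕ} {A : Type*} [Ring A] (X Y : Mat₂ M N A) : Mat₂ M N A :=
  fun x y => ∑ p : Fin (M + N) × Fin (M + N),
    (-1) ^ ((par x.1 + par p.1 + par x.2 + par p.2) * (par p.1 + par y.1 + par p.2 + par y.2)
        + (par x.2 + par p.2) * (par p.1 + par y.1)) *
      (X x p * Y p y)

/-- `X₁ = ∑ x_ab ⊗ E_ab ⊗ 1`. -/
def leg₁ {M N : ℕ} {A : Type*} [Zero A] (X : SuperMat M N A) : Mat₂ M N A :=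
  fun x y => if x.2 = y.2 then X x.1 y.1 else 0

/-- `X₂ = ∑ x_cd ⊗ 1 ⊗ E_cd`. -/
def leg₂ {M N : ℕ} {A : Type*} [Zero A] (X : SuperMat M N A) : Mat₂ M N A :=
  fun x y => if x.1 = y.1 then X x.2 y.2 else 0

/-! ### The R-matrix -/

section RMatrix

variable {K : Type*} [Field K]

/-- `q_i = q` for even `i` and `q_i = q⁻¹` for odd `i`. -/
def qi (q : K) {M N : ℕ} (i : Fin (M + N)) : K := if par i = 0 then q else q⁻¹

/-- The matrix `R(z,w) = ∑ (z q_i - w q_i⁻¹) E_ii ⊗ E_ii + (z - w) ∑_{i ≠ j} E_ii ⊗ E_jj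
  + z ∑_{i < j} (q_j - q_j⁻¹) E_ij ⊗ E_ji + w ∑_{i > j} (q_j - q_j⁻¹) E_ij ⊗ E_ji`,
where `z` and `w` are elements of a commutative `K`-algebra. -/
def rMat (q : K) (M N : ℕ) {S : Type*} [CommRing S] [Algebra K S] (z w : S) : Mat₂ M N S :=
  fun x y =>
    if x = y then
      if x.1 = x.2 then qi q x.1 • z - (qi q x.1)⁻¹ • w else z - w
    else if x.1 = y.2 ∧ x.2 = y.1 then
      (qi q y.1 - (qi q y.1)⁻¹) • (if x.1 < y.1 then z else w)
    else 0

/-- The coefficients of the normalizing series `f(y)`, see `normSeries`. -/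
noncomputable def normCoeff (q : K) (M N : ℕ) : ℕ → K
  | 0 => 1
  | 1 =>
    let t : K := q ^ (2 * (M : ℤ) - 2 * N)
    ((1 + t) - (q ^ 2 + t * (q ^ 2)⁻¹)) / (t - 1)
  | n + 2 =>
    let t : K := q ^ (2 * (M : ℤ) - 2 * N)
    (((1 + t) * t ^ (n + 1) - (q ^ 2 + t * (q ^ 2)⁻¹)) * normCoeff q M N (n + 1)
      + (t - t ^ (n + 1)) * normCoeff q M N n) / (t ^ (n + 2) - 1)

/-- The normalizing series `f` with constant term `1`, written in the variable `y = w/z`: for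
`M ≠ N` and `q` not a root of unity it is determined by the functional equation of
`normSeries_functional`.  (The equation has no solution for `M = N`; the value is then `1`.) -/
noncomputable def normSeries (q : K) (M N : ℕ) : K⟦X⟧ := PowerSeries.mk (normCoeff q M N)

/-- `f(ty) (1 - y) (1 - ty) = f(y) (1 - q² y) (1 - t q⁻² y)` for `t = q^{2M-2N}`. -/
theorem normSeries_functional (q : K) (M N : ℕ) (t : K) (ht : t = q ^ (2 * (M : ℤ) - 2 * N))
    (hq : q ≠ 0) (h : ∀ n : ℕ, 0 < n → t ^ n ≠ 1) :
    rescale t (normSeries q M N) * ((1 - X) * (1 - C t * X)) =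
      normSeries q M N * ((1 - C (q ^ 2) * X) * (1 - C (t * (q ^ 2)⁻¹) * X)) := by
  have key : ∀ (F : K⟦X⟧) (a b : K), F * ((1 - C a * X) * (1 - C b * X)) =
      F - C (a + b) * (F * X) + C (a * b) * (F * X * X) := by
    intro F a b
    simp only [map_add, map_mul]
    ring
  have key0 : ∀ (F : K⟦X⟧) (a b : K),
      coeff 0 (F * ((1 - C a * X) * (1 - C b * X))) = coeff 0 F := by
    intro F a b
    simp
  have key1 : ∀ (F : K⟦X⟧) (a b : K),
      coeff 1 (F * ((1 - C a * X) * (1 - C b * X))) = coeff 1 F - (a + b) * coeff 0 F := by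
    intro F a b
    rw [key]
    generalize a + b = c
    generalize a * b = d
    rw [map_add, map_sub, coeff_C_mul, coeff_C_mul, coeff_succ_mul_X, coeff_succ_mul_X,
      coeff_zero_mul_X, mul_zero, add_zero]
  have key2 : ∀ (F : K⟦X⟧) (a b : K) (n : ℕ),
      coeff (n + 2) (F * ((1 - C a * X) * (1 - C b * X))) =
        coeff (n + 2) F - (a + b) * coeff (n + 1) F + a * b * coeff n F := by
    intro F a b n
    rw [key]
    generalize a + b = c
    generalize a * b = d
    rw [map_add, map_sub, coeff_C_mul, coeff_C_mul, coeff_succ_mul_X, coeff_succ_mul_X,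
      coeff_succ_mul_X]
  have h1 : (1 - X : K⟦X⟧) = 1 - C (1 : K) * X := by simp
  have hq2 : q ^ 2 * (t * (q ^ 2)⁻¹) = t := by field_simp
  rw [h1]
  ext n
  rcases n with _ | _ | n
  · rw [key0, key0, coeff_rescale, pow_zero, one_mul]
  · have := sub_ne_zero.mpr (h 1 one_pos)
    rw [pow_one] at this
    rw [zero_add, key1, key1, coeff_rescale, coeff_rescale, normSeries, coeff_mk, coeff_mk,
      normCoeff, normCoeff, ← ht]
    field_simp
    ring
  · have := sub_ne_zero.mpr (h (n + 2) (by omega))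
    rw [key2, key2, hq2, coeff_rescale, coeff_rescale, coeff_rescale, normSeries, coeff_mk,
      coeff_mk, coeff_mk, normCoeff, ← ht]
    generalize normCoeff q M N (n + 1) = u
    generalize normCoeff q M N n = v
    field_simp
    ring

/-- The normalized R-matrix `R(x) = f(x) R(z,w) / (z q - w q⁻¹)`, `x = z/w`, expanded as a power
series in `w/z` (the variable `X`). -/
noncomputable def normR (q : K) (M N : ℕ) : Mat₂ M N K⟦X⟧ :=
  fun x y => normSeries q M N * (C q - C q⁻¹ * X)⁻¹ * rMat q M N 1 X x y

end RMatrix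

/-! ### The quantum affine superalgebra -/

/-- The superscript `±`. -/
inductive PM
  | plus
  | minus

/-- `L^±(z)` is a series in `z^{∓1}`: this is the exponent `∓1`. -/
def PM.expo : PM → ℤ
  | .plus => -1
  | .minus => 1

/-- The generators: `l^±_ij^{(r)}`, and the central element `q^c` with its inverse. -/
inductive Gen (M N : ℕ)
  | l (s : PM) (i j : Fin (M + N)) (r : ℕ)
  | qc
  | qcInv

section Algebra

variable {K : Type*} [Field K] (q : K) (M N : ℕ)

/-- The free algebra on the generators. -/
abbrev Free (K : Type*) [Field K] (M N : ℕ) := FreeAlgebra K (Gen M N)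

/-- The matrix of generators `(l^±_ij^{(r)})`. -/
def genL (K : Type*) [Field K] (M N : ℕ) (s : PM) (r : ℕ) : SuperMat M N (Free K M N) :=
  fun i j => FreeAlgebra.ι K (Gen.l s i j r)

/-- The coefficient of `z^m` in `L^±(z) = ∑_r L^±^{(r)} z^{∓r}`, for an integer `m`. -/
def genLz (K : Type*) [Field K] (M N : ℕ) (s : PM) (m : ℤ) : SuperMat M N (Free K M N) :=
  if 0 ≤ s.expo * m then genL K M N s (s.expo * m).toNat else 0

/-- A matrix with scalar entries as a matrix over the free algebra. -/
def scal {K : Type*} [Field K] {M N : ℕ} (X : Mat₂ M N K) : Mat₂ M N (Free K M N) :=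
  fun x y => algebraMap K _ (X x y)

/-- The coefficient of `z^m w^n` in `R(z,w) L₁(z) L₂(w)`. -/
noncomputable def rllLeft (s : PM) (m n : ℤ) : Mat₂ M N (Free K M N) :=
  superMul₂ (scal (rMat q M N 1 0))
      (superMul₂ (leg₁ (genLz K M N s (m - 1))) (leg₂ (genLz K M N s n)))
    + superMul₂ (scal (rMat q M N 0 1))
      (superMul₂ (leg₁ (genLz K M N s m)) (leg₂ (genLz K M N s (n - 1))))

/-- The coefficient of `z^m w^n` in `L₂(w) L₁(z) R(z,w)`. -/
noncomputable def rllRight (s : PM) (m n : ℤ) : Mat₂ M N (Free K M N) :=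
  superMul₂ (superMul₂ (leg₂ (genLz K M N s n)) (leg₁ (genLz K M N s (m - 1))))
      (scal (rMat q M N 1 0))
    + superMul₂ (superMul₂ (leg₂ (genLz K M N s (n - 1))) (leg₁ (genLz K M N s m)))
      (scal (rMat q M N 0 1))

/-- The coefficient of `(w/z)^k` in the normalized R-matrix. -/
noncomputable def normRCoeff (k : ℕ) : Mat₂ M N K := fun x y => coeff k (normR q M N x y)

/-- The coefficient of `z^{-m} w^n` in `R(z q^c / w) L⁺₁(z) L⁻₂(w)`. -/
noncomputable def crossLeft (m n : ℕ) : Mat₂ M N (Free K M N) :=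
  fun x y => ∑ k ∈ Finset.range (min m n + 1),
    FreeAlgebra.ι K Gen.qcInv ^ k *
      superMul₂ (scal (normRCoeff q M N k))
        (superMul₂ (leg₁ (genL K M N .plus (m - k))) (leg₂ (genL K M N .minus (n - k)))) x y

/-- The coefficient of `z^{-m} w^n` in `L⁻₂(w) L⁺₁(z) R(z q^{-c} / w)`. -/
noncomputable def crossRight (m n : ℕ) : Mat₂ M N (Free K M N) :=
  fun x y => ∑ k ∈ Finset.range (min m n + 1),
    FreeAlgebra.ι K Gen.qc ^ k *
      superMul₂ (superMul₂ (leg₂ (genL K M N .minus (n - k))) (leg₁ (genL K M N .plus (m - k))))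
        (scal (normRCoeff q M N k)) x y

/-- The defining relations.  For equal signs the scalar factor of the normalized R-matrix, which is
invertible and occurs on both sides, is cancelled, so that `R(z,w)` takes the place of `R(z/w)`. -/
inductive Rel : Free K M N → Free K M N → Prop
  | triPlus (i j : Fin (M + N)) (h : i < j) : Rel (genL K M N .plus 0 j i) 0
  | triMinus (i j : Fin (M + N)) (h : i < j) : Rel (genL K M N .minus 0 i j) 0
  | diagLeft (i : Fin (M + N)) : Rel (genL K M N .minus 0 i i * genL K M N .plus 0 i i) 1
  | diagRight (i : Fin (M + N)) : Rel (genL K M N .plus 0 i i * genL K M N .minus 0 i i) 1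
  | rll (s : PM) (m n : ℤ) (x y : Fin (M + N) × Fin (M + N)) :
      Rel (rllLeft q M N s m n x y) (rllRight q M N s m n x y)
  | cross (m n : ℕ) (x y : Fin (M + N) × Fin (M + N)) :
      Rel (crossLeft q M N m n x y) (crossRight q M N m n x y)
  | qcLeft : Rel (FreeAlgebra.ι K Gen.qc * FreeAlgebra.ι K Gen.qcInv) 1
  | qcRight : Rel (FreeAlgebra.ι K Gen.qcInv * FreeAlgebra.ι K Gen.qc) 1
  | qcCentral (s : PM) (i j : Fin (M + N)) (r : ℕ) :
      Rel (FreeAlgebra.ι K Gen.qc * genL K M N s r i j)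
        (genL K M N s r i j * FreeAlgebra.ι K Gen.qc)

/-- The quantum affine superalgebra `U_q(\hat{gl}_{M|N})`. -/
def Uq : Type _ := RingQuot (Rel q M N)

noncomputable instance : Ring (Uq q M N) := inferInstanceAs (Ring (RingQuot (Rel q M N)))

noncomputable instance : Algebra K (Uq q M N) :=
  inferInstanceAs (Algebra K (RingQuot (Rel q M N)))

/-- The projection from the free algebra. -/
noncomputable def Uq.mk : Free K M N →ₐ[K] Uq q M N := RingQuot.mkAlgHom K (Rel q M N)

/-! ### Generating series

A series in `z^{∓1}` is a power series, whose variable stands for `z^{-1}` in the case `+` and for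
`z` in the case `-`. -/

/-- The generator matrix `L^±(z)`. -/
noncomputable def L (s : PM) : (SuperMat M N (Uq q M N))⟦X⟧ :=
  PowerSeries.mk fun r i j => Uq.mk q M N (genL K M N s r i j)

/-- The series `F(z q^k)`, for a series `F(z)` in `z^{∓1}`. -/
noncomputable def shift {B : Type*} [Ring B] [Module K B] (s : PM) (k : ℤ) (F : B⟦X⟧) : B⟦X⟧ :=
  PowerSeries.mk fun r => q ^ (s.expo * k * r) • coeff r F

/-- The entry `(i,j)` of a matrix of series. -/
noncomputable def entry {M N : ℕ} {A : Type*} [Ring A] (F : (SuperMat M N A)⟦X⟧)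
    (i j : Fin (M + N)) : A⟦X⟧ :=
  PowerSeries.mk fun r => (coeff r F : SuperMat M N A) i j

/-- The supertranspose of a matrix of series. -/
noncomputable def stSeries {M N : ℕ} {A : Type*} [Ring A] (F : (SuperMat M N A)⟦X⟧) :
    (SuperMat M N A)⟦X⟧ :=
  PowerSeries.mk fun r => SuperMat.st (coeff r F)

/-- The scalar series `Z(z)`, as the matrix of series `∑ Z(z) ⊗ E_ii`. -/
noncomputable def scalarSeries {A : Type*} [Ring A] (Z : A⟦X⟧) : (SuperMat M N A)⟦X⟧ :=
  PowerSeries.mk fun r i j => if i = j then coeff r Z else 0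

/-- The inverse `L^±(z)⁻¹` in the ring of series over `U_q ⊗ End ℂ^{M|N}` (graded product). -/
noncomputable def Linv (s : PM) : (SuperMat M N (Uq q M N))⟦X⟧ := Ring.inverse (L q M N s)

/-- Exponents of `q` in `D`: the `i`-th one (counted from `1`) is `-2i` for `i ≤ M`, and the
`(M+k)`-th one is `-2M+2k-2` for `1 ≤ k ≤ N`. -/
def dExpo {M N : ℕ} (i : Fin (M + N)) : ℤ :=
  if (i : ℕ) < M then -2 * ((i : ℤ) + 1) else 2 * (i : ℤ) - 4 * M

/-- `diag[q^{-2}, q^{-4}, …, q^{-2M}, q^{-2M}, …, q^{-2M+2N-2}]` to the power `e`. -/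
noncomputable def Dmat (e : ℤ) : (SuperMat M N (Uq q M N))⟦X⟧ :=
  C (R := SuperMat M N (Uq q M N))
    (fun i j => if i = j then algebraMap K _ (q ^ (e * dExpo i)) else 0)

/-- The two equations that characterize the series `Z^±(z)`:
`L(z q^{2N-2M})^st D (L(z)⁻¹)^st = Z(z) D` and
`(L(z)⁻¹)^st D⁻¹ L(z q^{2N-2M})^st = Z(z) D⁻¹`. -/
def IsZSeries (s : PM) (Z : (Uq q M N)⟦X⟧) : Prop :=
  stSeries (shift q s (2 * N - 2 * M) (L q M N s)) * Dmat q M N 1 * stSeries (Linv q M N s)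
      = scalarSeries M N Z * Dmat q M N 1 ∧
  stSeries (Linv q M N s) * Dmat q M N (-1) * stSeries (shift q s (2 * N - 2 * M) (L q M N s))
      = scalarSeries M N Z * Dmat q M N (-1)

/-- The length of a permutation: its number of inversions. -/
def len {n : ℕ} (σ : Equiv.Perm (Fin n)) : ℕ :=
  (Finset.univ.filter fun p : Fin n × Fin n => p.1 < p.2 ∧ σ p.2 < σ p.1).card

/-- The quantum Berezinian
`B_q(L(z)) = ∑_σ (-q)^{-l(σ)} L(z)_{σ(1),1} ⋯ L(z q^{2M-2})_{σ(M),M}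
  × ∑_τ (-q)^{-l(τ)} (L(z q^{2M-2})⁻¹)_{M+1,M+τ(1)} ⋯ (L(z q^{2M-2N})⁻¹)_{M+N,M+τ(N)}`. -/
noncomputable def berezinian (s : PM) : (Uq q M N)⟦X⟧ :=
  (∑ σ : Equiv.Perm (Fin M), ((-q)⁻¹ ^ len σ) •
    (List.ofFn fun i : Fin M =>
      entry (shift q s (2 * (i : ℤ)) (L q M N s)) (Fin.castAdd N (σ i)) (Fin.castAdd N i)).prod) *
  (∑ τ : Equiv.Perm (Fin N), ((-q)⁻¹ ^ len τ) •
    (List.ofFn fun i : Fin N =>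
      entry (shift q s (2 * M - 2 - 2 * (i : ℤ)) (Linv q M N s))
        (Fin.natAdd M i) (Fin.natAdd M (τ i))).prod)

end Algebra

end QuantumAffineSuper

/-!
The sign `(-1)^{(i + 1) j}` turns the graded matrix product into the ordinary one (`hatSeries`), so
that `L^±(z)` becomes a matrix over the ring of power series which satisfies an ordinary relation
`R(z,w) L₁(z) L₂(w) = L₂(w) L₁(z) R(z,w)` (`isRLL_hatSeries_L`). The constant terms of its leading
submatrices are triangular with invertible diagonal entries. Hence `L` and all its leading
submatrices are invertible, and so are the trailing submatrices of `L⁻¹`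
(`isUnit_submatrix_of_compl`). Everything else holds for a matrix `L` with these properties over an
algebra on which substitutions `F(z) ↦ F(cz)` act (`Scaling`, `IsSystem`). The relations have
coefficients such as `z - w`, which are zero at exceptional points. There they are cancelled by
density: a power series whose coefficients are polynomials in `c` and which vanishes for all
`c ≠ c₀` vanishes at `c₀` as well.

*The scalar series.* The relation between `L` and `L⁻¹` (`IsRLL.mixed`), summed with the diagonal
entries of `D` as weights, expresses `(z ω₀ - w ω_n) ∑ L⁻¹(w)_{kx} L(z)_{xi}` by the entries of
`L(z)^st D (L(w)⁻¹)^st`. Here `D` is an eigenvector of the relevant part of the R-matrix, because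
its entries are, up to signs and a common factor, differences of consecutive terms of a sequence `ω`
(`IsWeight.sum_dWeight_mul_rOff_add`). The eigenvalue `z ω₀ - w ω_n` is zero for `z = w q^{2N-2M}`,
and the resulting linear equations say that `L(z q^{2N-2M})^st D (L(z)⁻¹)^st` is a scalar multiple
of `D` (`IsSystem.exists_twistedProd_eq`). The second equation is the first one for the transpose of
`L` over the opposite algebra (`IsSystem.revOp`). The two scalar series `Z` and `Z'` satisfy
`Z L = L Z'`, with `L` taken at `z q^{2N-2M}`, and `Z' L⁻¹ = L⁻¹ Z`. An invertible corner entry of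
`L` or of `L⁻¹` commutes with `Z`, so that `Z = Z'` (`scalar_eq`).

*The Berezinian.* The formula is proved by induction on `M` (`hasLiouville`). Let `h` be the upper
left entry of `L`, and suppose that the first index is even. The Schur complement of `h` in `L` is
the inverse of a trailing submatrix of `L⁻¹`. It satisfies the same relations, and its entries
commute with `h`. A comparison of two-by-two minors shows that the scalar series of the Schur
complement is `h(uz)⁻¹ h(q² uz) Z(z)`, where `u = q^{2N-2M}` (`IsSystem.twistedProd_schur`).
Clearing the first row of the leading submatrix by column operations shows that the Berezinian is
`B(z) = h(z) B'(q² z)`, where `B'` is the one of the Schur complement (`ber_eq_corner_mul`). The two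
changes cancel in the formula. For odd indices only, `L⁻¹` transposed satisfies the relation for
even indices only (`IsSystem.revOp_inv`), and its quantum determinant is the Berezinian of `L`, so
that this case reduces to the even one (`hasLiouville_odd`).
-/

namespace QuantumLiouville

/-! ### Complementary submatrices of inverse matrices -/

section Jacobi

variable {R ι α β : Type*} [Ring R] [Fintype ι] [Fintype α] [Fintype β]

theorem sum_eq_sum_add_sum_of_bijective {f : α → ι} {g : β → ι}
    (h : Function.Bijective (Sum.elim f g)) (F : ι → R) :
    ∑ i, F i = ∑ a, F (f a) + ∑ b, F (g b) := by
  rw [← (Equiv.ofBijective _ h).sum_comp, Fintype.sum_sum_type]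
  rfl

theorem submatrix_mul_of_bijective {f : α → ι} {g : β → ι}
    (h : Function.Bijective (Sum.elim f g)) (X Y : Matrix ι ι R) {γ δ : Type*} (r : γ → ι)
    (s : δ → ι) : (X * Y).submatrix r s =
      X.submatrix r f * Y.submatrix f s + X.submatrix r g * Y.submatrix g s := by
  ext i j
  simp only [Matrix.submatrix_apply, Matrix.mul_apply, Matrix.add_apply]
  exact sum_eq_sum_add_sum_of_bijective h _

/-- A submatrix of an invertible matrix is invertible if the complementary submatrix of the inverse
matrix is. The inverse is the Schur complement. -/
theorem isUnit_submatrix_of_compl [DecidableEq ι] [DecidableEq α] [DecidableEq β]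
    {f : α → ι} {g : β → ι} (h : Function.Bijective (Sum.elim f g))
    {L M : Matrix ι ι R} (hLM : L * M = 1) (hML : M * L = 1)
    (hu : IsUnit (M.submatrix g g)) : IsUnit (L.submatrix f f) := by
  have hf : Function.Injective f := fun a b hab => by
    simpa using h.1 (a₁ := Sum.inl a) (a₂ := Sum.inl b) hab
  have hfg : ∀ a b, f a ≠ g b := fun a b hab => by
    simpa using h.1 (a₁ := Sum.inl a) (a₂ := Sum.inr b) hab
  have one_ff : (1 : Matrix ι ι R).submatrix f f = 1 := Matrix.submatrix_one f hf
  have one_fg : (1 : Matrix ι ι R).submatrix f g = 0 := by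
    ext a b; simp [hfg a b]
  have one_gf : (1 : Matrix ι ι R).submatrix g f = 0 := by
    ext a b; simp [(hfg b a).symm]
  obtain ⟨u, hu1, hu2⟩ := isUnit_iff_exists.1 hu
  have e1 := submatrix_mul_of_bijective h L M f f
  have e2 := submatrix_mul_of_bijective h L M f g
  have e3 := submatrix_mul_of_bijective h M L f f
  have e4 := submatrix_mul_of_bijective h M L g f
  rw [hLM, one_ff] at e1
  rw [hLM, one_fg] at e2
  rw [hML, one_ff] at e3
  rw [hML, one_gf] at e4
  -- With `u` the inverse of the block `M_gg`, the vanishing off-diagonal blocks of `L M` and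
  -- `M L` determine `L_fg` and `L_gf` from `L_ff`.
  have e2' : L.submatrix f g = -(L.submatrix f f * M.submatrix f g * u) := by
    have := congrArg (· * u) e2
    simp only [Matrix.add_mul, Matrix.zero_mul, Matrix.mul_assoc (L.submatrix f g), hu1,
      Matrix.mul_one] at this
    exact (neg_eq_of_add_eq_zero_right this.symm).symm
  have e4' : L.submatrix g f = -(u * M.submatrix g f * L.submatrix f f) := by
    have := congrArg (u * ·) e4
    simp only [Matrix.mul_add, Matrix.mul_zero, ← Matrix.mul_assoc u,
      hu2, Matrix.one_mul] at this
    exact (neg_eq_of_add_eq_zero_right this.symm).symm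
  refine ⟨⟨L.submatrix f f,
    M.submatrix f f - M.submatrix f g * (u * M.submatrix g f), ?_, ?_⟩, rfl⟩
  · rw [e2'] at e1
    rw [e1]
    simp only [sub_eq_add_neg, Matrix.mul_add, Matrix.mul_neg, Matrix.neg_mul, Matrix.mul_assoc]
  · rw [e4'] at e3
    rw [e3]
    simp only [sub_eq_add_neg, Matrix.add_mul, Matrix.mul_neg, Matrix.neg_mul, Matrix.mul_assoc]

end Jacobi

/-! ### The exchange relation -/

section Exchange

variable {K : Type*} [Field K]

/-- The sign `(-1)^{p(a) p(b)}` for a parity function `p`, with `true` for odd. -/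
def sg (K : Type*) [Field K] {ι : Type*} (p : ι → Bool) (a b : ι) : K :=
  if p a && p b then -1 else 1

/-- `q_a = q` for even `a` and `q_a = q⁻¹` for odd `a`. -/
def qpar {ι : Type*} (p : ι → Bool) (q : K) (a : ι) : K := if p a then q⁻¹ else q

/-- The diagonal coefficients of the R-matrix. -/
def rDiag {ι : Type*} [DecidableEq ι] (p : ι → Bool) (q z w : K) (a c : ι) : K :=
  if a = c then z * qpar p q a - w * (qpar p q a)⁻¹ else z - w

/-- The off-diagonal coefficients of the R-matrix up to sign, set to `0` on the diagonal. -/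
def rOff {ι : Type*} [LinearOrder ι] (q z w : K) (a c : ι) : K :=
  if a = c then 0 else (q - q⁻¹) * if a < c then z else w

section
variable {ι : Type*} (p : ι → Bool)

theorem sg_cases (a b : ι) : sg K p a b = 1 ∨ sg K p a b = -1 := by
  unfold sg; split_ifs <;> simp

theorem sg_comm (a b : ι) : sg K p a b = sg K p b a := by
  simp only [sg, Bool.and_comm]

theorem sg_mul_self (a b : ι) : sg K p a b * sg K p a b = 1 := by
  rcases sg_cases (K := K) p a b with h | h <;> simp [h]

theorem sg_ne_zero (a b : ι) : sg K p a b ≠ 0 := by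
  rcases sg_cases (K := K) p a b with h | h <;> simp [h]

theorem qpar_ne_zero {q : K} (hq : q ≠ 0) (a : ι) : qpar p q a ≠ 0 := by
  unfold qpar; split_ifs <;> simp [hq]

/-- `q_a - q_a⁻¹ = (-1)^{p(a)} (q - q⁻¹)` -/
theorem qpar_sub_inv (q : K) (a : ι) :
    qpar p q a - (qpar p q a)⁻¹ = sg K p a a * (q - q⁻¹) := by
  unfold qpar sg; cases p a <;> simp

end

variable {ι : Type*} [LinearOrder ι] {A : Type*} [Ring A] [Algebra K A]
  (p : ι → Bool) (q : K)

/-- The matrix that represents `R(z,w)` after the graded product is turned into the ordinary one. -/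
def rMatrix (A : Type*) [Ring A] [Algebra K A] (z w : K) : Matrix (ι × ι) (ι × ι) A :=
  fun x y => algebraMap K A ((if y = x then rDiag p q z w x.1 x.2 else 0) +
    if y = x.swap then sg K p x.1 x.2 * rOff q z w x.1 x.2 else 0)

/-- The first leg `X ⊗ 1` in the ordinary product: moving `X` past the second leg costs a sign. -/
def legOne (X : Matrix ι ι A) : Matrix (ι × ι) (ι × ι) A :=
  fun x y => if x.2 = y.2 then (sg K p x.2 x.1 * sg K p x.2 y.1) • X x.1 y.1 else 0

/-- The second leg `1 ⊗ X` in the ordinary product. -/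
def legTwo (X : Matrix ι ι A) : Matrix (ι × ι) (ι × ι) A :=
  fun x y => if x.1 = y.1 then X x.2 y.2 else 0

theorem legOne_one : legOne p (K := K) (1 : Matrix ι ι A) = 1 := by
  ext ⟨a, c⟩ ⟨b, d⟩
  by_cases h : a = b <;> by_cases h' : c = d <;>
    simp [legOne, Matrix.one_apply, h, h', sg_mul_self]

theorem legTwo_one : legTwo (1 : Matrix ι ι A) = 1 := by
  ext ⟨a, c⟩ ⟨b, d⟩
  by_cases h : a = b <;> by_cases h' : c = d <;> simp [legTwo, Matrix.one_apply, h, h']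

variable [Fintype ι]

theorem rMatrix_mul_apply (z w : K) (V : Matrix (ι × ι) (ι × ι) A) (a c : ι) (y : ι × ι) :
    (rMatrix p q A z w * V) (a, c) y = rDiag p q z w a c • V (a, c) y +
      (sg K p a c * rOff q z w a c) • V (c, a) y := by
  simp only [Matrix.mul_apply, rMatrix, map_add, add_mul, Finset.sum_add_distrib]
  simp only [apply_ite (algebraMap K A), map_zero, ite_mul, zero_mul, Finset.sum_ite_eq',
    Finset.mem_univ, if_true, Algebra.smul_def, Prod.swap_prod_mk]

theorem mul_rMatrix_apply (z w : K) (V : Matrix (ι × ι) (ι × ι) A) (x : ι × ι) (b d : ι) :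
    (V * rMatrix p q A z w) x (b, d) = rDiag p q z w b d • V x (b, d) +
      (sg K p b d * rOff q z w d b) • V x (d, b) := by
  have h : ∀ y : ι × ι, ((b, d) = y.swap) ↔ y = (d, b) := by
    rintro ⟨y1, y2⟩; simp only [Prod.swap_prod_mk, Prod.mk.injEq]; tauto
  simp only [Matrix.mul_apply, rMatrix, map_add, mul_add, Finset.sum_add_distrib, h]
  simp only [apply_ite (algebraMap K A), map_zero, mul_ite, mul_zero, Finset.sum_ite_eq,
    Finset.sum_ite_eq', Finset.mem_univ, if_true, Algebra.smul_def, ← Algebra.commutes]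
  rw [sg_comm p d b]

theorem legOne_mul (X Y : Matrix ι ι A) :
    legOne p (K := K) (X * Y) = legOne p (K := K) X * legOne p (K := K) Y := by
  ext ⟨a, c⟩ ⟨b, d⟩
  rw [Matrix.mul_apply, Fintype.sum_prod_type]
  simp only [legOne]
  rw [Finset.sum_comm, Finset.sum_eq_single c]
  · by_cases h : c = d
    · subst h
      simp only [if_true, Matrix.mul_apply, Finset.smul_sum]
      refine Finset.sum_congr rfl fun e _ => ?_
      rw [smul_mul_smul_comm]
      congr 1
      linear_combination -(sg K p c a * sg K p c b) * sg_mul_self (K := K) p c e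
    · simp [h]
  · intro e _ he
    refine Finset.sum_eq_zero fun f _ => ?_
    rw [if_neg (Ne.symm he), zero_mul]
  · simp

theorem legTwo_mul (X Y : Matrix ι ι A) : legTwo (X * Y) = legTwo X * legTwo Y := by
  ext ⟨a, c⟩ ⟨b, d⟩
  rw [Matrix.mul_apply, Fintype.sum_prod_type]
  simp only [legTwo]
  rw [Finset.sum_eq_single a]
  · by_cases h : a = b <;> simp [h, Matrix.mul_apply]
  · intro e _ he
    refine Finset.sum_eq_zero fun f _ => ?_
    rw [if_neg (Ne.symm he), zero_mul]
  · simp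

theorem legOne_mul_legTwo_apply (X Y : Matrix ι ι A) (a c b d : ι) :
    (legOne p (K := K) X * legTwo Y) (a, c) (b, d) =
      (sg K p c a * sg K p c b) • (X a b * Y c d) := by
  simp only [legOne, legTwo, Matrix.mul_apply, Fintype.sum_prod_type]
  rw [Finset.sum_eq_single b, Finset.sum_eq_single c]
  · simp
  · intro e _ he
    rw [if_neg (Ne.symm he), zero_mul]
  · simp
  · intro e _ he
    refine Finset.sum_eq_zero fun f _ => ?_
    rw [if_neg he, mul_zero]
  · simp

theorem legTwo_mul_legOne_apply (X Y : Matrix ι ι A) (a c b d : ι) :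
    (legTwo Y * legOne p (K := K) X) (a, c) (b, d) =
      (sg K p d a * sg K p d b) • (Y c d * X a b) := by
  simp only [legOne, legTwo, Matrix.mul_apply, Fintype.sum_prod_type]
  rw [Finset.sum_eq_single a, Finset.sum_eq_single d]
  · simp
  · intro e _ he
    rw [if_neg he, mul_zero]
  · simp
  · intro e _ he
    refine Finset.sum_eq_zero fun f _ => ?_
    rw [if_neg (Ne.symm he), zero_mul]
  · simp

/-- The relation `R(z,w) X₁ Y₂ = Y₂ X₁ R(z,w)`. -/
def IsRLL (z w : K) (X Y : Matrix ι ι A) : Prop :=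
  rMatrix p q A z w * (legOne p (K := K) X * legTwo Y) =
    legTwo Y * legOne p (K := K) X * rMatrix p q A z w

/-- The RLL relation in terms of matrix entries. -/
theorem isRLL_iff {p : ι → Bool} {q : K} {z w : K} {X Y : Matrix ι ι A} :
    IsRLL p q z w X Y ↔ ∀ a c b d : ι,
      (sg K p c a * sg K p c b * rDiag p q z w a c) • (X a b * Y c d) +
        (sg K p a b * rOff q z w a c) • (X c b * Y a d) =
      (sg K p d a * sg K p d b * rDiag p q z w b d) • (Y c d * X a b) +
        (sg K p a b * rOff q z w d b) • (Y c b * X a d) := by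
  unfold IsRLL
  have key : ∀ a c b d : ι,
      ((rMatrix p q A z w * (legOne p (K := K) X * legTwo Y)) (a, c) (b, d) =
        (legTwo Y * legOne p (K := K) X * rMatrix p q A z w) (a, c) (b, d)) ↔
      ((sg K p c a * sg K p c b * rDiag p q z w a c) • (X a b * Y c d) +
        (sg K p a b * rOff q z w a c) • (X c b * Y a d) =
      (sg K p d a * sg K p d b * rDiag p q z w b d) • (Y c d * X a b) +
        (sg K p a b * rOff q z w d b) • (Y c b * X a d)) := by
    intro a c b d
    rw [rMatrix_mul_apply, mul_rMatrix_apply, legOne_mul_legTwo_apply, legOne_mul_legTwo_apply,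
      legTwo_mul_legOne_apply, legTwo_mul_legOne_apply]
    simp only [smul_smul]
    rw [sg_comm p b d, sg_comm p b a, sg_comm p a b,
      show rDiag p q z w a c * (sg K p c a * sg K p c b) =
        sg K p c a * sg K p c b * rDiag p q z w a c by ring,
      show rDiag p q z w b d * (sg K p d a * sg K p d b) =
        sg K p d a * sg K p d b * rDiag p q z w b d by ring,
      show sg K p a c * rOff q z w a c * (sg K p a c * sg K p b a) =
        sg K p b a * rOff q z w a c by
          linear_combination sg K p b a * rOff q z w a c * sg_mul_self (K := K) p a c,
      show sg K p d b * rOff q z w d b * (sg K p b a * sg K p d b) =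
        sg K p b a * rOff q z w d b by
          linear_combination sg K p b a * rOff q z w d b * sg_mul_self (K := K) p d b]
  constructor
  · intro h a c b d
    exact (key a c b d).1 (by rw [h])
  · intro h
    ext ⟨a, c⟩ ⟨b, d⟩
    exact (key a c b d).2 (h a c b d)

end Exchange

section ExchangeInverse

variable {K : Type*} [Field K] {ι : Type*} [LinearOrder ι] [Fintype ι] {A : Type*} [Ring A]
  [Algebra K A] {p : ι → Bool} {q z w : K}

/-- The relation `X₁ Y₂ R(z,w) = R(z,w) Y₂ X₁`, which is satisfied by the inverses of matrices
that satisfy `IsRLL`. -/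
def IsLLR (p : ι → Bool) (q z w : K) (X Y : Matrix ι ι A) : Prop :=
  legOne p (K := K) X * legTwo Y * rMatrix p q A z w =
    rMatrix p q A z w * (legTwo Y * legOne p (K := K) X)

/-- The relation for inverses in terms of matrix entries. -/
theorem isLLR_iff {X Y : Matrix ι ι A} :
    IsLLR p q z w X Y ↔ ∀ a c b d : ι,
      (sg K p c a * sg K p c b * rDiag p q z w b d) • (X a b * Y c d) +
        (sg K p b d * sg K p c a * sg K p c d * rOff q z w d b) • (X a d * Y c b) =
      (sg K p d a * sg K p d b * rDiag p q z w a c) • (Y c d * X a b) +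
        (sg K p a c * sg K p d c * sg K p d b * rOff q z w a c) • (Y a d * X c b) := by
  unfold IsLLR
  have key : ∀ a c b d : ι,
      ((legOne p (K := K) X * legTwo Y * rMatrix p q A z w) (a, c) (b, d) =
        (rMatrix p q A z w * (legTwo Y * legOne p (K := K) X)) (a, c) (b, d)) ↔
      ((sg K p c a * sg K p c b * rDiag p q z w b d) • (X a b * Y c d) +
        (sg K p b d * sg K p c a * sg K p c d * rOff q z w d b) • (X a d * Y c b) =
      (sg K p d a * sg K p d b * rDiag p q z w a c) • (Y c d * X a b) +
        (sg K p a c * sg K p d c * sg K p d b * rOff q z w a c) • (Y a d * X c b)) := by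
    intro a c b d
    rw [rMatrix_mul_apply, mul_rMatrix_apply, legOne_mul_legTwo_apply, legOne_mul_legTwo_apply,
      legTwo_mul_legOne_apply, legTwo_mul_legOne_apply]
    simp only [smul_smul]
    refine iff_of_eq (congrArg₂ (· = ·) ?_ ?_) <;> congr 2 <;> ring
  constructor
  · intro h a c b d
    exact (key a c b d).1 (by rw [h])
  · intro h
    ext ⟨a, c⟩ ⟨b, d⟩
    exact (key a c b d).2 (h a c b d)

variable {X X' Y Y' : Matrix ι ι A}

theorem legOne_mul_eq_one (h : X * X' = 1) :
    legOne p (K := K) X * legOne p (K := K) X' = 1 := by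
  rw [← legOne_mul, h, legOne_one]

theorem legTwo_mul_eq_one (h : X * X' = 1) : legTwo X * legTwo X' = 1 := by
  rw [← legTwo_mul, h, legTwo_one]

theorem IsRLL.inverse (h : IsRLL p q z w X Y) (hX : X * X' = 1) (hX' : X' * X = 1)
    (hY : Y * Y' = 1) (hY' : Y' * Y = 1) : IsLLR p q z w X' Y' := by
  unfold IsRLL at h
  unfold IsLLR
  have e1 := legOne_mul_eq_one (p := p) (K := K) hX
  have e1' := legOne_mul_eq_one (p := p) (K := K) hX'
  have e2 := legTwo_mul_eq_one hY
  have e2' := legTwo_mul_eq_one hY'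
  generalize legOne p (K := K) X = U at *
  generalize legOne p (K := K) X' = U' at *
  generalize legTwo Y = V at *
  generalize legTwo Y' = V' at *
  generalize rMatrix p q A z w = R at *
  calc U' * V' * R = U' * V' * (R * (U * V)) * (V' * U') := by
        rw [← mul_assoc R, mul_assoc _ _ (V' * U'), mul_assoc _ _ (V' * U'), ← mul_assoc V, e2,
          one_mul, mul_assoc R, e1, mul_one]
    _ = R * (V' * U') := by
        have c1 : ∀ T, V' * (V * T) = T := fun T => by rw [← mul_assoc, e2', one_mul]
        have c2 : ∀ T, U' * (U * T) = T := fun T => by rw [← mul_assoc, e1', one_mul]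
        rw [h]
        simp only [mul_assoc, c1, c2]

theorem IsLLR.inverse (h : IsLLR p q z w X Y) (hX : X * X' = 1) (hX' : X' * X = 1)
    (hY : Y * Y' = 1) (hY' : Y' * Y = 1) : IsRLL p q z w X' Y' := by
  unfold IsLLR at h
  unfold IsRLL
  have e1 := legOne_mul_eq_one (p := p) (K := K) hX
  have e1' := legOne_mul_eq_one (p := p) (K := K) hX'
  have e2 := legTwo_mul_eq_one hY
  have e2' := legTwo_mul_eq_one hY'
  generalize legOne p (K := K) X = U at *
  generalize legOne p (K := K) X' = U' at *
  generalize legTwo Y = V at *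
  generalize legTwo Y' = V' at *
  generalize rMatrix p q A z w = R at *
  calc R * (U' * V') = V' * U' * (U * V * R) * (U' * V') := by
        rw [mul_assoc U V, ← mul_assoc (V' * U'), mul_assoc V', e1', mul_one, ← mul_assoc V',
          e2', one_mul]
    _ = V' * U' * R := by
        rw [h]
        have c1 : ∀ T, V * (V' * T) = T := fun T => by rw [← mul_assoc, e2, one_mul]
        simp only [mul_assoc]
        have c2 : U * (U' * V') = V' := by rw [← mul_assoc, e1, one_mul]
        rw [c2, e2, mul_one]

/-- The exchange relation of `X` with the inverse `Y'` of `Y`, which is `Y'₂ R X₁ = X₁ R Y'₂`. -/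
theorem IsRLL.mixed (h : IsRLL p q z w X Y) (hY : Y * Y' = 1) (hY' : Y' * Y = 1) (a c b d : ι) :
    (sg K p d a * sg K p d b * rDiag p q z w a d) • (Y' c d * X a b) +
      (if a = d then sg K p a b • ∑ x, rOff q z w a x • (Y' c x * X x b) else 0) =
    (sg K p c a * sg K p c b * rDiag p q z w b c) • (X a b * Y' c d) +
      (if b = c then sg K p a b • ∑ e, rOff q z w e b • (X a e * Y' e d) else 0) := by
  have e2 := legTwo_mul_eq_one hY
  have e2' := legTwo_mul_eq_one hY'
  have key : legTwo Y' * (rMatrix p q A z w * legOne p (K := K) X) =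
      legOne p (K := K) X * (rMatrix p q A z w * legTwo Y') := by
    unfold IsRLL at h
    generalize legOne p (K := K) X = U at *
    generalize legTwo Y = V at *
    generalize legTwo Y' = V' at *
    generalize rMatrix p q A z w = R at *
    calc V' * (R * U) = V' * (R * (U * V)) * V' := by
          simp only [mul_assoc, e2, mul_one]
      _ = U * (R * V') := by
          rw [h, mul_assoc V, ← mul_assoc V', e2', one_mul, mul_assoc]
  have key2 := congrFun (congrFun key (a, c)) (b, d)
  have l : (legTwo Y' * (rMatrix p q A z w * legOne p (K := K) X)) (a, c) (b, d) =
      ∑ x, Y' c x * (rMatrix p q A z w * legOne p (K := K) X) (a, x) (b, d) := by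
    rw [Matrix.mul_apply, Fintype.sum_prod_type, Finset.sum_eq_single a]
    · simp [legTwo]
    · intro e _ he
      exact Finset.sum_eq_zero fun f _ => by simp [legTwo, Ne.symm he]
    · simp
  have r : (legOne p (K := K) X * (rMatrix p q A z w * legTwo Y')) (a, c) (b, d) =
      ∑ e, (sg K p c a * sg K p c e) • (X a e * (rMatrix p q A z w * legTwo Y') (e, c) (b, d)) := by
    rw [Matrix.mul_apply, Fintype.sum_prod_type]
    refine Finset.sum_congr rfl fun e _ => ?_
    rw [Finset.sum_eq_single c]
    · simp [legOne]
    · intro f _ hf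
      simp [legOne, Ne.symm hf]
    · simp
  rw [l, r] at key2
  have l2 : ∀ x, Y' c x * (rMatrix p q A z w * legOne p (K := K) X) (a, x) (b, d) =
      (if x = d then (sg K p d a * sg K p d b * rDiag p q z w a d) • (Y' c d * X a b) else 0) +
      (if a = d then sg K p a b • rOff q z w a x • (Y' c x * X x b) else 0) := by
    intro x
    rw [rMatrix_mul_apply, mul_add]
    congr 1
    · by_cases hx : x = d
      · subst hx
        simp only [legOne, if_true, mul_smul_comm, smul_smul]
        congr 1
        ring
      · simp [legOne, hx]
    · by_cases hx : a = d
      · subst hx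
        simp only [legOne, if_true, mul_smul_comm, smul_smul]
        congr 1
        linear_combination (rOff q z w a x * sg K p a b) * sg_mul_self (K := K) p a x
      · simp [legOne, hx]
  have r2 : ∀ e, (sg K p c a * sg K p c e) •
        (X a e * (rMatrix p q A z w * legTwo Y') (e, c) (b, d)) =
      (if e = b then (sg K p c a * sg K p c b * rDiag p q z w b c) • (X a b * Y' c d) else 0) +
      (if b = c then sg K p a b • rOff q z w e b • (X a e * Y' e d) else 0) := by
    intro e
    rw [rMatrix_mul_apply, mul_add, smul_add]
    congr 1
    · by_cases hx : e = b
      · subst hx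
        simp only [legTwo, if_true, mul_smul_comm, smul_smul]
      · simp [legTwo, hx]
    · by_cases hx : b = c
      · subst hx
        simp only [legTwo, if_true, mul_smul_comm, smul_smul]
        congr 1
        rw [sg_comm p e b, sg_comm p b a]
        linear_combination (rOff q z w e b * sg K p a b) * sg_mul_self (K := K) p b e
      · simp [legTwo, hx, Ne.symm hx]
  simp only [l2, r2, Finset.sum_add_distrib, Finset.sum_ite_eq', Finset.mem_univ, if_true] at key2
  simp only [Finset.smul_sum]
  convert key2 using 2 <;> split_ifs <;> simp

end ExchangeInverse

/-! ### Algebras with scaling automorphisms -/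

/-- An algebra of functions `F(z)` with coefficients in a noncommutative algebra, on which the
substitutions `F(z) ↦ F(cz)` act, such that the functions `c ↦ ∑ x F(cz) + ∑ G(cz) y` have no
isolated nonzero values.  The last property allows the cancellation of factors such as `z - w`. -/
structure Scaling (K A : Type*) [Field K] [Ring A] [Algebra K A] where
  /-- The substitution `F(z) ↦ F(cz)`. -/
  scale : Kˣ → A →ₐ[K] A
  scale_one : ∀ x, scale 1 x = x
  scale_scale : ∀ a b x, scale a (scale b x) = scale (a * b) x
  dense : ∀ f ∈ Submodule.span K {f : Kˣ → A | ∃ x y : A,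
    f = (fun c => x * scale c y) ∨ f = fun c => scale c y * x},
    ∀ c₀, (∀ c, c ≠ c₀ → f c = 0) → f c₀ = 0

section Systems

open MulOpposite

variable {K A : Type*} [Field K] [Ring A] [Algebra K A]

namespace Scaling

variable (σ : Scaling K A)

/-- The functions of `c` to which the density property of a scaling applies. -/
def regular : Submodule K (Kˣ → A) :=
  Submodule.span K {f : Kˣ → A | ∃ x y : A,
    f = (fun c => x * σ.scale c y) ∨ f = fun c => σ.scale c y * x}

variable {σ}

theorem mul_scale_mem_regular (x y : A) : (fun c => x * σ.scale c y) ∈ σ.regular :=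
  Submodule.subset_span ⟨x, y, Or.inl rfl⟩

theorem scale_mul_mem_regular (x y : A) : (fun c => σ.scale c y * x) ∈ σ.regular :=
  Submodule.subset_span ⟨x, y, Or.inr rfl⟩

/-- Commutativity with a rescaled element extends to an exceptional point, where a coefficient such
as `z - w` of the exchange relation is zero. -/
theorem commute_of_forall_ne {x y : A} (c₀ : Kˣ) (h : ∀ c, c ≠ c₀ → Commute x (σ.scale c y)) :
    Commute x (σ.scale c₀ y) := by
  have := σ.dense _ (σ.regular.sub_mem (mul_scale_mem_regular x y) (scale_mul_mem_regular x y)) c₀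
    (fun c hc => sub_eq_zero.2 (h c hc))
  exact sub_eq_zero.1 this

/-- The scaling of the opposite algebra. -/
def op (σ : Scaling K A) : Scaling K Aᵐᵒᵖ where
  scale c := AlgHom.op (σ.scale c)
  scale_one x := by
    induction x using MulOpposite.rec'
    simp [AlgHom.op, σ.scale_one]
  scale_scale a b x := by
    induction x using MulOpposite.rec'
    simp [AlgHom.op, σ.scale_scale]
  dense f hf c₀ h := by
    let φ : (Kˣ → Aᵐᵒᵖ) →ₗ[K] (Kˣ → A) :=
      { toFun := fun g c => unop (g c), map_add' := fun _ _ => rfl, map_smul' := fun _ _ => rfl }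
    have hle : Submodule.span K {f : Kˣ → Aᵐᵒᵖ | ∃ x y : Aᵐᵒᵖ,
        f = (fun c => x * AlgHom.op (σ.scale c) y) ∨ f = fun c => AlgHom.op (σ.scale c) y * x} ≤
        Submodule.comap φ σ.regular := by
      refine Submodule.span_le.2 ?_
      rintro _ ⟨x, y, rfl | rfl⟩
      · exact scale_mul_mem_regular (unop x) (unop y)
      · exact mul_scale_mem_regular (unop x) (unop y)
    have := σ.dense _ (hle hf) c₀ (fun c hc => congrArg unop (h c hc))
    exact unop_injective this

@[simp]
theorem op_scale_op (c : Kˣ) (x : A) :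
    σ.op.scale c (MulOpposite.op x) = MulOpposite.op (σ.scale c x) := rfl

end Scaling

variable (σ : Scaling K A)

/-- The inclusion of the last `m` of `n` indices. -/
def lastIdx {k m n : ℕ} (h : k + m = n) (i : Fin m) : Fin n := ⟨k + i, by omega⟩

/-- The inclusion of the first `k` of `n` indices. -/
def firstIdx {k m n : ℕ} (h : k + m = n) (i : Fin k) : Fin n := ⟨i, by omega⟩

/-- A matrix `L` over an algebra with a scaling, together with its inverse `M`, that satisfies the
RLL relation for the parity `p`. -/
structure IsSystem {n : ℕ} (p : Fin n → Bool) (q : K) (L M : Matrix (Fin n) (Fin n) A) : Prop where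
  mul_inv : L * M = 1
  inv_mul : M * L = 1
  rll : ∀ a b : Kˣ, IsRLL p q (a : K) (b : K) (L.map (σ.scale a)) (L.map (σ.scale b))

/-- All lower right submatrices are invertible. For the inverse of `L` this says that `L` has a
Gauss decomposition. -/
def HasLastMinors {n : ℕ} (M : Matrix (Fin n) (Fin n) A) : Prop :=
  ∀ {k m : ℕ} (h : k + m = n), IsUnit (M.submatrix (lastIdx h) (lastIdx h))

end Systems

/-! ### The scalar series -/

section Weights

variable {K : Type*} [Field K] {n : ℕ}

/-- The sequence `ω` satisfies `ω_{i+1} = ω_i q_i⁻²`. -/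
structure IsWeight (p : Fin n → Bool) (q : K) (ω : ℕ → K) : Prop where
  ne_zero : ∀ i, ω i ≠ 0
  succ : ∀ i : Fin n, ω (i + 1) = ω i * ((qpar p q i)⁻¹ * (qpar p q i)⁻¹)

/-- The diagonal entries of `D`, up to a common factor and to the signs `(-1)^{p(i)}`. -/
def dWeight (p : Fin n → Bool) (q : K) (ω : ℕ → K) (i : Fin n) : K :=
  sg K p i i * (ω i * (qpar p q i)⁻¹)

variable {p : Fin n → Bool} {q : K} {ω : ℕ → K}

theorem IsWeight.dWeight_ne_zero (hω : IsWeight p q ω) (hq : q ≠ 0) (i : Fin n) :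
    dWeight p q ω i ≠ 0 :=
  mul_ne_zero (sg_ne_zero p i i) (mul_ne_zero (hω.ne_zero i) (inv_ne_zero (qpar_ne_zero p hq i)))

/-- `(q - q⁻¹) d_i = ω_i - ω_{i+1}`, so that sums of the `d_i` telescope. -/
theorem IsWeight.sub_mul_dWeight (hω : IsWeight p q ω) (hq : q ≠ 0) (i : Fin n) :
    (q - q⁻¹) * dWeight p q ω i = ω i - ω (i + 1) := by
  have h := qpar_sub_inv p q i
  have h2 := qpar_ne_zero p hq i
  rw [hω.succ, dWeight]
  linear_combination (-(ω i * (qpar p q i)⁻¹)) * h + ω i * mul_inv_cancel₀ h2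

theorem IsWeight.sum_dWeight_mul_rOff (hω : IsWeight p q ω) (hq : q ≠ 0) (z w : K) (x : Fin n) :
    ∑ j, dWeight p q ω j * rOff q z w j x = z * (ω 0 - ω x) + w * (ω (x + 1) - ω n) := by
  -- By `sub_mul_dWeight`, the summand is the difference `F j - F (j + 1)`; the second part of `F`
  -- absorbs the missing summand at `x`.
  let F : ℕ → K := fun i =>
    if i ≤ x then z * ω i - z * ω x + w * ω (x + 1) else w * ω i
  have h : ∀ j : Fin n, dWeight p q ω j * rOff q z w j x = F j - F (j + 1) := by
    intro j
    have e := hω.sub_mul_dWeight hq j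
    simp only [rOff, F]
    rcases lt_trichotomy j x with h | h | h
    · have h' : (j : ℕ) < x := h
      rw [if_neg h.ne, if_pos h, if_pos h'.le, if_pos (by omega)]
      linear_combination z * e
    · subst h
      rw [if_pos rfl, if_pos le_rfl, if_neg (by omega)]
      ring
    · have h' : (x : ℕ) < j := h
      rw [if_neg h.ne', if_neg h.not_gt, if_neg (by omega), if_neg (by omega)]
      linear_combination w * e
  rw [Finset.sum_congr rfl fun j _ => h j, Fin.sum_univ_eq_sum_range (fun i => F i - F (i + 1)) n,
    Finset.sum_range_sub']
  have hx := x.isLt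
  simp only [F, Nat.zero_le, if_true]
  rw [if_neg (by omega)]
  ring

/-- The vector of the `d_i` is an eigenvector of the diagonal part of the supertransposed R-matrix;
the eigenvalue vanishes for `z ω_0 = w ω_n`. -/
theorem IsWeight.sum_dWeight_mul_rOff_add (hω : IsWeight p q ω) (hq : q ≠ 0) (z w : K)
    (x : Fin n) : sg K p x x * rDiag p q z w x x * dWeight p q ω x +
      ∑ j, dWeight p q ω j * rOff q z w j x = z * ω 0 - w * ω n := by
  have h2 := qpar_ne_zero p hq x
  have h3 := sg_mul_self (K := K) p x x
  rw [hω.sum_dWeight_mul_rOff hq, hω.succ, dWeight, rDiag, if_pos rfl]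
  field_simp
  linear_combination (z * ω x * (qpar p q x) ^ 2 - w * ω x) * h3

end Weights

section ScalarSeries

variable {K A : Type*} [Field K] [Ring A] [Algebra K A] {n : ℕ} {σ : Scaling K A}
  {p : Fin n → Bool} {q : K} {ω : ℕ → K} {L M : Matrix (Fin n) (Fin n) A}

/-- The entries of `L(cz)^st D (L(z)⁻¹)^st`. -/
def twistedProd (σ : Scaling K A) (p : Fin n → Bool) (q : K) (ω : ℕ → K)
    (L M : Matrix (Fin n) (Fin n) A) (i k : Fin n) (c : Kˣ) : A :=
  ∑ j, (sg K p j i * sg K p j k * dWeight p q ω j) • (σ.scale c (L j i) * M k j)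

/-- The relation between `L(cz)` and `L(z)⁻¹`, summed with weights. For `c ω_0 = ω_n` the left-hand
side vanishes, which leaves linear equations between the entries of `L(cz)^st D (L(z)⁻¹)^st`. -/
theorem IsSystem.smul_sum_eq_twistedProd (h : IsSystem σ p q L M) (hω : IsWeight p q ω)
    (hq : q ≠ 0) (c : Kˣ) (i k : Fin n) :
    (c * ω 0 - ω n) • ∑ x, M k x * σ.scale c (L x i) =
      (sg K p k i * rDiag p q c 1 i k) • twistedProd σ p q ω L M i k c +
      if i = k then ∑ e, rOff q (c : K) 1 e i • twistedProd σ p q ω L M e e c else 0 := by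
  have hL : L.map (σ.scale 1) = L := by
    ext; simp [σ.scale_one]
  have hrll := h.rll c 1
  rw [hL] at hrll
  have key := fun j => hrll.mixed h.mul_inv h.inv_mul j k i j
  simp only [if_true, Matrix.map_apply, Units.val_one] at key
  -- The right-hand side of the mixed relation yields the entries of `twistedProd`. On the
  -- left-hand side, the weights form an eigenvector.
  have key2 := Finset.sum_congr rfl fun j (_ : j ∈ Finset.univ) =>
    congrArg (fun y => (sg K p j i * dWeight p q ω j) • y) (key j)
  simp only [smul_add, Finset.sum_add_distrib, smul_smul] at key2
  have l : (c * ω 0 - ω n) • ∑ x, M k x * σ.scale c (L x i) =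
      ∑ j, (sg K p j i * dWeight p q ω j * (sg K p j j * sg K p j i * rDiag p q c 1 j j)) •
          (M k j * σ.scale c (L j i)) +
      ∑ j, (sg K p j i * dWeight p q ω j * sg K p j i) •
        ∑ x, rOff q (c : K) 1 j x • (M k x * σ.scale c (L x i)) := by
    simp only [Finset.smul_sum (s := (Finset.univ : Finset (Fin n))), smul_smul]
    rw [Finset.sum_comm (f := fun j x => (sg K p j i * dWeight p q ω j * sg K p j i *
      rOff q (c : K) 1 j x) • (M k x * σ.scale c (L x i))), ← Finset.sum_add_distrib]
    refine Finset.sum_congr rfl fun x _ => ?_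
    rw [← Finset.sum_smul, ← add_smul]
    congr 1
    have := hω.sum_dWeight_mul_rOff_add hq c 1 x
    rw [one_mul] at this
    rw [← this]
    congr 1
    · linear_combination -(sg K p x x * rDiag p q c 1 x x * dWeight p q ω x) *
        sg_mul_self (K := K) p x i
    · refine Finset.sum_congr rfl fun j _ => ?_
      linear_combination -(dWeight p q ω j * rOff q (c : K) 1 j x) * sg_mul_self (K := K) p j i
  rw [l, key2]
  congr 1
  · simp only [twistedProd, Finset.smul_sum, smul_smul]
    refine Finset.sum_congr rfl fun j _ => ?_
    rw [sg_comm p k j]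
    congr 1
    ring
  · split_ifs with hik
    · subst hik
      simp only [twistedProd, Finset.smul_sum (s := (Finset.univ : Finset (Fin n))), smul_smul]
      rw [Finset.sum_comm]
      refine Finset.sum_congr rfl fun e _ => Finset.sum_congr rfl fun j _ => ?_
      congr 1
      linear_combination (dWeight p q ω j * rOff q (c : K) 1 e i) *
        (sg_mul_self (K := K) p j i - sg_mul_self (K := K) p j e)
    · simp

theorem twistedProd_mem_regular (i k : Fin n) :
    twistedProd σ p q ω L M i k ∈ σ.regular := by
  have : twistedProd σ p q ω L M i k = ∑ j, (sg K p j i * sg K p j k * dWeight p q ω j) •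
      fun c => σ.scale c (L j i) * M k j := by
    ext c
    simp [twistedProd]
  rw [this]
  exact Submodule.sum_mem _ fun j _ =>
    Submodule.smul_mem _ _ (Scaling.scale_mul_mem_regular _ _)

theorem sum_mul_scale_mem_regular (k i : Fin n) :
    (fun c => ∑ x, M k x * σ.scale c (L x i)) ∈ σ.regular := by
  have : (fun c => ∑ x, M k x * σ.scale c (L x i)) =
      ∑ x, fun c => M k x * σ.scale c (L x i) := by
    ext c
    simp
  rw [this]
  exact Submodule.sum_mem _ fun j _ => Scaling.mul_scale_mem_regular _ _

theorem IsSystem.sum_mul_scale_one (h : IsSystem σ p q L M) (k i : Fin n) :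
    ∑ x, M k x * σ.scale 1 (L x i) = if k = i then 1 else 0 := by
  simp only [σ.scale_one]
  rw [← Matrix.mul_apply, h.inv_mul, Matrix.one_apply]

/-- A division by `c - 1`. For `u = 1`, where it is a division by zero, it is justified by density
and `G 1 = 0`. -/
theorem Scaling.eq_zero_of_smul_eq {u : Kˣ} (hu : u * ω 0 = ω n)
    {F G : Kˣ → A} (hF : F ∈ σ.regular) (hG : G ∈ σ.regular) (hG1 : G 1 = 0)
    (hFG : ∀ c : Kˣ, ((c : K) - 1) • F c = ((c : K) * ω 0 - ω n) • G c) : F u = 0 := by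
  by_cases hu1 : u = 1
  · subst hu1
    rw [Units.val_one, one_mul] at hu
    have := σ.dense _ (σ.regular.sub_mem hF (σ.regular.smul_mem (ω 0) hG)) 1 ?_
    · simpa [hG1] using this
    · intro c hc
      have hc' : (c : K) - 1 ≠ 0 := sub_ne_zero.2 fun h' => hc (Units.ext h')
      have := hFG c
      rw [← hu, show (c : K) * ω 0 - ω 0 = (c - 1) * ω 0 by ring, mul_smul] at this
      have := smul_right_injective A hc' this
      simp [this]
  · have hc' : (u : K) - 1 ≠ 0 := sub_ne_zero.2 fun h' => hu1 (Units.ext h')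
    have := hFG u
    rw [hu, sub_self, zero_smul] at this
    exact (smul_eq_zero.1 this).resolve_left hc'

/-- The off-diagonal entries of `L(uz)^st D (L(z)⁻¹)^st` vanish. -/
theorem IsSystem.twistedProd_eq_zero (h : IsSystem σ p q L M) (hω : IsWeight p q ω)
    (hq : q ≠ 0) {u : Kˣ} (hu : u * ω 0 = ω n) {i k : Fin n} (hik : i ≠ k) :
    twistedProd σ p q ω L M i k u = 0 := by
  refine Scaling.eq_zero_of_smul_eq hu (twistedProd_mem_regular i k)
    (Submodule.smul_mem _ (sg K p k i) (sum_mul_scale_mem_regular (L := L) (M := M) k i)) ?_ ?_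
  · rw [Pi.smul_apply, h.sum_mul_scale_one, if_neg hik.symm, smul_zero]
  · intro c
    have := h.smul_sum_eq_twistedProd hω hq c i k
    rw [if_neg hik, add_zero, rDiag, if_neg hik] at this
    rw [Pi.smul_apply, smul_comm, this, smul_smul, ← mul_assoc, sg_mul_self, one_mul]

/-- Adjacent diagonal entries of `L(uz)^st D (L(z)⁻¹)^st` are proportional: the difference of the
two linear equations for the indices `i` and `i + 1` involves no other entry. -/
theorem IsSystem.twistedProd_succ (h : IsSystem σ p q L M) (hω : IsWeight p q ω)
    (hq : q ≠ 0) {u : Kˣ} (hu : u * ω 0 = ω n) {i i' : Fin n} (hi : (i' : ℕ) = i + 1) :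
    (sg K p i' i' * qpar p q i') • twistedProd σ p q ω L M i' i' u =
      (sg K p i i * (qpar p q i)⁻¹) • twistedProd σ p q ω L M i i u := by
  refine sub_eq_zero.1 (Scaling.eq_zero_of_smul_eq hu
    (Submodule.sub_mem _ (Submodule.smul_mem _ (sg K p i' i' * qpar p q i')
        (twistedProd_mem_regular i' i'))
      (Submodule.smul_mem _ (sg K p i i * (qpar p q i)⁻¹) (twistedProd_mem_regular i i)))
    (Submodule.sub_mem _ (sum_mul_scale_mem_regular (L := L) (M := M) i' i')
      (sum_mul_scale_mem_regular (L := L) (M := M) i i)) ?_ ?_)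
  · simp [h.sum_mul_scale_one]
  · intro c
    have e1 := h.smul_sum_eq_twistedProd hω hq c i' i'
    have e2 := h.smul_sum_eq_twistedProd hω hq c i i
    have hne : i ≠ i' := fun hh => by rw [hh] at hi; omega
    have hlt : i < i' := by rw [Fin.lt_def]; omega
    rw [if_pos rfl] at e1 e2
    have e3 : ∑ e, rOff q (c : K) 1 e i' • twistedProd σ p q ω L M e e c -
        ∑ e, rOff q (c : K) 1 e i • twistedProd σ p q ω L M e e c =
        ((q - q⁻¹) * c) • twistedProd σ p q ω L M i i c -
          (q - q⁻¹) • twistedProd σ p q ω L M i' i' c := by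
      rw [← Finset.sum_sub_distrib, Fintype.sum_eq_add i i' hne]
      · simp [rOff, hne, hne.symm, hlt, hlt.not_gt, sub_eq_add_neg]
      · intro e he
        rw [← sub_smul]
        have : (e < i') ↔ (e < i) := by
          have h1 : (e : ℕ) ≠ i := fun h => he.1 (Fin.ext h)
          rw [Fin.lt_def, Fin.lt_def]; omega
        simp [rOff, he.1, he.2, this]
    have s1 := qpar_sub_inv p q i
    have s2 := qpar_sub_inv p q i'
    have t1 := sg_mul_self (K := K) p i i
    have t2 := sg_mul_self (K := K) p i' i'
    simp only [rDiag, if_true, one_mul] at e1 e2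
    simp only [Pi.sub_apply, Pi.smul_apply]
    rw [smul_sub _ (∑ x, _) (∑ x, _), e1, e2, add_sub_add_comm, e3]
    generalize twistedProd σ p q ω L M i i c = S
    generalize twistedProd σ p q ω L M i' i' c = S'
    match_scalars
    · linear_combination (-sg K p i' i') * s2 - (q - q⁻¹) * t2
    · linear_combination (c * sg K p i i) * s1 + (c : K) * (q - q⁻¹) * t1

/-- The matrix `L(uz)^st D (L(z)⁻¹)^st` is a scalar multiple of `D`. -/
theorem IsSystem.exists_twistedProd_eq (h : IsSystem σ p q L M) (hω : IsWeight p q ω)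
    (hq : q ≠ 0) {u : Kˣ} (hu : u * ω 0 = ω n) :
    ∃ Z : A, ∀ i k, twistedProd σ p q ω L M i k u =
      if i = k then dWeight p q ω i • Z else 0 := by
  rcases Nat.eq_zero_or_pos n with hn | hn
  · subst hn
    exact ⟨0, fun i => i.elim0⟩
  refine ⟨(dWeight p q ω ⟨0, hn⟩)⁻¹ • twistedProd σ p q ω L M ⟨0, hn⟩ ⟨0, hn⟩ u, fun i k => ?_⟩
  split_ifs with hik
  · subst hik
    obtain ⟨i, hi⟩ := i
    induction i with
    | zero => rw [smul_inv_smul₀ (hω.dWeight_ne_zero hq _)]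
    | succ i ih =>
      have e := h.twistedProd_succ hω hq hu (i := ⟨i, by omega⟩) (i' := ⟨i + 1, hi⟩) rfl
      rw [ih (by omega), smul_smul] at e
      have hs := sg_ne_zero (K := K) p ⟨i + 1, hi⟩ ⟨i + 1, hi⟩
      have hq' := qpar_ne_zero p hq ⟨i + 1, hi⟩
      refine smul_right_injective A (mul_ne_zero hs hq') ?_
      simp only
      generalize (dWeight p q ω ⟨0, hn⟩)⁻¹ • (_ : A) = S at e ⊢
      rw [e, smul_smul]
      congr 1
      have := hω.succ ⟨i, by omega⟩
      simp only [dWeight] at this ⊢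
      rw [this]
      have t1 := sg_mul_self (K := K) p ⟨i + 1, hi⟩ ⟨i + 1, hi⟩
      have t2 := sg_mul_self (K := K) p ⟨i, by omega⟩ ⟨i, by omega⟩
      linear_combination (ω i * (qpar p q ⟨i, by omega⟩)⁻¹ ^ 2) * (t2 - t1 -
        sg K p ⟨i + 1, hi⟩ ⟨i + 1, hi⟩ ^ 2 * mul_inv_cancel₀ hq')
  · exact h.twistedProd_eq_zero hω hq hu hik

end ScalarSeries

/-! ### Transposition -/

section Transposition

open MulOpposite

variable {K A : Type*} [Field K] [Ring A] [Algebra K A] {σ : Scaling K A} {q : K}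

section RevOp

variable {n : ℕ} {p : Fin n → Bool} {L M : Matrix (Fin n) (Fin n) A}

/-- The transpose with respect to the second diagonal, over the opposite algebra. -/
def revOp (X : Matrix (Fin n) (Fin n) A) : Matrix (Fin n) (Fin n) Aᵐᵒᵖ :=
  fun i j => op (X j.rev i.rev)

theorem revOp_mul (X Y : Matrix (Fin n) (Fin n) A) : revOp (X * Y) = revOp Y * revOp X := by
  ext i k
  simp only [revOp, Matrix.mul_apply, Finset.op_sum, op_mul]
  exact (Equiv.sum_comp Fin.revPerm (fun j => op (Y j i.rev) * op (X k.rev j))).symm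

theorem revOp_one : revOp (1 : Matrix (Fin n) (Fin n) A) = 1 := by
  ext i j
  by_cases h : i = j <;> simp [revOp, Matrix.one_apply, Fin.rev_inj, h, eq_comm (a := j)]

theorem rDiag_rev (z w : K) (a c : Fin n) :
    rDiag (p ∘ Fin.rev) q z w a c = rDiag p q z w a.rev c.rev := by
  simp [rDiag, qpar, Fin.rev_inj]

theorem rOff_rev (z w : K) (a c : Fin n) :
    rOff q z w a c = rOff q z w c.rev a.rev := by
  simp [rOff, Fin.rev_lt_rev, Fin.rev_inj, eq_comm]

theorem rDiag_comm {ι : Type*} [DecidableEq ι] (p : ι → Bool) (z w : K) (a c : ι) :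
    rDiag p q z w a c = rDiag p q z w c a := by
  unfold rDiag
  by_cases h : a = c
  · subst h; rfl
  · rw [if_neg h, if_neg (Ne.symm h)]

/-- The relations are invariant under the transposition over the opposite algebra. -/
theorem IsSystem.revOp (h : IsSystem σ p q L M) :
    IsSystem σ.op (p ∘ Fin.rev) q (revOp L) (revOp M) where
  mul_inv := by rw [← revOp_mul, h.inv_mul, revOp_one]
  inv_mul := by rw [← revOp_mul, h.mul_inv, revOp_one]
  rll a b := by
    rw [isRLL_iff]
    intro i k j l
    have := isRLL_iff.1 (h.rll a b) j.rev l.rev i.rev k.rev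
    have := congrArg op this
    simp only [Matrix.map_apply, op_add, op_smul, op_mul] at this
    simp only [Matrix.map_apply, QuantumLiouville.revOp, Scaling.op_scale_op, rDiag_rev]
    have hs : ∀ x y, sg K (p ∘ Fin.rev) x y = sg K p x.rev y.rev := fun _ _ => rfl
    simp only [hs]
    rw [rOff_rev _ _ i k, rOff_rev _ _ l j, rDiag_comm p _ _ i.rev, sg_comm p i.rev j.rev,
      mul_comm (sg K p k.rev i.rev), mul_comm (sg K p l.rev i.rev)]
    rw [rDiag_comm p _ _ k.rev]
    exact this.symm

theorem IsWeight.rev {ω : ℕ → K} (hω : IsWeight p q ω) (hq : q ≠ 0) :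
    IsWeight (p ∘ Fin.rev) q (fun i => (ω (n - i))⁻¹) where
  ne_zero i := inv_ne_zero (hω.ne_zero _)
  succ i := by
    have := hω.succ i.rev
    have h2 := qpar_ne_zero p hq i.rev
    have h3 := hω.ne_zero i.rev
    have e : (i.rev : ℕ) + 1 = n - i := by rw [Fin.val_rev]; omega
    have e' : (i.rev : ℕ) = n - (i + 1) := by rw [Fin.val_rev]
    rw [e] at this
    have hqr : qpar (p ∘ Fin.rev) q i = qpar p q i.rev := rfl
    rw [← e', this, hqr]
    field_simp

theorem IsWeight.dWeight_rev {ω : ℕ → K} (hω : IsWeight p q ω) (hq : q ≠ 0) (i : Fin n) :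
    dWeight (p ∘ Fin.rev) q (fun i => (ω (n - i))⁻¹) i.rev = (dWeight p q ω i)⁻¹ := by
  have := hω.succ i
  have h2 := qpar_ne_zero p hq i
  have h3 := hω.ne_zero i
  have e' : n - (i.rev : ℕ) = i + 1 := by rw [Fin.val_rev]; omega
  have hqr : qpar (p ∘ Fin.rev) q i.rev = qpar p q i := by simp [qpar]
  have hs : sg K (p ∘ Fin.rev) i.rev i.rev = sg K p i i := by simp [sg]
  have hs2 : (sg K p i i)⁻¹ = sg K p i i := by
    rcases sg_cases (K := K) p i i with h | h <;> simp [h, inv_neg]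
  simp only [dWeight]
  rw [e', this, hqr, hs, mul_inv (sg K p i i), hs2, mul_inv, mul_inv, mul_inv]
  field_simp

/-- The matrix `(L(z)⁻¹)^st D⁻¹ L(uz)^st` is a scalar multiple of `D⁻¹`. -/
theorem IsSystem.exists_twistedProd'_eq {ω : ℕ → K} (h : IsSystem σ p q L M)
    (hω : IsWeight p q ω) (hq : q ≠ 0) {u : Kˣ} (hu : u * ω 0 = ω n) :
    ∃ Z : A, ∀ i k, ∑ j, (sg K p j i * sg K p j k * (dWeight p q ω j)⁻¹) •
      (M j k * σ.scale u (L i j)) = if i = k then (dWeight p q ω i)⁻¹ • Z else 0 := by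
  have h0 := hω.ne_zero 0
  have hn := hω.ne_zero n
  obtain ⟨Z, hZ⟩ := h.revOp.exists_twistedProd_eq (hω.rev hq) hq (u := u) (by
    simp only [Nat.sub_zero, Nat.sub_self]
    rw [← hu] at hn ⊢
    have := u.ne_zero
    field_simp)
  refine ⟨unop Z, fun i k => ?_⟩
  have := congrArg unop (hZ i.rev k.rev)
  rw [hω.dWeight_rev hq] at this
  simp only [apply_ite unop, unop_smul, Fin.rev_inj, unop_zero] at this
  rw [← this, twistedProd, Finset.unop_sum, ← Equiv.sum_comp Fin.revPerm]
  refine Finset.sum_congr rfl fun j _ => ?_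
  have hj := hω.dWeight_rev hq j.rev
  rw [Fin.rev_rev] at hj
  simp only [Fin.revPerm_apply, QuantumLiouville.revOp, Scaling.op_scale_op, unop_smul, unop_mul,
    unop_op, Fin.rev_rev]
  rw [hj]
  simp [sg]

/-- The two scalar series intertwine. With `D` and `D⁻¹` as in `twistedProd`, the products
`L(uz)^st D (L(z)⁻¹)^st D⁻¹ L(uz)^st` and `(L(z)⁻¹)^st D⁻¹ L(uz)^st D (L(z)⁻¹)^st` are evaluated by
bracketing them in both ways. -/
theorem scalar_mul_eq {ω : ℕ → K} (hω : IsWeight p q ω) (hq : q ≠ 0) {u : Kˣ} {Z Z' : A}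
    (hZ : ∀ i k, twistedProd σ p q ω L M i k u = if i = k then dWeight p q ω i • Z else 0)
    (hZ' : ∀ i k, ∑ j, (sg K p j i * sg K p j k * (dWeight p q ω j)⁻¹) •
      (M j k * σ.scale u (L i j)) = if i = k then (dWeight p q ω i)⁻¹ • Z' else 0)
    (l i : Fin n) :
    Z * σ.scale u (L l i) = σ.scale u (L l i) * Z' ∧ Z' * M l i = M l i * Z := by
  have hd := hω.dWeight_ne_zero hq
  constructor
  · have e1 : ∑ k, ∑ j, (sg K p j i * sg K p j k * dWeight p q ω j *
        ((dWeight p q ω k)⁻¹ * sg K p k l)) •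
          (σ.scale u (L j i) * M k j * σ.scale u (L l k)) =
        sg K p l i • (Z * σ.scale u (L l i)) := by
      have : ∀ k, ∑ j, (sg K p j i * sg K p j k * dWeight p q ω j *
        ((dWeight p q ω k)⁻¹ * sg K p k l)) •
          (σ.scale u (L j i) * M k j * σ.scale u (L l k)) =
          if i = k then sg K p l i • (Z * σ.scale u (L l i)) else 0 := by
        intro k
        have := congrArg (fun y => ((dWeight p q ω k)⁻¹ * sg K p k l) • (y * σ.scale u (L l k)))
          (hZ i k)
        simp only [twistedProd, Finset.sum_mul, Finset.smul_sum, smul_mul_assoc, smul_smul] at this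
        rw [Finset.sum_congr rfl fun j _ => by rw [mul_comm], this]
        split_ifs with hik
        · subst hik
          rw [smul_mul_assoc, smul_smul, mul_right_comm, inv_mul_cancel₀ (hd i), one_mul,
            sg_comm]
        · simp
      simp [this]
    have e2 : ∑ k, ∑ j, (sg K p j i * sg K p j k * dWeight p q ω j *
        ((dWeight p q ω k)⁻¹ * sg K p k l)) •
          (σ.scale u (L j i) * M k j * σ.scale u (L l k)) =
        sg K p l i • (σ.scale u (L l i) * Z') := by
      rw [Finset.sum_comm]
      have : ∀ j, ∑ k, (sg K p j i * sg K p j k * dWeight p q ω j *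
        ((dWeight p q ω k)⁻¹ * sg K p k l)) •
          (σ.scale u (L j i) * M k j * σ.scale u (L l k)) =
          if l = j then sg K p l i • (σ.scale u (L l i) * Z') else 0 := by
        intro j
        have := congrArg (fun y => (sg K p j i * dWeight p q ω j) • (σ.scale u (L j i) * y))
          (hZ' l j)
        simp only [Finset.mul_sum, Finset.smul_sum, mul_smul_comm, smul_smul] at this
        rw [Finset.sum_congr rfl fun k _ => ?_, this]
        · split_ifs with hik
          · subst hik
            rw [mul_smul_comm, smul_smul, mul_assoc, mul_inv_cancel₀ (hd l), mul_one]
          · simp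
        · rw [mul_assoc (σ.scale u (L j i)), sg_comm p j k]
          congr 1
          ring
      simp [this]
    exact smul_right_injective A (sg_ne_zero p l i) (e1.symm.trans e2)
  · have e1 : ∑ k, ∑ j, (sg K p j k * sg K p j i * (dWeight p q ω j)⁻¹ *
        (dWeight p q ω k * sg K p k l)) •
          (M j i * σ.scale u (L k j) * M l k) =
        sg K p l i • (Z' * M l i) := by
      have : ∀ k, ∑ j, (sg K p j k * sg K p j i * (dWeight p q ω j)⁻¹ *
        (dWeight p q ω k * sg K p k l)) •
          (M j i * σ.scale u (L k j) * M l k) =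
          if k = i then sg K p l i • (Z' * M l i) else 0 := by
        intro k
        have := congrArg (fun y => (dWeight p q ω k * sg K p k l) • (y * M l k)) (hZ' k i)
        simp only [Finset.sum_mul, Finset.smul_sum, smul_mul_assoc, smul_smul] at this
        rw [Finset.sum_congr rfl fun j _ => by rw [mul_comm], this]
        split_ifs with hik
        · subst hik
          rw [smul_mul_assoc, smul_smul, mul_right_comm, mul_inv_cancel₀ (hd k), one_mul,
            sg_comm]
        · simp
      simp [this]
    have e2 : ∑ k, ∑ j, (sg K p j k * sg K p j i * (dWeight p q ω j)⁻¹ *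
        (dWeight p q ω k * sg K p k l)) •
          (M j i * σ.scale u (L k j) * M l k) =
        sg K p l i • (M l i * Z) := by
      rw [Finset.sum_comm]
      have : ∀ j, ∑ k, (sg K p j k * sg K p j i * (dWeight p q ω j)⁻¹ *
        (dWeight p q ω k * sg K p k l)) •
          (M j i * σ.scale u (L k j) * M l k) =
          if j = l then sg K p l i • (M l i * Z) else 0 := by
        intro j
        have := congrArg (fun y => (sg K p j i * (dWeight p q ω j)⁻¹) • (M j i * y)) (hZ j l)
        simp only [twistedProd, Finset.mul_sum, Finset.smul_sum, mul_smul_comm, smul_smul] at this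
        rw [Finset.sum_congr rfl fun k _ => ?_, this]
        · split_ifs with hik
          · subst hik
            rw [mul_smul_comm, smul_smul, mul_assoc, inv_mul_cancel₀ (hd j), mul_one]
          · simp
        · rw [mul_assoc (M j i), sg_comm p j k]
          congr 1
          ring
      simp [this]
    exact smul_right_injective A (sg_ne_zero p l i) (e1.symm.trans e2)

end RevOp

end Transposition

/-! ### Removing the first index -/

section FirstIndex

variable {K A : Type*} [Field K] [Ring A] [Algebra K A] {σ : Scaling K A} {q : K}

section Peel

variable {n : ℕ} {p : Fin (n + 1) → Bool} {L M : Matrix (Fin (n + 1)) (Fin (n + 1)) A}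

/-- The Schur complement of the upper left entry of `L`, whose inverse is `h'`. -/
def schur (h' : A) (L : Matrix (Fin (n + 1)) (Fin (n + 1)) A) : Matrix (Fin n) (Fin n) A :=
  fun i j => L i.succ j.succ - L i.succ 0 * h' * L 0 j.succ

theorem map_schur (h' : A) (f : A →ₐ[K] A) :
    (schur h' L).map f = schur (f h') (L.map f) := by
  ext i j
  simp [schur]

theorem schur_mul_submatrix {h' : A} (hh : h' * L 0 0 = 1) (hLM : L * M = 1) :
    schur h' L * M.submatrix Fin.succ Fin.succ = 1 := by
  ext i k
  have e1 := congrFun (congrFun hLM i.succ) k.succ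
  have e2 := congrFun (congrFun hLM 0) k.succ
  rw [Matrix.mul_apply, Fin.sum_univ_succ] at e1 e2
  simp only [Matrix.one_apply, Fin.succ_inj, (Fin.succ_ne_zero k).symm, if_false] at e1 e2
  simp only [Matrix.mul_apply, schur, Matrix.submatrix_apply, sub_mul, Finset.sum_sub_distrib,
    mul_assoc, ← Finset.mul_sum, Matrix.one_apply]
  rw [eq_neg_of_add_eq_zero_right e2, eq_sub_of_add_eq' e1, mul_neg, mul_neg, ← mul_assoc h', hh,
    one_mul]
  abel

theorem submatrix_mul_schur {h' : A} (hh : L 0 0 * h' = 1) (hML : M * L = 1) :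
    M.submatrix Fin.succ Fin.succ * schur h' L = 1 := by
  ext i k
  have e1 := congrFun (congrFun hML i.succ) k.succ
  have e2 := congrFun (congrFun hML i.succ) 0
  rw [Matrix.mul_apply, Fin.sum_univ_succ] at e1 e2
  simp only [Matrix.one_apply, Fin.succ_inj, Fin.succ_ne_zero, if_false] at e1 e2
  simp only [Matrix.mul_apply, schur, Matrix.submatrix_apply, mul_sub, Finset.sum_sub_distrib,
    ← mul_assoc, ← Finset.sum_mul, Matrix.one_apply]
  rw [eq_neg_of_add_eq_zero_right e2, eq_sub_of_add_eq' e1, neg_mul, neg_mul,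
    mul_assoc (M i.succ 0) (L 0 0), hh, mul_one]
  abel

theorem rDiag_succ (z w : K) (a c : Fin n) :
    rDiag (p ∘ Fin.succ) q z w a c = rDiag p q z w a.succ c.succ := by
  simp [rDiag, qpar]

theorem rOff_succ (z w : K) (a c : Fin n) :
    rOff q z w a c = rOff q z w a.succ c.succ := by
  simp [rOff]

theorem IsLLR.submatrix_succ {z w : K} {X Y : Matrix (Fin (n + 1)) (Fin (n + 1)) A}
    (h : IsLLR p q z w X Y) : IsLLR (p ∘ Fin.succ) q z w (X.submatrix Fin.succ Fin.succ)
      (Y.submatrix Fin.succ Fin.succ) := by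
  rw [isLLR_iff] at h ⊢
  intro a c b d
  have := h a.succ c.succ b.succ d.succ
  rw [← rDiag_succ, ← rDiag_succ, ← rOff_succ, ← rOff_succ] at this
  exact this

theorem map_mul_map_eq_one {ι : Type*} [Fintype ι] [DecidableEq ι] {X Y : Matrix ι ι A}
    (h : X * Y = 1) (f : A →ₐ[K] A) : X.map f * Y.map f = 1 := by
  rw [← Matrix.map_mul, h, Matrix.map_one _ (map_zero f) (map_one f)]

/-- The Schur complement satisfies the same relations, because its inverse is a submatrix of the
inverse of `L` and the relation for inverses passes to submatrices. -/
theorem IsSystem.schur {h' : A} (h : IsSystem σ p q L M) (h1 : h' * L 0 0 = 1)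
    (h2 : L 0 0 * h' = 1) :
    IsSystem σ (p ∘ Fin.succ) q (schur h' L) (M.submatrix Fin.succ Fin.succ) where
  mul_inv := schur_mul_submatrix h1 h.mul_inv
  inv_mul := submatrix_mul_schur h2 h.inv_mul
  rll a b := by
    have e1 := schur_mul_submatrix h1 h.mul_inv
    have e2 := submatrix_mul_schur h2 h.inv_mul
    exact (((h.rll a b).inverse (map_mul_map_eq_one h.mul_inv _) (map_mul_map_eq_one h.inv_mul _)
      (map_mul_map_eq_one h.mul_inv _) (map_mul_map_eq_one h.inv_mul _)).submatrix_succ).inverse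
      (map_mul_map_eq_one e2 _) (map_mul_map_eq_one e1 _)
      (map_mul_map_eq_one e2 _) (map_mul_map_eq_one e1 _)

theorem HasLastMinors.submatrix_succ (h : HasLastMinors M) :
    HasLastMinors (M.submatrix Fin.succ Fin.succ) := by
  intro k m hk
  have := h (k := k + 1) (m := m) (by omega)
  convert this using 1
  ext i j
  simp only [Matrix.submatrix_apply]
  congr 1 <;> ext <;> simp [lastIdx] <;> omega

theorem bijective_firstIdx_lastIdx {k m n : ℕ} (h : k + m = n) :
    Function.Bijective (Sum.elim (firstIdx h) (lastIdx h)) := by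
  constructor
  · rintro (a | a) (b | b) hab <;> simp [firstIdx, lastIdx, Fin.ext_iff] at hab ⊢ <;> omega
  · intro i
    by_cases hi : (i : ℕ) < k
    · exact ⟨Sum.inl ⟨i, hi⟩, rfl⟩
    · refine ⟨Sum.inr ⟨i - k, by omega⟩, ?_⟩
      ext
      simp [lastIdx]
      omega

theorem HasLastMinors.isUnit_submatrix_firstIdx {n k m : ℕ} {L M : Matrix (Fin n) (Fin n) A}
    (h : HasLastMinors M) (hLM : L * M = 1) (hML : M * L = 1) (hk : k + m = n) :
    IsUnit (L.submatrix (firstIdx hk) (firstIdx hk)) :=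
  isUnit_submatrix_of_compl (bijective_firstIdx_lastIdx hk) hLM hML (h hk)

theorem HasLastMinors.isUnit_corner (h : HasLastMinors M) (hLM : L * M = 1) (hML : M * L = 1) :
    IsUnit (L 0 0) := by
  have := h.isUnit_submatrix_firstIdx hLM hML (k := 1) (m := n) (by omega)
  obtain ⟨U, h1, h2⟩ := isUnit_iff_exists.1 this
  have e1 := congrFun (congrFun h1 0) 0
  have e2 := congrFun (congrFun h2 0) 0
  simp only [Matrix.mul_apply, Fin.sum_univ_succ, Finset.univ_eq_empty, Finset.sum_empty, add_zero,
    Matrix.one_apply_eq, Matrix.submatrix_apply] at e1 e2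
  exact isUnit_iff_exists.2 ⟨U 0 0, e1, e2⟩

section Commute

theorem commute_of_commute_inverse {ι : Type*} [Fintype ι] [DecidableEq ι] {X Y : Matrix ι ι A}
    (hXY : X * Y = 1) (hYX : Y * X = 1) {a : A} (h : ∀ i j, Commute a (Y i j)) (i j : ι) :
    Commute a (X i j) := by
  have e1 : Y * Matrix.diagonal (fun _ => a) = Matrix.diagonal (fun _ => a) * Y := by
    ext i j
    rw [Matrix.mul_diagonal, Matrix.diagonal_mul]
    exact (h i j).symm
  have e2 : X * Matrix.diagonal (fun _ => a) = Matrix.diagonal (fun _ => a) * X := by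
    calc X * Matrix.diagonal (fun _ => a) = X * (Matrix.diagonal (fun _ => a) * Y) * X := by
          rw [mul_assoc, mul_assoc, hYX, mul_one]
      _ = _ := by rw [← e1, ← mul_assoc, hXY, one_mul]
  have := congrFun (congrFun e2 i) j
  rw [Matrix.mul_diagonal, Matrix.diagonal_mul] at this
  exact this.symm

/-- For an even first index, the upper left entry of `L` commutes with the inverse matrix away from
the first row and column. At equal arguments the coefficient of the relation is zero, and density is
used. -/
theorem IsSystem.commute_corner_inv (h : IsSystem σ p q L M) (hp : p 0 = false)
    (c : Kˣ) (i j : Fin n) :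
    Commute (L 0 0) (σ.scale c (M i.succ j.succ)) := by
  have key : ∀ c, c ≠ 1 → Commute (L 0 0) (σ.scale c (M i.succ j.succ)) := by
    intro c hc
    have hrll := h.rll 1 c
    have := hrll.mixed (map_mul_map_eq_one h.mul_inv _) (map_mul_map_eq_one h.inv_mul _) 0 i.succ 0
      j.succ
    simp only [sg, hp, Bool.and_false, rDiag, (Fin.succ_ne_zero _).symm, if_false,
      Matrix.map_apply, σ.scale_one, Units.val_one] at this
    have hc' : (1 : K) - c ≠ 0 := sub_ne_zero.2 fun h' => hc (Units.ext h'.symm)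
    have := smul_right_injective A hc' (a₁ := σ.scale c (M i.succ j.succ) * L 0 0)
      (a₂ := L 0 0 * σ.scale c (M i.succ j.succ)) (by simpa using this)
    exact this.symm
  by_cases hc : c = 1
  · subst hc
    exact Scaling.commute_of_forall_ne 1 key
  · exact key c hc

/-- The upper left entry commutes with its Schur complement, whose inverse is a submatrix of
`L⁻¹`. -/
theorem IsSystem.commute_corner_schur (h : IsSystem σ p q L M) (hp : p 0 = false)
    {h' : A} (h1 : h' * L 0 0 = 1) (h2 : L 0 0 * h' = 1) (c : Kˣ)
    (i j : Fin n) : Commute (L 0 0) (σ.scale c (QuantumLiouville.schur h' L i j)) := by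
  have e1 := schur_mul_submatrix h1 h.mul_inv
  have e2 := submatrix_mul_schur h2 h.inv_mul
  exact commute_of_commute_inverse (map_mul_map_eq_one e1 (σ.scale c))
    (map_mul_map_eq_one e2 (σ.scale c)) (fun i j => h.commute_corner_inv hp c i j) i j

/-- The values of an even upper left entry commute with each other. The coefficient of the relation
is zero for `c = q²`, where density is used. -/
theorem IsSystem.commute_corner_corner (h : IsSystem σ p q L M) (hp : p 0 = false)
    (hq : q ≠ 0) (c : Kˣ) :
    Commute (L 0 0) (σ.scale c (L 0 0)) := by
  let c₀ : Kˣ := (Units.mk0 q hq) ^ 2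
  have key : ∀ c, c ≠ c₀ → Commute (L 0 0) (σ.scale c (L 0 0)) := by
    intro c hc
    have := isRLL_iff.1 (h.rll 1 c) 0 0 0 0
    simp only [sg, hp, rDiag, rOff, qpar, if_true, Matrix.map_apply, σ.scale_one, Units.val_one,
      Bool.and_false, mul_zero, zero_smul, add_zero, one_mul] at this
    have hc' : q - c * q⁻¹ ≠ 0 := by
      intro h'
      apply hc
      ext
      simp only [c₀, Units.val_pow_eq_pow_val, Units.val_mk0]
      field_simp at h'
      linear_combination -h'
    exact smul_right_injective A hc' (by simpa using this)
  by_cases hc : c = c₀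
  · subst hc
    exact Scaling.commute_of_forall_ne c₀ key
  · exact key c hc

end Commute

theorem Scaling.commute_scale {x y : A} (h : ∀ c, Commute x (σ.scale c y)) (a b : Kˣ) :
    Commute (σ.scale a x) (σ.scale b y) := by
  have := (h (a⁻¹ * b)).map (σ.scale a)
  rwa [σ.scale_scale, mul_inv_cancel_left] at this

/-- The two-by-two minors with an even first row and column, at `z` and `q² z`, factor in two ways
into an entry and a quasideterminant. -/
theorem IsRLL.corner_mul_schur {z w : K} {X Y : Matrix (Fin (n + 1)) (Fin (n + 1)) A}
    (h : IsRLL p q z w X Y) (hp : p 0 = false) (hq : q ≠ 0) (hq2 : q ^ 2 ≠ 1) (hz : z ≠ 0)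
    (hw : w = q ^ 2 * z) {x y : A} (hx : X 0 0 * x = 1) (hy : Y 0 0 * y = 1)
    (j i : Fin n) :
    X 0 0 * QuantumLiouville.schur y Y j i = Y 0 0 * (X j.succ i.succ -
      sg K p j.succ i.succ • (X 0 i.succ * x * X j.succ 0)) := by
  -- For `w = q² z` the R-matrix degenerates, and the exchange relations become linear relations
  -- between two-by-two minors.
  have hr : rDiag p q z w 0 0 = 0 := by
    simp only [rDiag, if_true, qpar, hp, hw]
    field_simp
    simp
  have hk : q - q⁻¹ ≠ 0 := by
    intro h'
    apply hq2
    field_simp at h'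
    linear_combination h'
  have hk' : (q - q⁻¹) * z ≠ 0 := mul_ne_zero hk hz
  have hzw : z - w = -q * ((q - q⁻¹) * z) := by
    rw [hw]; field_simp; ring
  have hzw' : (q - q⁻¹) * w = q ^ 2 * ((q - q⁻¹) * z) := by
    rw [hw]; ring
  rw [isRLL_iff] at h
  have e1 := h 0 j.succ 0 0
  have e2 := h 0 0 0 i.succ
  have e4 := h j.succ 0 0 i.succ
  have r1 : rDiag p q z w 0 j.succ = z - w := by simp [rDiag, (Fin.succ_ne_zero j).symm]
  have r2 : rDiag p q z w 0 i.succ = z - w := by simp [rDiag, (Fin.succ_ne_zero i).symm]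
  have r3 : rDiag p q z w j.succ 0 = z - w := by simp [rDiag]
  have k1 : rOff q z w 0 j.succ = (q - q⁻¹) * z := by
    simp [rOff, (Fin.succ_ne_zero j).symm]
  have k2 : rOff q z w i.succ 0 = (q - q⁻¹) * w := by simp [rOff]
  have k3 : rOff q z w j.succ 0 = (q - q⁻¹) * w := by simp [rOff]
  have k4 : rOff q z w (0 : Fin (n + 1)) 0 = 0 := by simp [rOff]
  have s0 : ∀ a, sg K p a 0 = 1 := by simp [sg, hp]
  have s0' : ∀ a, sg K p 0 a = 1 := by simp [sg, hp]
  simp only [s0, s0', r1, r2, r3, k1, k2, k3, k4, hr, hzw, hzw'] at e1 e2 e4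
  generalize (q - q⁻¹) * z = κ at *
  -- The first column, the first row, and the two-by-two minor with rows `0, j` and columns
  -- `0, i`.
  have f1 : X 0 0 * Y j.succ 0 = q⁻¹ • (X j.succ 0 * Y 0 0) := by
    refine smul_right_injective A (mul_ne_zero hq hk') ?_
    simp only
    linear_combination (norm := skip) (-1 : K) • e1
    match_scalars <;> field_simp <;> ring
  have f2 : Y 0 i.succ * X 0 0 = q • (Y 0 0 * X 0 i.succ) := by
    refine smul_right_injective A (mul_ne_zero hq hk') ?_
    simp only
    linear_combination (norm := skip) (1 : K) • e2
    match_scalars <;> field_simp <;> ring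
  have f4 : X 0 0 * Y j.succ i.succ - q⁻¹ • (X j.succ 0 * Y 0 i.succ) =
      Y 0 0 * X j.succ i.succ - (q⁻¹ * sg K p j.succ i.succ) • (Y 0 i.succ * X j.succ 0) := by
    refine smul_right_injective A (mul_ne_zero (pow_ne_zero 2 hq) hk') ?_
    simp only [sg_comm p j.succ i.succ] at e4 ⊢
    linear_combination (norm := skip) (1 : K) • e4
    match_scalars <;> field_simp <;> ring
  have g1 : X 0 0 * (Y j.succ 0 * y) = q⁻¹ • X j.succ 0 := by
    rw [← mul_assoc, f1, smul_mul_assoc, mul_assoc, hy, mul_one]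
  have g2 : Y 0 0 * (X 0 i.succ * x) = q⁻¹ • Y 0 i.succ := by
    have := congrArg (fun a => q⁻¹ • (a * x)) f2
    simp only [smul_mul_assoc, mul_assoc, hx, mul_one, inv_smul_smul₀ hq] at this
    exact this.symm
  rw [QuantumLiouville.schur, mul_sub, mul_sub, mul_smul_comm, ← mul_assoc (X 0 0) (_ * _), g1,
    ← mul_assoc (Y 0 0) (_ * _), g2, smul_mul_assoc, smul_mul_assoc, f4, smul_smul,
    mul_comm q⁻¹]

/-- Removing an even first index multiplies the scalar series by the ratio of two values of the
upper left entry. -/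
theorem IsSystem.twistedProd_schur {ω : ℕ → K} (h : IsSystem σ p q L M)
    (hp : p 0 = false) (hq : q ≠ 0) (hq2 : q ^ 2 ≠ 1) {h' : A} (h1 : h' * L 0 0 = 1)
    (h2 : L 0 0 * h' = 1) {u u' : Kˣ} (hu : (u' : K) = q ^ 2 * u) {Z : A}
    (hZ : ∀ i k, twistedProd σ p q ω L M i k u = if i = k then dWeight p q ω i • Z else 0)
    (i k : Fin n) :
    twistedProd σ (p ∘ Fin.succ) q (fun i => ω (i + 1)) (QuantumLiouville.schur h' L)
      (M.submatrix Fin.succ Fin.succ) i k u' =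
    if i = k then dWeight (p ∘ Fin.succ) q (fun i => ω (i + 1)) i •
      (σ.scale u h' * σ.scale u' (L 0 0) * Z) else 0 := by
  have hx : σ.scale u h' * σ.scale u (L 0 0) = 1 := by rw [← map_mul, h1, map_one]
  have hx' : σ.scale u (L 0 0) * σ.scale u h' = 1 := by rw [← map_mul, h2, map_one]
  have hy : σ.scale u' (L 0 0) * σ.scale u' h' = 1 := by rw [← map_mul, h2, map_one]
  have key := fun j => (h.rll u u').corner_mul_schur hp hq hq2 u.ne_zero hu hx' hy j i
  have e1 := hZ i.succ k.succ
  have e2 := hZ 0 k.succ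
  rw [twistedProd, Fin.sum_univ_succ] at e1 e2
  simp only [(Fin.succ_ne_zero k).symm, if_false, Fin.succ_inj] at e1 e2
  have s0 : ∀ a, sg K p a 0 = 1 := by simp [sg, hp]
  have s0' : ∀ a, sg K p 0 a = 1 := by simp [sg, hp]
  simp only [s0, s0', one_mul] at e1 e2
  have hs : ∀ x y, sg K (p ∘ Fin.succ) x y = sg K p x.succ y.succ := fun _ _ => rfl
  have hd : ∀ x, dWeight (p ∘ Fin.succ) q (fun i => ω (i + 1)) x = dWeight p q ω x.succ :=
    fun _ => rfl
  have key2 : ∀ j, σ.scale u' (QuantumLiouville.schur h' L j i) = σ.scale u h' * σ.scale u' (L 0 0) *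
      (σ.scale u (L j.succ i.succ) - sg K p j.succ i.succ •
        (σ.scale u (L 0 i.succ) * σ.scale u h' * σ.scale u (L j.succ 0))) := by
    intro j
    have hj := congrArg (fun a => σ.scale u h' * a) (key j)
    simp only [Matrix.map_apply, ← mul_assoc, hx, one_mul] at hj
    rw [← hj, ← map_schur]
    rfl
  -- The entry `(0, k)` of `L(uz)^st D (L(z)⁻¹)^st` is zero.
  have e3 : ∑ j : Fin n, (sg K p j.succ k.succ * dWeight p q ω j.succ) •
      (σ.scale u h' * (σ.scale u (L j.succ 0) * M k.succ j.succ)) =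
      -(dWeight p q ω 0 • M k.succ 0) := by
    have := congrArg (fun a => σ.scale u h' * a) (eq_neg_of_add_eq_zero_right e2)
    simp only [Finset.mul_sum, mul_smul_comm, mul_neg, ← mul_assoc, hx, one_mul] at this
    simpa only [← mul_assoc] using this
  simp only [twistedProd, hs, hd, key2, Matrix.submatrix_apply]
  have e4 : ∀ j : Fin n, (sg K p j.succ i.succ * sg K p j.succ k.succ * dWeight p q ω j.succ) •
      (σ.scale u h' * σ.scale u' (L 0 0) *
      (σ.scale u (L j.succ i.succ) - sg K p j.succ i.succ •
        (σ.scale u (L 0 i.succ) * σ.scale u h' * σ.scale u (L j.succ 0))) * M k.succ j.succ) =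
      σ.scale u h' * σ.scale u' (L 0 0) *
        ((sg K p j.succ i.succ * sg K p j.succ k.succ * dWeight p q ω j.succ) •
          (σ.scale u (L j.succ i.succ) * M k.succ j.succ) -
        σ.scale u (L 0 i.succ) * ((sg K p j.succ k.succ * dWeight p q ω j.succ) •
      (σ.scale u h' * (σ.scale u (L j.succ 0) * M k.succ j.succ)))) := by
    intro j
    simp only [mul_sub, sub_mul, smul_sub, mul_smul_comm, smul_mul_assoc, smul_smul, mul_assoc]
    congr 2
    linear_combination (sg K p j.succ k.succ * dWeight p q ω j.succ) *
      sg_mul_self (K := K) p j.succ i.succ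
  simp only [e4]
  rw [← Finset.mul_sum, Finset.sum_sub_distrib, ← Finset.mul_sum, e3, eq_sub_of_add_eq' e1,
    mul_neg, mul_smul_comm]
  by_cases hik : i = k
  · simp [hik]
  · simp [hik]

end Peel

end FirstIndex

/-! ### Quantum determinants -/

section QuantumDeterminants

open QuantumAffineSuper (len)

variable {K A : Type*} [Field K] [Ring A] [Algebra K A]

section Len

/-- A transposition of adjacent positions that creates an inversion increases the length by one. -/
theorem len_mul_swap {n : ℕ} (τ : Equiv.Perm (Fin n)) {k k' : Fin n} (hk : (k' : ℕ) = k + 1)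
    (h : τ k < τ k') : len (τ * Equiv.swap k k') = len τ + 1 := by
  have hne : k ≠ k' := fun hh => by rw [hh] at hk; omega
  have hlt : ∀ a b : Fin n, a < b → (a, b) ≠ (k, k') →
      Equiv.swap k k' a < Equiv.swap k k' b := by
    intro a b hab hne'
    have h1 : ¬ (a = k ∧ b = k') := fun hh => hne' (by rw [hh.1, hh.2])
    simp only [Equiv.swap_apply_def]
    simp only [Fin.ext_iff, Fin.lt_def] at *
    split_ifs <;> omega
  have hmem : (k, k') ∈ Finset.univ.filter fun p : Fin n × Fin n =>
      p.1 < p.2 ∧ (τ * Equiv.swap k k') p.2 < (τ * Equiv.swap k k') p.1 := by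
    rw [Finset.mem_filter]
    simp only [Finset.mem_univ, true_and, Equiv.Perm.mul_apply,
      Equiv.swap_apply_left, Equiv.swap_apply_right]
    exact ⟨by rw [Fin.lt_def]; omega, h⟩
  unfold len
  rw [← Finset.card_erase_add_one hmem]
  congr 1
  refine Finset.card_nbij' (fun p => (Equiv.swap k k' p.1, Equiv.swap k k' p.2))
    (fun p => (Equiv.swap k k' p.1, Equiv.swap k k' p.2)) ?_ ?_ ?_ ?_
  · rintro ⟨a, b⟩ hab
    rw [Finset.mem_coe, Finset.mem_erase, Finset.mem_filter] at hab
    rw [Finset.mem_coe, Finset.mem_filter]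
    exact ⟨Finset.mem_univ _, hlt a b hab.2.2.1 hab.1, hab.2.2.2⟩
  · rintro ⟨a, b⟩ hab
    rw [Finset.mem_coe, Finset.mem_filter] at hab
    rw [Finset.mem_coe, Finset.mem_erase, Finset.mem_filter]
    simp only [Finset.mem_univ, true_and, Equiv.Perm.mul_apply, Equiv.swap_apply_self] at hab ⊢
    refine ⟨?_, hlt a b hab.1 ?_, hab.2⟩
    · intro hh
      have e1 : a = k' := by
        rw [← Equiv.swap_apply_self k k' a, (Prod.mk.inj hh).1, Equiv.swap_apply_left]
      have e2 : b = k := by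
        rw [← Equiv.swap_apply_self k k' b, (Prod.mk.inj hh).2, Equiv.swap_apply_right]
      have := hab.1
      rw [e1, e2, Fin.lt_def] at this
      omega
    · intro hh
      rw [(Prod.mk.inj hh).1, (Prod.mk.inj hh).2] at hab
      exact hab.2.not_gt h
  · rintro ⟨a, b⟩ _
    simp
  · rintro ⟨a, b⟩ _
    simp

theorem len_decomposeFin_symm_zero {n : ℕ} (τ : Equiv.Perm (Fin n)) :
    len (Equiv.Perm.decomposeFin.symm (0, τ)) = len τ := by
  have h0 : Equiv.Perm.decomposeFin.symm (0, τ) 0 = 0 := by simp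
  have hs : ∀ x : Fin n, Equiv.Perm.decomposeFin.symm (0, τ) x.succ = (τ x).succ := by
    intro x; simp
  unfold len
  symm
  refine Finset.card_bij (fun p _ => (p.1.succ, p.2.succ)) ?_ ?_ ?_
  · rintro ⟨a, b⟩ hab
    simpa [hs] using hab
  · rintro ⟨a, b⟩ _ ⟨a', b'⟩ _ hh
    simpa using hh
  · rintro ⟨a, b⟩ hab
    simp only [Finset.mem_filter, Finset.mem_univ, true_and] at hab
    induction a using Fin.cases with
    | zero =>
      rw [h0] at hab
      exact absurd hab.2 (Fin.not_lt_zero _)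
    | succ a =>
      induction b using Fin.cases with
      | zero => exact absurd hab.1 (Fin.not_lt_zero _)
      | succ b =>
        refine ⟨(a, b), ?_, rfl⟩
        simpa [hs] using hab

/-- Conjugation with the longest permutation preserves the length. -/
theorem len_rev_conj {n : ℕ} (τ : Equiv.Perm (Fin n)) :
    len (Fin.revPerm * τ * Fin.revPerm) = len τ := by
  unfold len
  refine Finset.card_nbij' (fun p => (p.2.rev, p.1.rev)) (fun p => (p.2.rev, p.1.rev)) ?_ ?_ ?_ ?_
  · rintro ⟨a, b⟩ hab
    simpa [Fin.rev_lt_rev] using hab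
  · rintro ⟨a, b⟩ hab
    simpa [Fin.rev_lt_rev] using hab
  · rintro ⟨a, b⟩ _
    simp
  · rintro ⟨a, b⟩ _
    simp

end Len

/-- The quantum determinant of the matrix with columns `V 0, …, V (n-1)`, in this order. -/
noncomputable def qdet (q : K) {n : ℕ} (V : Fin n → Fin n → A) : A :=
  ∑ τ : Equiv.Perm (Fin n), ((-q)⁻¹ ^ len τ) • (List.ofFn fun k => V k (τ k)).prod

/-- The factors before and after position `k` of an ordered product, which do not depend on the
factor at `k`. -/
theorem exists_prod_ofFn_split {n : ℕ} (k : Fin n) :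
    ∃ P S : (Fin n → A) → A, (∀ f, (List.ofFn f).prod = P f * f k * S f) ∧
      ∀ f g : Fin n → A, (∀ i, i ≠ k → f i = g i) → P f = P g ∧ S f = S g := by
  obtain ⟨k, hk⟩ := k
  obtain ⟨m, rfl⟩ := Nat.exists_eq_add_of_lt hk
  refine ⟨fun f => (List.ofFn fun i : Fin k => f ⟨i, by omega⟩).prod,
    fun f => (List.ofFn fun i : Fin m => f ⟨k + 1 + i, by omega⟩).prod, fun f => ?_,
    fun f g h => ⟨?_, ?_⟩⟩
  · have := List.ofFn_add (n := k) (m := m + 1) (f := f)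
    rw [this, List.prod_append, List.ofFn_succ, List.prod_cons, mul_assoc]
    congr 4
    funext i
    congr 1
    ext
    simp
    omega
  · beta_reduce
    congr 2
    funext i
    refine h _ (fun hh => ?_)
    have := Fin.mk.inj hh
    have := i.isLt
    omega
  · beta_reduce
    congr 2
    funext i
    refine h _ (fun hh => ?_)
    have := Fin.mk.inj hh
    have := i.isLt
    omega

/-- The factors before and after two adjacent positions of an ordered product, which do not depend
on the factors there. -/
theorem exists_prod_ofFn_split₂ {n : ℕ} {k k' : Fin n} (hkk : (k' : ℕ) = k + 1) :
    ∃ P S : (Fin n → A) → A, (∀ f, (List.ofFn f).prod = P f * (f k * f k') * S f) ∧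
      ∀ f g : Fin n → A, (∀ i, i ≠ k → i ≠ k' → f i = g i) → P f = P g ∧ S f = S g := by
  obtain ⟨k, hk⟩ := k
  obtain ⟨k', hk'⟩ := k'
  simp only at hkk
  subst hkk
  obtain ⟨m, rfl⟩ := Nat.exists_eq_add_of_lt hk'
  refine ⟨fun f => (List.ofFn fun i : Fin k => f ⟨i, by omega⟩).prod,
    fun f => (List.ofFn fun i : Fin m => f ⟨k + 2 + i, by omega⟩).prod, fun f => ?_,
    fun f g h => ⟨?_, ?_⟩⟩
  · have e : k + 1 + m + 1 = k + (m + 1 + 1) := by omega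
    have := List.ofFn_add (n := k) (m := m + 1 + 1)
      (f := fun i => f (Fin.cast e.symm i))
    have e2 : List.ofFn f = List.ofFn (fun i => f (Fin.cast e.symm i)) := by
      rw [List.ofFn_congr e]
    rw [e2, this, List.prod_append, List.ofFn_succ, List.prod_cons, List.ofFn_succ,
      List.prod_cons, mul_assoc, mul_assoc]
    congr 5
    funext i
    congr 1
    ext
    simp
    omega
  · beta_reduce
    congr 2
    funext i
    refine h _ (fun hh => ?_) (fun hh => ?_)
    all_goals
      have := Fin.mk.inj hh
      have := i.isLt
      omega
  · beta_reduce
    congr 2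
    funext i
    refine h _ (fun hh => ?_) (fun hh => ?_)
    all_goals
      have := Fin.mk.inj hh
      have := i.isLt
      omega

/-- The quantum determinant is additive in each column. -/
theorem qdet_sub {q : K} {n : ℕ} {V W U : Fin n → Fin n → A} (k : Fin n)
    (h1 : ∀ i, i ≠ k → V i = W i) (h2 : ∀ i, i ≠ k → V i = U i)
    (h : ∀ r, V k r = W k r - U k r) : qdet q V = qdet q W - qdet q U := by
  obtain ⟨P, S, hPS, hc⟩ := exists_prod_ofFn_split (A := A) k
  simp only [qdet, hPS, ← Finset.sum_sub_distrib, ← smul_sub]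
  refine Finset.sum_congr rfl fun τ _ => ?_
  obtain ⟨a1, a2⟩ := hc (fun k => V k (τ k)) (fun k => W k (τ k)) fun i hi => by rw [h1 i hi]
  obtain ⟨b1, b2⟩ := hc (fun k => V k (τ k)) (fun k => U k (τ k)) fun i hi => by rw [h2 i hi]
  rw [← a1, ← a2, ← b1, ← b2, h, mul_sub, sub_mul]

/-- Expansion of the quantum determinant by two-by-two minors of adjacent columns `k` and `k + 1`,
which pairs `τ` with `τ (k k+1)`. -/
theorem qdet_eq_sum_lt {q : K} {n : ℕ} (V : Fin n → Fin n → A) {k k' : Fin n}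
    (hkk : (k' : ℕ) = k + 1) {P S : (Fin n → A) → A}
    (hPS : ∀ f, (List.ofFn f).prod = P f * (f k * f k') * S f)
    (hc : ∀ f g : Fin n → A, (∀ i, i ≠ k → i ≠ k' → f i = g i) → P f = P g ∧ S f = S g) :
    qdet q V = ∑ τ ∈ Finset.univ.filter (fun τ : Equiv.Perm (Fin n) => τ k < τ k'),
      ((-q)⁻¹ ^ len τ) • (P (fun k => V k (τ k)) *
        (V k (τ k) * V k' (τ k') - q⁻¹ • (V k (τ k') * V k' (τ k))) * S (fun k => V k (τ k))) := by
  have hne : k ≠ k' := fun hh => by rw [hh] at hkk; omega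
  rw [qdet, ← Finset.sum_filter_add_sum_filter_not _ (fun τ : Equiv.Perm (Fin n) => τ k < τ k')]
  have e : ∑ τ ∈ Finset.univ.filter (fun τ : Equiv.Perm (Fin n) => ¬ τ k < τ k'),
      ((-q)⁻¹ ^ len τ) • (List.ofFn fun k => V k (τ k)).prod =
      ∑ τ ∈ Finset.univ.filter (fun τ : Equiv.Perm (Fin n) => τ k < τ k'),
      ((-q)⁻¹ ^ (len τ + 1)) • (P (fun k => V k (τ k)) *
        (V k (τ k') * V k' (τ k)) * S (fun k => V k (τ k))) := by
    symm
    refine Finset.sum_nbij' (fun τ => τ * Equiv.swap k k') (fun τ => τ * Equiv.swap k k')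
      ?_ ?_ ?_ ?_ ?_
    · intro τ hτ
      simp only [Finset.mem_filter, Finset.mem_univ, true_and, Equiv.Perm.mul_apply,
        Equiv.swap_apply_left, Equiv.swap_apply_right] at hτ ⊢
      exact hτ.not_gt
    · intro τ hτ
      simp only [Finset.mem_filter, Finset.mem_univ, true_and, Equiv.Perm.mul_apply,
        Equiv.swap_apply_left, Equiv.swap_apply_right] at hτ ⊢
      exact lt_of_le_of_ne (not_lt.1 hτ) (fun hh => hne (τ.injective hh).symm)
    · intro τ _
      rw [mul_assoc, Equiv.swap_mul_self, mul_one]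
    · intro τ _
      rw [mul_assoc, Equiv.swap_mul_self, mul_one]
    · intro τ hτ
      rw [len_mul_swap τ hkk (by simpa using hτ), hPS]
      obtain ⟨a1, a2⟩ := hc (fun k => V k (τ k)) (fun i => V i ((τ * Equiv.swap k k') i))
        fun i hi hi' => by
          rw [Equiv.Perm.mul_apply, Equiv.swap_apply_of_ne_of_ne hi hi']
      rw [← a1, ← a2]
      simp only [Equiv.Perm.mul_apply, Equiv.swap_apply_left, Equiv.swap_apply_right]
  rw [e, ← Finset.sum_add_distrib]
  refine Finset.sum_congr rfl fun τ _ => ?_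
  rw [hPS, pow_succ, mul_smul, ← smul_add, mul_sub, sub_mul, mul_smul_comm, smul_mul_assoc,
    sub_eq_add_neg, inv_neg, neg_smul]

/-- A linear relation between the two-by-two minors of two adjacent columns carries over to the
quantum determinants. -/
theorem qdet_eq_smul_of_minors {q : K} {n : ℕ} {V W : Fin n → Fin n → A} {k k' : Fin n}
    (hkk : (k' : ℕ) = k + 1) (hVW : ∀ i, i ≠ k → i ≠ k' → V i = W i) (c : K)
    (h : ∀ a b, a < b → V k a * V k' b - q⁻¹ • (V k b * V k' a) =
      c • (W k a * W k' b - q⁻¹ • (W k b * W k' a))) :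
    qdet q V = c • qdet q W := by
  obtain ⟨P, S, hPS, hc⟩ := exists_prod_ofFn_split₂ (A := A) hkk
  rw [qdet_eq_sum_lt V hkk hPS hc, qdet_eq_sum_lt W hkk hPS hc, Finset.smul_sum]
  refine Finset.sum_congr rfl fun τ hτ => ?_
  obtain ⟨a1, a2⟩ := hc (fun k => V k (τ k)) (fun k => W k (τ k))
    fun i hi hi' => by rw [hVW i hi hi']
  rw [a1, a2, h _ _ (by simpa using hτ), mul_smul_comm, smul_mul_assoc, smul_comm]

/-- Expansion along the first row if only its first entry is not zero. -/
theorem qdet_eq_corner_mul {q : K} {n : ℕ} (V : Fin (n + 1) → Fin (n + 1) → A)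
    (h : ∀ k : Fin n, V k.succ 0 = 0) :
    qdet q V = V 0 0 * qdet q (fun k i => V k.succ i.succ) := by
  rw [qdet, ← Equiv.sum_comp Equiv.Perm.decomposeFin.symm, Fintype.sum_prod_type,
    Finset.sum_eq_single 0]
  · rw [qdet, Finset.mul_sum]
    refine Finset.sum_congr rfl fun τ _ => ?_
    rw [len_decomposeFin_symm_zero, List.ofFn_succ, List.prod_cons, mul_smul_comm]
    simp
  · intro j _ hj
    refine Finset.sum_eq_zero fun τ _ => ?_
    obtain ⟨k, hk⟩ := (Equiv.Perm.decomposeFin.symm (j, τ)).surjective 0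
    have hk0 : k ≠ 0 := by
      rintro rfl
      rw [Equiv.Perm.decomposeFin_symm_apply_zero] at hk
      exact hj hk
    obtain ⟨i, rfl⟩ := Fin.exists_succ_eq.2 hk0
    obtain ⟨P, S, hPS, -⟩ := exists_prod_ofFn_split (A := A) i.succ
    rw [hPS, hk, h, mul_zero, zero_mul, smul_zero]
  · simp

section Columns

variable {σ : Scaling K A} {q : K}

/-- A two-by-two quantum minor with equal columns vanishes. -/
theorem IsRLL.minor_eq_zero {ι : Type*} [LinearOrder ι] [Fintype ι] {z w : K} {X Y : Matrix ι ι A}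
    (h : IsRLL (fun _ => false) q z w X Y) (hq : q ≠ 0) (hq2 : q ^ 2 ≠ 1) (hz : z ≠ 0)
    (hw : w = q ^ 2 * z) (b : ι) {a e : ι} (hae : a < e) :
    X a b * Y e b - q⁻¹ • (X e b * Y a b) = 0 := by
  have hk : q - q⁻¹ ≠ 0 := by
    intro h'
    apply hq2
    field_simp at h'
    linear_combination h'
  have hzw : z - w = -q * ((q - q⁻¹) * z) := by
    rw [hw]; field_simp; ring
  have hr : z * q - w * q⁻¹ = 0 := by
    rw [hw]; field_simp; ring
  have := isRLL_iff.1 h a e b b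
  simp only [sg, rDiag, rOff, qpar, hae.ne, hae, if_true, if_false, Bool.and_false, hr, mul_zero,
    zero_smul, add_zero, one_mul, hzw, Bool.false_eq_true] at this
  refine smul_right_injective A (mul_ne_zero hq (mul_ne_zero hk hz)) ?_
  simp only
  linear_combination (norm := skip) (-1 : K) • this
  match_scalars <;> field_simp <;> ring

/-- An exchange of the columns multiplies a two-by-two quantum minor by `-q⁻¹`. -/
theorem IsRLL.minor_swap {ι : Type*} [LinearOrder ι] [Fintype ι] {z w : K} {X Y : Matrix ι ι A}
    (h : IsRLL (fun _ => false) q z w X Y) (hq : q ≠ 0) (hq2 : q ^ 2 ≠ 1) (hz : z ≠ 0)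
    (hw : w = q ^ 2 * z) {b d : ι} (hdb : d < b) {a e : ι} (hae : a < e) :
    X a b * Y e d - q⁻¹ • (X e b * Y a d) =
      (-q⁻¹) • (X a d * Y e b - q⁻¹ • (X e d * Y a b)) := by
  have hk : q - q⁻¹ ≠ 0 := by
    intro h'
    apply hq2
    field_simp at h'
    linear_combination h'
  have hzw : z - w = -q * ((q - q⁻¹) * z) := by
    rw [hw]; field_simp; ring
  have hw' : (q - q⁻¹) * w = q ^ 2 * ((q - q⁻¹) * z) := by
    rw [hw]; ring
  have e1 := isRLL_iff.1 h a e b d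
  have e2 := isRLL_iff.1 h a e d b
  have hk' := mul_ne_zero hk hz
  simp only [sg, rDiag, rOff, hae.ne, hae, hdb.ne, hdb.ne', hdb, hdb.not_gt, if_true, if_false,
    Bool.and_false, one_mul, hzw, hw', Bool.false_eq_true] at e1 e2
  generalize (q - q⁻¹) * z = κ at *
  refine smul_right_injective A (mul_ne_zero hq hk') ?_
  simp only
  linear_combination (norm := skip) (-1 : K) • e1 - q⁻¹ • e2
  match_scalars <;> field_simp <;> ring

/-- The quantum determinant of `L(z)`, with arguments `z, q² z, q⁴ z, …` in the columns. -/
noncomputable def colDet (σ : Scaling K A) (Q : Kˣ) {n : ℕ} (L : Matrix (Fin n) (Fin n) A) : A :=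
  qdet (Q : K) fun k i => σ.scale (Q ^ (2 * (k : ℕ))) (L i k)

variable {Q : Kˣ} {n : ℕ} {L : Matrix (Fin (n + 1)) (Fin (n + 1)) A}

/-- The quantum determinant vanishes if the first column occurs again, multiplied by `x`, at the
position `j`, and the columns to the left of `j` are those of `L`. -/
theorem qdet_eq_zero_of_repeat (hQ : (Q : K) ^ 2 ≠ 1)
    (h : ∀ a b : Kˣ, IsRLL (fun _ => false) (Q : K) (a : K) (b : K) (L.map (σ.scale a))
      (L.map (σ.scale b)))
    (j : ℕ) (hj : j + 1 < n + 1) (V : Fin (n + 1) → Fin (n + 1) → A)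
    (hV : ∀ i : Fin (n + 1), (i : ℕ) ≤ j → V i = fun r => σ.scale (Q ^ (2 * (i : ℕ))) (L r i))
    (x : A) (hx : ∀ r, V ⟨j + 1, hj⟩ r = σ.scale (Q ^ (2 * (j + 1))) (L r 0) * x) :
    qdet (Q : K) V = 0 := by
  induction j generalizing V x with
  | zero =>
    rw [qdet_eq_smul_of_minors (V := V) (W := V) (k := 0) (k' := ⟨1, hj⟩) rfl (fun _ _ _ => rfl) 0,
      zero_smul]
    intro a b hab
    have := (h 1 (Q ^ 2)).minor_eq_zero Q.ne_zero hQ (by simp) (by simp) 0 hab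
    simp only [Matrix.map_apply, σ.scale_one] at this
    rw [zero_smul, hV 0 (by simp), hx, hx]
    simp only [Fin.val_zero, mul_zero, pow_zero, σ.scale_one, zero_add, mul_one]
    rw [← mul_assoc, ← mul_assoc, ← smul_mul_assoc, ← sub_mul, this, zero_mul]
  | succ j ih =>
    let k : Fin (n + 1) := ⟨j + 1, by omega⟩
    let k' : Fin (n + 1) := ⟨j + 1 + 1, hj⟩
    have hne : k ≠ k' := by simp [k, k']
    -- Exchange the columns `j + 1` and `j + 2`: the repeated first column moves to the left, and
    -- `x` stays in the column to the right.
    let W : Fin (n + 1) → Fin (n + 1) → A :=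
      Function.update (Function.update V k fun r => σ.scale (Q ^ (2 * (j + 1))) (L r 0)) k'
        fun r => σ.scale (Q ^ (2 * (j + 1 + 1))) (L r k) * x
    have hWk : W k = fun r => σ.scale (Q ^ (2 * (j + 1))) (L r 0) := by
      simp [W, Function.update_of_ne hne]
    have hWk' : W k' = fun r => σ.scale (Q ^ (2 * (j + 1 + 1))) (L r k) * x := by
      simp [W]
    have hW : qdet (Q : K) W = 0 := by
      refine ih (by omega) W (fun i hi => ?_) 1 (fun r => ?_)
      · have h1 : i ≠ k := fun hh => by simp [hh, k] at hi
        have h2 : i ≠ k' := fun hh => by simp [hh, k'] at hi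
        simp only [W, Function.update_of_ne h1, Function.update_of_ne h2]
        exact hV i (by omega)
      · exact (congrFun hWk r).trans (mul_one _).symm
    rw [qdet_eq_smul_of_minors (V := V) (W := W) (k := k) (k' := k') rfl ?_ (-(Q : K)⁻¹), hW,
      smul_zero]
    · intro a b hab
      have h0 : (0 : Fin (n + 1)) < k := by rw [Fin.lt_def]; simp [k]
      have := (h (Q ^ (2 * (j + 1))) (Q ^ (2 * (j + 1 + 1)))).minor_swap Q.ne_zero hQ
        (Units.ne_zero _) (by push_cast; ring) h0 hab
      have := congrArg (· * x) this
      simp only [Matrix.map_apply, sub_mul, smul_mul_assoc, mul_assoc] at this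
      rw [hV k (by simp [k]), hx, hx, hWk, hWk']
      exact this
    · intro i h1 h2
      simp only [W, Function.update_of_ne h1, Function.update_of_ne h2]

/-- The quantum determinant is the product of the upper left entry and the quantum determinant of
its Schur complement. -/
theorem colDet_eq_corner_mul (hQ : (Q : K) ^ 2 ≠ 1)
    (h : ∀ a b : Kˣ, IsRLL (fun _ => false) (Q : K) (a : K) (b : K) (L.map (σ.scale a))
      (L.map (σ.scale b))) {h' : A} (hh : L 0 0 * h' = 1) :
    colDet σ Q L = L 0 0 * σ.scale (Q ^ 2) (colDet σ Q (schur h' L)) := by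
  -- The columns of the matrix that is obtained from `L` by clearing the first row.
  let η : Fin (n + 1) → Fin (n + 1) → A := fun k r =>
    σ.scale (Q ^ (2 * (k : ℕ))) (L r k - L r 0 * (h' * L 0 k))
  -- The first row is cleared in the columns `1, …, j`. Going down from `j`, each step subtracts a
  -- right multiple of the first column from one column, while the columns to its left are still
  -- those of `L`; the determinant does not change by `qdet_eq_zero_of_repeat`.
  have key : ∀ j : ℕ, j + 1 ≤ n + 1 → ∀ V V' : Fin (n + 1) → Fin (n + 1) → A, V 0 = V' 0 →
      (∀ i : Fin (n + 1), (i : ℕ) ≤ j → V i = fun r => σ.scale (Q ^ (2 * (i : ℕ))) (L r i)) →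
      (∀ i : Fin (n + 1), i ≠ 0 → (i : ℕ) ≤ j → V' i = η i) →
      (∀ i : Fin (n + 1), j < i → V i = V' i) → qdet (Q : K) V' = qdet (Q : K) V := by
    intro j
    induction j with
    | zero =>
      intro _ V V' h0 _ _ h3
      congr 1
      funext i
      by_cases hi : i = 0
      · rw [hi, h0]
      · exact (h3 i (Nat.pos_of_ne_zero fun hh => hi (Fin.ext hh))).symm
    | succ j ih =>
      intro hj V V' h0 h1 h2 h3
      let k : Fin (n + 1) := ⟨j + 1, by omega⟩
      have hk0 : k ≠ 0 := by simp [k, Fin.ext_iff]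
      let U : Fin (n + 1) → Fin (n + 1) → A := Function.update V k fun r =>
        σ.scale (Q ^ (2 * (j + 1))) (L r 0) * σ.scale (Q ^ (2 * (j + 1))) (h' * L 0 k)
      have hU : qdet (Q : K) U = 0 := by
        refine qdet_eq_zero_of_repeat hQ h j (by omega) U (fun i hi => ?_) _
          fun r => congrFun (Function.update_self k _ V) r
        rw [← h1 i (by omega)]
        refine Function.update_of_ne ?_ _ _
        rintro rfl
        simp [k] at hi
      rw [ih (by omega) (Function.update V k (η k)) V' ?_ ?_ ?_ ?_]
      · rw [qdet_sub (V := Function.update V k (η k)) (W := V) (U := U) k, hU, sub_zero]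
        · intro i hi
          rw [Function.update_of_ne hi]
        · intro i hi
          simp only [U, Function.update_of_ne hi]
        · intro r
          simp only [U]
          rw [Function.update_self, Function.update_self, h1 k (by simp [k]), ← map_mul,
            ← map_sub]
      · rw [Function.update_of_ne hk0.symm, h0]
      · intro i hi
        rw [Function.update_of_ne]
        · exact h1 i (by omega)
        · rintro rfl
          simp [k] at hi
      · intro i hi hi'
        exact h2 i hi (by omega)
      · intro i hi
        by_cases hik : i = k
        · subst hik
          rw [Function.update_self, h2 k hk0 (by simp [k])]
        · rw [Function.update_of_ne hik]
          refine h3 i ?_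
          have : (i : ℕ) ≠ j + 1 := fun hh => hik (Fin.ext hh)
          omega
  have e := key n le_rfl (fun k i => σ.scale (Q ^ (2 * (k : ℕ))) (L i k))
    (Function.update η 0 fun i => σ.scale (Q ^ (2 * ((0 : Fin (n + 1)) : ℕ))) (L i 0)) (by simp)
    (fun i _ => rfl) (fun i hi _ => by rw [Function.update_of_ne hi])
    (fun i hi => by omega)
  rw [colDet, ← e, qdet_eq_corner_mul]
  · rw [Function.update_self, colDet, qdet, qdet, map_sum]
    simp only [Fin.val_zero, mul_zero, pow_zero, σ.scale_one]
    congr 1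
    refine Finset.sum_congr rfl fun τ _ => ?_
    rw [map_smul, map_list_prod, List.map_ofFn]
    congr 3
    funext k
    rw [Function.update_of_ne (Fin.succ_ne_zero k), Function.comp_apply, σ.scale_scale, ← pow_add]
    simp only [η, schur, mul_assoc]
    congr 3
    rw [Fin.val_succ]
    ring
  · intro k
    rw [Function.update_of_ne (Fin.succ_ne_zero k)]
    simp only [η]
    rw [← mul_assoc, hh, one_mul, sub_self, map_zero]

end Columns

end QuantumDeterminants

/-! ### The Berezinian and the scalar series -/

section BerezinianScalar

open MulOpposite
open QuantumAffineSuper (len)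

variable {K A : Type*} [Field K] [Ring A] [Algebra K A]

section Odd

variable {σ : Scaling K A} {q : K} {n : ℕ} {L M : Matrix (Fin n) (Fin n) A}

theorem rDiag_odd {ι : Type*} [DecidableEq ι] (z w : K) (a c : ι) :
    rDiag (fun _ => true) q z w a c = -rDiag (fun _ => false) q w z a c := by
  by_cases h : a = c
  · simp [rDiag, qpar, h]
  · simp [rDiag, h]

theorem rOff_swap {ι : Type*} [LinearOrder ι] (z w : K) (a c : ι) :
    rOff q z w a c = rOff q w z c a := by
  unfold rOff
  rcases lt_trichotomy a c with h | h | h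
  · simp [h.ne, h.ne', h, h.not_gt]
  · simp [h]
  · simp [h.ne, h.ne', h, h.not_gt]

/-- The inverse of a matrix with odd indices only satisfies, after transposition, the RLL relation
for even indices. -/
theorem IsSystem.revOp_inv (h : IsSystem σ (fun _ => true) q L M) :
    IsSystem σ.op (fun _ => false) q (QuantumLiouville.revOp M) (QuantumLiouville.revOp L) where
  mul_inv := by rw [← revOp_mul, h.mul_inv, revOp_one]
  inv_mul := by rw [← revOp_mul, h.inv_mul, revOp_one]
  rll z w := by
    rw [isRLL_iff]
    intro a c b d
    have := isLLR_iff.1 ((h.rll w z).inverse (map_mul_map_eq_one h.mul_inv _)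
      (map_mul_map_eq_one h.inv_mul _) (map_mul_map_eq_one h.mul_inv _)
      (map_mul_map_eq_one h.inv_mul _)) d.rev b.rev c.rev a.rev
    have := congrArg op this
    have hr : ∀ x y : Fin n, rDiag (fun _ => false) q (z : K) w x.rev y.rev =
        rDiag (fun _ => false) q (z : K) w y x := fun x y => by
      rw [rDiag_comm, rDiag, rDiag]
      simp [Fin.rev_inj, qpar]
    have hs : ∀ x y : Fin n, rOff q (w : K) z x.rev y.rev = rOff q (z : K) w x y := fun x y => by
      rw [rOff_swap, ← rOff_rev]
    simp only [Matrix.map_apply, op_add, op_smul, op_mul, rDiag_odd, hr, hs, sg, Bool.and_self,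
      if_true] at this
    simp only [Matrix.map_apply, QuantumLiouville.revOp, Scaling.op_scale_op, sg, Bool.and_self,
      Bool.false_eq_true, if_false]
    linear_combination (norm := module) (-1 : K) • this

theorem isUnit_revOp {X : Matrix (Fin n) (Fin n) A} (h : IsUnit X) :
    IsUnit (QuantumLiouville.revOp X) := by
  obtain ⟨Y, h1, h2⟩ := isUnit_iff_exists.1 h
  exact isUnit_iff_exists.2 ⟨QuantumLiouville.revOp Y, by rw [← revOp_mul, h2, revOp_one],
    by rw [← revOp_mul, h1, revOp_one]⟩

theorem HasLastMinors.revOp (h : HasLastMinors M) (hLM : L * M = 1) (hML : M * L = 1) :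
    HasLastMinors (QuantumLiouville.revOp L) := by
  intro k m hk
  have := isUnit_revOp (h.isUnit_submatrix_firstIdx hLM hML (k := m) (m := k) (by omega))
  convert this using 1
  ext i j
  simp only [Matrix.submatrix_apply, QuantumLiouville.revOp]
  congr 2 <;> ext <;> simp [lastIdx, firstIdx, Fin.val_rev] <;> omega

end Odd

section Berezinian

variable {σ : Scaling K A} {Q : Kˣ}

/-- The quantum determinant of `X(z)` that is ordered by rows, with the arguments `q⁻² z, q⁻⁴ z, …`
in the rows. -/
noncomputable def rowDet (σ : Scaling K A) (Q : Kˣ) {n : ℕ} (X : Matrix (Fin n) (Fin n) A) : A :=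
  ∑ τ : Equiv.Perm (Fin n), ((-(Q : K))⁻¹ ^ len τ) •
    (List.ofFn fun i => σ.scale (Q ^ (-2 - 2 * (i : ℤ))) (X i (τ i))).prod

/-- The transposition over the opposite algebra exchanges the quantum determinants by columns and by
rows. -/
theorem colDet_revOp {n : ℕ} (X : Matrix (Fin n) (Fin n) A) :
    colDet σ.op Q (revOp X) = op (σ.scale (Q ^ (2 * n)) (rowDet σ Q X)) := by
  let e : Equiv.Perm (Fin n) ≃ Equiv.Perm (Fin n) :=
    { toFun := fun τ => Fin.revPerm * τ * Fin.revPerm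
      invFun := fun τ => Fin.revPerm * τ * Fin.revPerm
      left_inv := fun τ => by ext i; simp
      right_inv := fun τ => by ext i; simp }
  rw [rowDet, ← Equiv.sum_comp e, map_sum, Finset.op_sum, colDet, qdet]
  refine Finset.sum_congr rfl fun τ _ => ?_
  have he : len (e τ) = len τ := len_rev_conj τ
  rw [he, map_smul, op_smul, map_list_prod, MulOpposite.op_list_prod, List.map_map, List.map_ofFn]
  congr 2
  refine List.ext_getElem (by simp) fun k h1 h2 => ?_
  have hk : k < n := by simpa using h1
  have hf : e τ (⟨k, hk⟩ : Fin n).rev = (τ ⟨k, hk⟩).rev := by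
    simp [e]
  have hr : (⟨n - 1 - k, by omega⟩ : Fin n) = (⟨k, hk⟩ : Fin n).rev := by
    ext
    simp [Fin.val_rev]
    omega
  simp only [List.getElem_ofFn, List.getElem_reverse, List.length_ofFn, Function.comp_apply,
    σ.scale_scale, revOp, Scaling.op_scale_op, ← zpow_natCast, ← zpow_add]
  rw [hr, hf]
  congr 4
  have : ((n - 1 - k : ℕ) : ℤ) = n - 1 - k := by omega
  push_cast [this]
  ring

theorem Commute.qdet_right {q : K} {n : ℕ} {V : Fin n → Fin n → A} {x : A}
    (h : ∀ k r, Commute x (V k r)) : Commute x (qdet q V) := by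
  refine Commute.sum_right _ _ _ fun τ _ => Commute.smul_right ?_ _
  refine Commute.list_prod_right _ _ fun y hy => ?_
  obtain ⟨i, rfl⟩ := (List.mem_ofFn' _ _).1 hy
  exact h _ _

theorem Commute.rowDet_right {n : ℕ} {X : Matrix (Fin n) (Fin n) A} {x : A}
    (h : ∀ c i j, Commute x (σ.scale c (X i j))) : Commute x (rowDet σ Q X) := by
  refine Commute.sum_right _ _ _ fun τ _ => Commute.smul_right ?_ _
  refine Commute.list_prod_right _ _ fun y hy => ?_
  obtain ⟨i, rfl⟩ := (List.mem_ofFn' _ _).1 hy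
  exact h _ _ _

theorem commute_of_mul_eq_one {x x' y : A} (h1 : x * x' = 1) (h2 : x' * x = 1)
    (h : Commute x y) : Commute x' y := by
  calc x' * y = x' * (y * x) * x' := by rw [mul_assoc, mul_assoc, h1, mul_one]
    _ = y * x' := by rw [← h.eq, ← mul_assoc, h2, one_mul]

/-- The parity function for which the first `M` indices are even. -/
def evenOdd (M : ℕ) {n : ℕ} (i : Fin n) : Bool := decide (M ≤ i)

/-- The quantum Berezinian of `L`, where `L'` is the inverse of `L`. -/
noncomputable def ber (σ : Scaling K A) (Q : Kˣ) {M N n : ℕ} (h : M + N = n)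
    (L L' : Matrix (Fin n) (Fin n) A) : A :=
  colDet σ Q (L.submatrix (firstIdx h) (firstIdx h)) *
    σ.scale (Q ^ (2 * M)) (rowDet σ Q (L'.submatrix (lastIdx h) (lastIdx h)))

theorem evenOdd_succ (M n : ℕ) : (evenOdd (M + 1) : Fin (n + 1) → Bool) ∘ Fin.succ = evenOdd M := by
  funext i
  simp [evenOdd]

theorem IsWeight.tail {n : ℕ} {p : Fin (n + 1) → Bool} {q : K} {ω : ℕ → K}
    (hω : IsWeight p q ω) : IsWeight (p ∘ Fin.succ) q (fun i => ω (i + 1)) where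
  ne_zero _ := hω.ne_zero _
  succ i := hω.succ i.succ

/-- The leading submatrix for the even indices satisfies the RLL relation for even indices only. -/
theorem isRLL_evenOdd_submatrix {M N n : ℕ} (h : M + N = n) {z w q : K}
    {X Y : Matrix (Fin n) (Fin n) A} (hXY : IsRLL (evenOdd M) q z w X Y) :
    IsRLL (fun _ => false) q z w (X.submatrix (firstIdx h) (firstIdx h))
      (Y.submatrix (firstIdx h) (firstIdx h)) := by
  rw [isRLL_iff] at hXY ⊢
  intro a c b d
  have := hXY (firstIdx h a) (firstIdx h c) (firstIdx h b) (firstIdx h d)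
  have hp : ∀ i : Fin M, evenOdd M (firstIdx h i) = false :=
    fun i => decide_eq_false i.isLt.not_ge
  have hi : ∀ i j : Fin M, firstIdx h i = firstIdx h j ↔ i = j := by
    intro i j
    simp [firstIdx, Fin.ext_iff]
  have hlt : ∀ i j : Fin M, firstIdx h i < firstIdx h j ↔ i < j :=
    fun _ _ => Iff.rfl
  simpa only [Matrix.submatrix_apply, sg, hp, rDiag, rOff, qpar, hi, hlt] using this

theorem IsSystem.commute_twistedProd {n : ℕ} {p : Fin n → Bool} {q : K} {ω : ℕ → K}
    {L L' : Matrix (Fin n) (Fin n) A} {x : A} (h : ∀ c i j, Commute x (σ.scale c (L i j)))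
    (h' : ∀ c i j, Commute x (σ.scale c (L' i j))) (i k : Fin n) (c : Kˣ) (b : Kˣ) :
    Commute x (σ.scale b (twistedProd σ p q ω L L' i k c)) := by
  rw [twistedProd, map_sum]
  refine Commute.sum_right _ _ _ fun j _ => ?_
  rw [map_smul, map_mul, σ.scale_scale]
  exact Commute.smul_right (Commute.mul_right (h _ _ _) (h' _ _ _)) _

/-- Removing an even first index splits off the upper left entry of `L` from the Berezinian. The
second factor is not affected, because the inverse of the Schur complement is a submatrix of
`L⁻¹`. -/
theorem ber_eq_corner_mul (hQ : (Q : K) ^ 2 ≠ 1) {M N n : ℕ} (h : M + N = n)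
    (h' : M + 1 + N = n + 1) {L L' : Matrix (Fin (n + 1)) (Fin (n + 1)) A}
    (hS : IsSystem σ (evenOdd (M + 1)) (Q : K) L L') {x : A} (h1 : L 0 0 * x = 1) :
    ber σ Q h' L L' =
      L 0 0 * σ.scale (Q ^ 2) (ber σ Q h (schur x L) (L'.submatrix Fin.succ Fin.succ)) := by
  have hl : L'.submatrix (lastIdx h') (lastIdx h') =
      (L'.submatrix Fin.succ Fin.succ).submatrix (lastIdx h) (lastIdx h) := by
    ext i j
    simp only [Matrix.submatrix_apply]
    congr 1 <;> ext <;> simp [lastIdx] <;> omega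
  have hs : schur x (L.submatrix (firstIdx h') (firstIdx h')) =
      (schur x L).submatrix (firstIdx h) (firstIdx h) := rfl
  have h0 : L.submatrix (firstIdx h') (firstIdx h') 0 0 = L 0 0 := rfl
  have hr : ∀ a b : Kˣ, IsRLL (fun _ => false) (Q : K) (a : K) (b : K)
      ((L.submatrix (firstIdx h') (firstIdx h')).map (σ.scale a))
      ((L.submatrix (firstIdx h') (firstIdx h')).map (σ.scale b)) := fun a b => by
    rw [← Matrix.submatrix_map, ← Matrix.submatrix_map]
    exact isRLL_evenOdd_submatrix h' (hS.rll a b)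
  have hc := colDet_eq_corner_mul hQ hr (h' := x) (by rw [h0, h1])
  rw [hs, h0] at hc
  rw [ber, hc, ber, map_mul, σ.scale_scale, ← pow_add, hl, mul_assoc,
    show 2 * (M + 1) = 2 + 2 * M by ring]

/-- An element that commutes with all values of `L` and `L⁻¹` commutes with the Berezinian. -/
theorem commute_scale_ber {M N n : ℕ} (h : M + N = n) {L L' : Matrix (Fin n) (Fin n) A} {x : A}
    (c1 : ∀ c i j, Commute x (σ.scale c (L i j)))
    (c2 : ∀ c i j, Commute x (σ.scale c (L' i j))) (c : Kˣ) :
    Commute x (σ.scale c (ber σ Q h L L')) := by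
  rw [ber, map_mul, σ.scale_scale]
  refine Commute.mul_right ?_ ?_
  · have := Commute.qdet_right (q := (Q : K)) (x := σ.scale c⁻¹ x)
      (V := fun k i => σ.scale (Q ^ (2 * (k : ℕ))) (L.submatrix (firstIdx h) (firstIdx h) i k))
      (fun k r => Scaling.commute_scale (fun c => c1 c _ _) _ _)
    have := this.map (σ.scale c)
    rwa [σ.scale_scale, mul_inv_cancel, σ.scale_one] at this
  · have := Commute.rowDet_right (Q := Q) (x := σ.scale (c * Q ^ (2 * M))⁻¹ x)
      (X := L'.submatrix (lastIdx h) (lastIdx h)) (σ := σ)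
      (fun b i j => Scaling.commute_scale (fun c => c2 c _ _) _ _)
    have := this.map (σ.scale (c * Q ^ (2 * M)))
    rwa [σ.scale_scale, mul_inv_cancel, σ.scale_one] at this

theorem IsWeight.rev_odd {n : ℕ} {q : K} {ω : ℕ → K} (hω : IsWeight (fun _ : Fin n => true) q ω)
    (hq : q ≠ 0) : IsWeight (fun _ : Fin n => false) q (fun i => ω (n - i)) := by
  refine ⟨fun i => hω.ne_zero _, fun i => ?_⟩
  have := hω.succ i.rev
  have e : (i.rev : ℕ) + 1 = n - i := by rw [Fin.val_rev]; omega
  have e' : (i.rev : ℕ) = n - (i + 1) := by rw [Fin.val_rev]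
  rw [e, e'] at this
  simp only [this, qpar, if_true, Bool.false_eq_true, if_false]
  field_simp

theorem IsWeight.dWeight_rev_odd {n : ℕ} {q : K} {ω : ℕ → K}
    (hω : IsWeight (fun _ : Fin n => true) q ω) (hq : q ≠ 0) (i : Fin n) :
    dWeight (fun _ => false) q (fun i => ω (n - i)) i = -dWeight (fun _ => true) q ω i.rev := by
  have := hω.succ i.rev
  have e : (i.rev : ℕ) + 1 = n - i := by rw [Fin.val_rev]; omega
  rw [e] at this
  simp only [dWeight, this, qpar, sg, if_true, Bool.false_eq_true, if_false, Bool.and_self]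
  field_simp

/-- The equation for the scalar series in the system of `IsSystem.revOp_inv`. -/
theorem twistedProd_revOp_inv {n : ℕ} {q : K} {ω : ℕ → K} {L L' : Matrix (Fin n) (Fin n) A} {Z : A}
    {u : Kˣ} (hω : IsWeight (fun _ : Fin n => true) q ω) (hq : q ≠ 0)
    (hZ : ∀ i k, twistedProd σ (fun _ => true) q ω L L' i k u =
      if i = k then dWeight (fun _ => true) q ω i • Z else 0) (i k : Fin n) :
    twistedProd σ.op (fun _ => false) q (fun i => ω (n - i)) (revOp L') (revOp L) i k u⁻¹ =
      if i = k then dWeight (fun _ => false) q (fun i => ω (n - i)) i • op (σ.scale u⁻¹ Z)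
      else 0 := by
  have := congrArg (fun y => op (σ.scale u⁻¹ y)) (hZ k.rev i.rev)
  simp only [apply_ite (σ.scale _), apply_ite op, map_zero, op_zero, map_smul, op_smul,
    Fin.rev_inj] at this
  have hs : (if i = k then dWeight (fun _ => false) q (fun i => ω (n - i)) i •
      op (σ.scale u⁻¹ Z) else 0) = -(if k = i then (dWeight (fun _ => true) q ω k.rev •
      op (σ.scale u⁻¹ Z)) else 0) := by
    by_cases hik : i = k
    · simp [hik, hω.dWeight_rev_odd hq]
    · simp [hik, Ne.symm hik]
  rw [hs, ← this, twistedProd, twistedProd, map_sum, Finset.op_sum,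
    ← Equiv.sum_comp Fin.revPerm, ← Finset.sum_neg_distrib]
  refine Finset.sum_congr rfl fun j _ => ?_
  rw [map_smul, op_smul, map_mul, op_mul, hω.dWeight_rev_odd hq, σ.scale_scale, inv_mul_cancel,
    σ.scale_one]
  simp only [Fin.revPerm_apply, revOp, Scaling.op_scale_op, Fin.rev_rev, sg,
    Bool.and_self, if_true, Bool.false_eq_true, if_false]
  module

/-- An invertible even corner entry commutes with all rescalings of the scalar series. By
`IsSystem.twistedProd_schur`, the scalar series is the product of values of this entry, of their
inverses, and of the scalar series of the Schur complement. -/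
theorem IsSystem.commute_corner_scalar {n : ℕ} {p : Fin (n + 1) → Bool} {q : K} {ω : ℕ → K}
    {L L' : Matrix (Fin (n + 1)) (Fin (n + 1)) A} (hS : IsSystem σ p q L L') (hp : p 0 = false)
    (hω : IsWeight p q ω) (hq : q ≠ 0) (hq2 : q ^ 2 ≠ 1) {x : A} (h1 : L 0 0 * x = 1)
    (h2 : x * L 0 0 = 1) {u : Kˣ} {Z : A}
    (hZ : ∀ i k, twistedProd σ p q ω L L' i k u = if i = k then dWeight p q ω i • Z else 0)
    (c : Kˣ) : Commute (L 0 0) (σ.scale c Z) := by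
  have c3 : ∀ c, Commute (L 0 0) (σ.scale c (L 0 0)) := hS.commute_corner_corner hp hq
  have c4 : ∀ c, Commute (L 0 0) (σ.scale c x) := fun c => by
    refine (commute_of_mul_eq_one (x := σ.scale c (L 0 0)) ?_ ?_ (c3 c).symm).symm
    · rw [← map_mul, h1, map_one]
    · rw [← map_mul, h2, map_one]
  rcases n with _ | n
  -- For a single index, the scalar series is a quotient of values of the entry.
  · have e1 := congrFun (congrFun hS.inv_mul 0) 0
    rw [Matrix.mul_apply, Fin.sum_univ_one, Matrix.one_apply_eq] at e1
    have e2 : L' 0 0 = x := by rw [← mul_one (L' 0 0), ← h1, ← mul_assoc, e1, one_mul]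
    have e := hZ 0 0
    have hsum : ∀ f : Fin (0 + 1) → A, ∑ j, f j = f 0 := Fin.sum_univ_one
    rw [twistedProd, hsum, if_pos rfl, e2] at e
    rw [eq_inv_smul_iff₀ (hω.dWeight_ne_zero hq 0) |>.2 e.symm, map_smul, map_smul, map_mul,
      σ.scale_scale]
    exact Commute.smul_right (Commute.smul_right (Commute.mul_right (c3 _) (c4 _)) _) _
  · obtain ⟨u', hu'⟩ : ∃ u' : Kˣ, u' = (Units.mk0 q hq) ^ 2 * u := ⟨_, rfl⟩
    have hZ' := hS.twistedProd_schur hp hq hq2 h2 h1 (u := u) (u' := u') (by simp [hu']) hZ 0 0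
    rw [if_pos rfl] at hZ'
    have hxx : σ.scale u' x * σ.scale u' (L 0 0) = 1 := by rw [← map_mul, h2, map_one]
    have hLx : σ.scale u (L 0 0) * σ.scale u x = 1 := by rw [← map_mul, h1, map_one]
    have hd := eq_inv_smul_iff₀ (hω.tail.dWeight_ne_zero hq 0) |>.2 hZ'.symm
    have : Z = σ.scale u' x * (σ.scale u (L 0 0) * (σ.scale u x * σ.scale u' (L 0 0) * Z)) := by
      rw [mul_assoc (σ.scale _ x), ← mul_assoc _ (σ.scale _ x), hLx, one_mul, ← mul_assoc,
        hxx, one_mul]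
    rw [this, hd, map_mul, map_mul, map_smul, σ.scale_scale, σ.scale_scale]
    refine Commute.mul_right (c4 _) (Commute.mul_right (c3 _) (Commute.smul_right ?_ _))
    exact IsSystem.commute_twistedProd (hS.commute_corner_schur hp h2 h1)
      (fun c i j => hS.commute_corner_inv hp c i j) _ _ _ _

/-- The Liouville theorem for all matrices with `M` even and `N` odd indices over an algebra with a
scaling. The scalar series is also shown to commute with the Berezinian, since the passage to the
opposite algebra reverses their product. -/
def HasLiouville (σ : Scaling K A) (Q : Kˣ) {M N n : ℕ} (h : M + N = n) : Prop :=
  ∀ L L' : Matrix (Fin n) (Fin n) A, IsSystem σ (evenOdd M) (Q : K) L L' → HasLastMinors L' →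
    ∀ (ω : ℕ → K) (Z : A), IsWeight (n := n) (evenOdd M) (Q : K) ω →
    (∀ i k, twistedProd σ (evenOdd M) (Q : K) ω L L' i k (Q ^ (2 * (N : ℤ) - 2 * M)) =
      if i = k then dWeight (evenOdd M) (Q : K) ω i • Z else 0) →
    σ.scale (Q ^ (-2 : ℤ)) (ber σ Q h L L') =
      σ.scale (Q ^ (2 * (M : ℤ) - 2 * N - 2)) Z * ber σ Q h L L' ∧
    Commute (σ.scale (Q ^ (2 * (M : ℤ) - 2 * N - 2)) Z) (ber σ Q h L L')

/-- The induction step: an even index is removed. The positive number `n` of remaining indices is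
needed to express the scalar series of the Schur complement by its entries. -/
theorem HasLiouville.succ (hQ : (Q : K) ^ 2 ≠ 1) {M N n : ℕ} (h : M + N = n)
    (h' : M + 1 + N = n + 1) (hn : 0 < n) (hyp : HasLiouville σ Q h) : HasLiouville σ Q h' := by
  intro L L' hS hL' ω Z hω hZ
  have hp : (evenOdd (M + 1) : Fin (n + 1) → Bool) 0 = false := by simp [evenOdd]
  obtain ⟨x, h1, h2⟩ := isUnit_iff_exists.1 (hL'.isUnit_corner hS.mul_inv hS.inv_mul)
  have hS' := hS.schur h2 h1
  have hω' := hω.tail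
  obtain ⟨u', hu'⟩ : ∃ u' : Kˣ, u' = Q ^ (2 * (N : ℤ) - 2 * M) := ⟨_, rfl⟩
  have hZ' := hS.twistedProd_schur hp Q.ne_zero hQ h2 h1
    (u := Q ^ (2 * (N : ℤ) - 2 * ((M + 1 : ℕ) : ℤ))) (u' := u') (by
      rw [hu', ← Units.val_pow_eq_pow_val, ← Units.val_mul, ← zpow_natCast, ← zpow_add]
      congr 2
      push_cast
      ring) hZ
  have e0 := hyp _ _ (by rw [← evenOdd_succ]; exact hS') hL'.submatrix_succ _ _
    (by rw [← evenOdd_succ]; exact hω') (by rw [← hu', ← evenOdd_succ]; exact hZ')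
  obtain ⟨e1, e2⟩ := e0
  have c1 : ∀ c i j, Commute (L 0 0) (σ.scale c (schur x L i j)) :=
    hS.commute_corner_schur hp h2 h1
  have c2 : ∀ c i j, Commute (L 0 0) (σ.scale c (L'.submatrix Fin.succ Fin.succ i j)) :=
    fun c i j => hS.commute_corner_inv hp c i j
  have c3 : ∀ c, Commute (L 0 0) (σ.scale c (L 0 0)) := hS.commute_corner_corner hp Q.ne_zero
  set Z' := σ.scale (Q ^ (2 * (N : ℤ) - 2 * ((M + 1 : ℕ) : ℤ))) x * σ.scale u' (L 0 0) * Z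
    with hZ'def
  set B' := ber σ Q h (schur x L) (L'.submatrix Fin.succ Fin.succ) with hB'
  -- The scalar series `Z'` and the Berezinian `B'` of the Schur complement commute with the
  -- values of the removed entry.
  have c4 : ∀ c, Commute (L 0 0) (σ.scale c Z') := by
    intro c
    have := hZ' ⟨0, hn⟩ ⟨0, hn⟩
    rw [if_pos rfl] at this
    have hd := hω'.dWeight_ne_zero Q.ne_zero ⟨0, hn⟩
    rw [eq_inv_smul_iff₀ hd |>.2 this.symm, map_smul]
    exact Commute.smul_right (IsSystem.commute_twistedProd c1 c2 _ _ _ _) _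
  have c5 : ∀ c, Commute (L 0 0) (σ.scale c B') := commute_scale_ber h c1 c2
  have hB : ber σ Q h' L L' = L 0 0 * σ.scale (Q ^ 2) B' := ber_eq_corner_mul hQ h h' hS h1
  have hxx : σ.scale u' x * σ.scale u' (L 0 0) = 1 := by rw [← map_mul, h2, map_one]
  have hLx : ∀ c, σ.scale c (L 0 0) * σ.scale c x = 1 := fun c => by rw [← map_mul, h1, map_one]
  -- At the argument that occurs in the formula, the scalar series is `h(z)⁻¹ h(q⁻² z)` times the
  -- one of the Schur complement at `q² z`.
  have hZeq : σ.scale (Q ^ (2 * ((M + 1 : ℕ) : ℤ) - 2 * N - 2)) Z =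
      x * σ.scale (Q ^ (-2 : ℤ)) (L 0 0) *
        σ.scale (Q ^ 2) (σ.scale (Q ^ (2 * (M : ℤ) - 2 * N - 2)) Z') := by
    have : Z = σ.scale u' x *
        (σ.scale (Q ^ (2 * (N : ℤ) - 2 * ((M + 1 : ℕ) : ℤ))) (L 0 0) * Z') := by
      rw [hZ'def, mul_assoc (σ.scale _ x), ← mul_assoc _ (σ.scale _ x), hLx, one_mul, ← mul_assoc,
        hxx, one_mul]
    conv_lhs => rw [this]
    rw [map_mul, map_mul, σ.scale_scale, σ.scale_scale, σ.scale_scale, hu', ← zpow_natCast,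
      ← zpow_add, ← zpow_add, ← zpow_add, ← mul_assoc]
    push_cast
    rw [show 2 * ((M : ℤ) + 1) - 2 * N - 2 + (2 * N - 2 * M) = 0 by ring,
      show 2 * ((M : ℤ) + 1) - 2 * N - 2 + (2 * N - 2 * (M + 1)) = -2 by ring,
      show 2 * ((M : ℤ) + 1) - 2 * N - 2 = 2 + (2 * M - 2 * N - 2) by ring, zpow_zero, σ.scale_one]
  have hQ2 : Q ^ (-2 : ℤ) * Q ^ 2 = 1 := by
    rw [← zpow_natCast, ← zpow_add]; norm_num
  have hQ2' : Q ^ 2 * Q ^ (-2 : ℤ) = 1 := by rw [mul_comm, hQ2]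
  have e1' : B' = σ.scale (Q ^ 2) (σ.scale (Q ^ (2 * (M : ℤ) - 2 * N - 2)) Z') *
      σ.scale (Q ^ 2) B' := by
    have := congrArg (σ.scale (Q ^ 2)) e1
    rwa [σ.scale_scale, hQ2', σ.scale_one, map_mul] at this
  have e2' := e2.map (σ.scale (Q ^ 2))
  have c4' : Commute (L 0 0) (σ.scale (Q ^ 2) (σ.scale (Q ^ (2 * (M : ℤ) - 2 * N - 2)) Z')) := by
    rw [σ.scale_scale]; exact c4 _
  have c6 : Commute (σ.scale (Q ^ (-2 : ℤ)) (L 0 0)) (σ.scale (Q ^ 2) B') :=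
    Scaling.commute_scale c5 _ _
  rw [hZeq, hB]
  generalize σ.scale (Q ^ 2) (σ.scale (Q ^ (2 * (M : ℤ) - 2 * N - 2)) Z') = T at *
  constructor
  · rw [map_mul, σ.scale_scale, hQ2, σ.scale_one]
    conv_lhs => rw [e1']
    calc σ.scale (Q ^ (-2 : ℤ)) (L 0 0) * (T * σ.scale (Q ^ 2) B') =
        x * L 0 0 * σ.scale (Q ^ (-2 : ℤ)) (L 0 0) * (T * σ.scale (Q ^ 2) B') := by
          rw [h2, one_mul]
      _ = x * (L 0 0 * σ.scale (Q ^ (-2 : ℤ)) (L 0 0)) * T * σ.scale (Q ^ 2) B' := by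
          simp only [mul_assoc]
      _ = x * σ.scale (Q ^ (-2 : ℤ)) (L 0 0) * (L 0 0 * T) * σ.scale (Q ^ 2) B' := by
          rw [(c3 _).eq]
          simp only [mul_assoc]
      _ = _ := by
          rw [c4'.eq]
          simp only [mul_assoc]
  · refine Commute.mul_left (Commute.mul_left ?_ ?_) ?_
    · refine Commute.mul_right ?_ (commute_of_mul_eq_one h1 h2 (c5 _))
      exact commute_of_mul_eq_one h1 h2 (Commute.refl _)
    · exact Commute.mul_right (c3 _).symm c6
    · exact Commute.mul_right c4'.symm e2'

theorem rowDet_zero (X : Matrix (Fin 0) (Fin 0) A) : rowDet σ Q X = 1 := by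
  simp [rowDet, len]

theorem colDet_zero (X : Matrix (Fin 0) (Fin 0) A) : colDet σ Q X = 1 := by
  simp [colDet, qdet, len]

/-- A single even index: `Z(z) = L(q⁻² z) L(z)⁻¹`, and the Berezinian is `L(z)`. -/
theorem hasLiouville_one (h : 1 + 0 = 1) : HasLiouville σ Q h := by
  intro L L' hS hL' ω Z hω hZ
  have hd := hω.dWeight_ne_zero Q.ne_zero 0
  have hs : sg K (evenOdd 1 : Fin 1 → Bool) 0 0 = 1 := by simp [sg, evenOdd]
  have e := hZ 0 0
  simp only [twistedProd, Fin.sum_univ_one, if_true, hs, one_mul] at e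
  have e := smul_right_injective A hd e
  simp only [Nat.cast_zero, mul_zero, Nat.cast_one, mul_one, zero_sub] at e
  have hB : ber σ Q h L L' = L 0 0 := by
    rw [ber, rowDet_zero, map_one, mul_one]
    have hlen : ∀ τ : Equiv.Perm (Fin 1), len τ = 0 := fun τ =>
      Finset.card_eq_zero.2 (Finset.filter_eq_empty_iff.2 fun p _ hp =>
        absurd (Subsingleton.elim p.1 p.2) hp.1.ne)
    simp [colDet, qdet, hlen, σ.scale_one, firstIdx]
  have h1 : L 0 0 * L' 0 0 = 1 := by
    have := congrFun (congrFun hS.mul_inv 0) 0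
    simpa [Matrix.mul_apply] using this
  have h2 : L' 0 0 * L 0 0 = 1 := by
    have := congrFun (congrFun hS.inv_mul 0) 0
    simpa [Matrix.mul_apply] using this
  have c3 := hS.commute_corner_corner (by simp [evenOdd]) Q.ne_zero
  rw [hB, ← e]
  simp only [Nat.cast_zero, mul_zero, Nat.cast_one, mul_one, sub_zero, sub_self, zpow_zero,
    σ.scale_one]
  refine ⟨by rw [mul_assoc, h2, mul_one], ?_⟩
  exact Commute.mul_left (c3 _).symm (commute_of_mul_eq_one h1 h2 (Commute.refl _))

theorem hasLiouville_even (hQ : (Q : K) ^ 2 ≠ 1) (M : ℕ) (h : M + 1 + 0 = M + 1) :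
    HasLiouville σ Q h := by
  induction M with
  | zero => exact hasLiouville_one h
  | succ M ih => exact HasLiouville.succ hQ rfl h (by omega) (ih rfl)

/-- Odd indices only: the formula for even indices is applied to the transpose of `L⁻¹` over the
opposite algebra. It has the inverse shift, and its quantum determinant by columns is the one by
rows of `L⁻¹`. -/
theorem hasLiouville_odd (hQ : (Q : K) ^ 2 ≠ 1) (N : ℕ) (h : 0 + (N + 1) = N + 1) :
    HasLiouville σ Q h := by
  intro L L' hS hL' ω Z hω hZ
  have hp : (evenOdd 0 : Fin (N + 1) → Bool) = fun _ => true := by funext i; simp [evenOdd]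
  have hp' : (evenOdd (N + 1) : Fin (N + 1) → Bool) = fun _ => false :=
    funext fun i => decide_eq_false i.isLt.not_ge
  rw [hp] at hS hω hZ
  have hu : (Q ^ (2 * ((N + 1 : ℕ) : ℤ) - 2 * (0 : ℕ)))⁻¹ =
      Q ^ (2 * ((0 : ℕ) : ℤ) - 2 * (N + 1 : ℕ)) := by
    rw [← zpow_neg, neg_sub]
  have hZ' := twistedProd_revOp_inv hω Q.ne_zero hZ
  rw [hu] at hZ'
  have key := hasLiouville_even (σ := σ.op) hQ N rfl (revOp L') (revOp L)
    (by rw [hp']; exact hS.revOp_inv) (hL'.revOp hS.mul_inv hS.inv_mul) _ _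
    (by rw [hp']; exact hω.rev_odd Q.ne_zero) (by rw [hp']; exact hZ')
  have hB : ber σ Q h L L' = rowDet σ Q L' := by
    rw [ber, colDet_zero, one_mul, mul_zero, pow_zero, σ.scale_one]
    congr 1
    ext i j
    simp only [Matrix.submatrix_apply]
    congr 1 <;> ext <;> simp [lastIdx]
  have hB' : ber σ.op Q (M := N + 1) (N := 0) rfl (revOp L') (revOp L) =
      op (σ.scale (Q ^ (2 * (N + 1))) (rowDet σ Q L')) := by
    rw [ber, rowDet_zero, map_one, mul_one, ← colDet_revOp]
    rfl
  rw [hB'] at key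
  rw [hB]
  obtain ⟨k1, k2⟩ := key
  have k2 := k2.unop
  simp only [Scaling.op_scale_op, σ.scale_scale, ← op_mul, unop_op] at k1 k2
  have k1 := congrArg (σ.scale (Q ^ (-(2 * ((N + 1 : ℕ) : ℤ))))) (op_injective k1)
  have k2 := k2.map (σ.scale (Q ^ (-(2 * ((N + 1 : ℕ) : ℤ)))))
  simp only [map_mul, σ.scale_scale, ← zpow_natCast, ← zpow_add] at k1 k2
  have e1 : -(2 * ((N + 1 : ℕ) : ℤ)) + (-2 + ((2 * (N + 1) : ℕ) : ℤ)) = -2 := by push_cast; ring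
  have e2 : -(2 * ((N + 1 : ℕ) : ℤ)) + ((2 * (N + 1) : ℕ) : ℤ) = 0 := by push_cast; ring
  have e3 : -(2 * ((N + 1 : ℕ) : ℤ)) + (2 * ((N + 1 : ℕ) : ℤ) - 2 * ((0 : ℕ) : ℤ) - 2 +
      (2 * ((0 : ℕ) : ℤ) - 2 * ((N + 1 : ℕ) : ℤ))) =
      2 * ((0 : ℕ) : ℤ) - 2 * ((N + 1 : ℕ) : ℤ) - 2 := by push_cast; ring
  rw [e1, e2, e3, zpow_zero, σ.scale_one] at k1
  rw [e2, e3, zpow_zero, σ.scale_one] at k2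
  exact ⟨k1.trans k2.eq.symm, k2⟩

/-- Even indices are removed one by one, until there are only odd indices or a single even one. -/
theorem hasLiouville (hQ : (Q : K) ^ 2 ≠ 1) (M N : ℕ) (hMN : 0 < M + N) :
    HasLiouville σ Q (rfl : M + N = M + N) := by
  have key : ∀ M N n : ℕ, ∀ h : M + N = n, 0 < n → HasLiouville σ Q h := by
    intro M
    induction M with
    | zero =>
      intro N n h hn
      obtain ⟨N, rfl⟩ : ∃ k, N = k + 1 := ⟨N - 1, by omega⟩
      obtain rfl : n = N + 1 := by omega
      exact hasLiouville_odd hQ N h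
    | succ M ih =>
      intro N n h _
      obtain ⟨n, rfl⟩ : ∃ k, n = k + 1 := ⟨n - 1, by omega⟩
      rcases Nat.eq_zero_or_pos n with hn | hn
      · obtain rfl : n = 0 := hn
        obtain rfl : M = 0 := by omega
        obtain rfl : N = 0 := by omega
        exact hasLiouville_one h
      · exact HasLiouville.succ hQ (by omega) h hn (ih N n (by omega) hn)
  exact key M N _ rfl hMN

/-- The two scalar series agree: they are intertwined by the entries of `L(uz)` and of `L(z)⁻¹`, and
an invertible corner entry of one of these matrices commutes with the first one. -/
theorem scalar_eq (hQ : (Q : K) ^ 2 ≠ 1) {M n : ℕ} (hn : 0 < n) {ω : ℕ → K}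
    {L L' : Matrix (Fin n) (Fin n) A} (hS : IsSystem σ (evenOdd M) (Q : K) L L')
    (hL' : HasLastMinors L') (hω : IsWeight (n := n) (evenOdd M) (Q : K) ω) {u : Kˣ} {Z Z' : A}
    (hZ : ∀ i k, twistedProd σ (evenOdd M) (Q : K) ω L L' i k u =
      if i = k then dWeight (evenOdd M) (Q : K) ω i • Z else 0)
    (hZ' : ∀ i k, ∑ j, (sg K (evenOdd M) j i * sg K (evenOdd M) j k *
      (dWeight (evenOdd M) (Q : K) ω j)⁻¹) • (L' j k * σ.scale u (L i j)) =
        if i = k then (dWeight (evenOdd M) (Q : K) ω i)⁻¹ • Z' else 0) : Z' = Z := by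
  obtain ⟨n, rfl⟩ : ∃ k, n = k + 1 := ⟨n - 1, by omega⟩
  have hs := scalar_mul_eq hω Q.ne_zero hZ hZ'
  rcases M with _ | M
  -- Without even indices, the last diagonal entry of `L⁻¹` is used, which is an even corner entry
  -- over the opposite algebra.
  · have hp : (evenOdd 0 : Fin (n + 1) → Bool) = fun _ => true := by funext i; simp [evenOdd]
    rw [hp] at hS hω hZ
    have hL : HasLastMinors _ := hL'.revOp hS.mul_inv hS.inv_mul
    have hSr := hS.revOp_inv
    obtain ⟨x, h1, h2⟩ := isUnit_iff_exists.1 (hL.isUnit_corner hSr.mul_inv hSr.inv_mul)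
    have hc := hSr.commute_corner_scalar rfl (hω.rev_odd Q.ne_zero) Q.ne_zero hQ h1 h2
      (twistedProd_revOp_inv hω Q.ne_zero hZ) u
    rw [Scaling.op_scale_op, σ.scale_scale, mul_inv_cancel, σ.scale_one] at hc
    have hc := hc.unop
    simp only [revOp, unop_op] at hc h1
    have e := (hs (Fin.rev 0) (Fin.rev 0)).2
    rw [hc.eq] at e
    have h1 := congrArg unop h1
    simp only [unop_mul, unop_op, unop_one] at h1
    have h2 := congrArg unop h2
    simp only [revOp, unop_mul, unop_op, unop_one] at h2
    rw [← mul_one Z', ← mul_one Z, ← h2, ← mul_assoc, e, mul_assoc]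
  · obtain ⟨x, h1, h2⟩ := isUnit_iff_exists.1 (hL'.isUnit_corner hS.mul_inv hS.inv_mul)
    have hc := hS.commute_corner_scalar (by simp [evenOdd]) hω Q.ne_zero hQ h1 h2 hZ u⁻¹
    have hc := hc.map (σ.scale u)
    rw [σ.scale_scale, mul_inv_cancel, σ.scale_one] at hc
    have e := (hs 0 0).1
    rw [← hc.eq] at e
    have hx : σ.scale u x * σ.scale u (L 0 0) = 1 := by rw [← map_mul, h2, map_one]
    rw [← one_mul Z', ← one_mul Z, ← hx, mul_assoc, ← e, mul_assoc]

end Berezinian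

end BerezinianScalar

open QuantumAffineSuper

/-! ### Rescaling of power series -/

section SeriesScaling

variable {K A : Type*} [Field K] [Ring A] [Algebra K A]

/-- The substitution `F(z) ↦ F(cz)` for series in `z^e`, as an algebra homomorphism. The variable of
the power series stands for `z^e`, where `e = 1` or `e = -1`. -/
noncomputable def seriesScale (e : ℤ) (c : Kˣ) : A⟦X⟧ →ₐ[K] A⟦X⟧ :=
  AlgHom.ofLinearMap
    { toFun := fun F => PowerSeries.mk fun r => ((c ^ (e * r) : Kˣ) : K) • coeff r F
      map_add' := fun F G => by ext r; simp
      map_smul' := fun a F => by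
        ext r
        simp only [coeff_mk, coeff_smul, RingHom.id_apply]
        rw [smul_comm] }
    (by
      ext r
      simp only [LinearMap.coe_mk, AddHom.coe_mk, coeff_mk, coeff_one]
      split_ifs with h
      · simp [h]
      · simp)
    (fun F G => by
      ext r
      simp only [LinearMap.coe_mk, AddHom.coe_mk, coeff_mk, coeff_mul, Finset.smul_sum]
      refine Finset.sum_congr rfl fun x hx => ?_
      rw [smul_mul_smul_comm, ← Units.val_mul, ← zpow_add,
        ← Finset.HasAntidiagonal.mem_antidiagonal.1 hx]
      push_cast
      ring_nf)

theorem coeff_seriesScale (e : ℤ) (c : Kˣ) (F : A⟦X⟧) (r : ℕ) :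
    coeff r (seriesScale e c F) = ((c ^ (e * r) : Kˣ) : K) • coeff r F := by
  simp [seriesScale]

/-- Every coefficient of a function in the span is a polynomial in `c^e`. -/
theorem exists_polynomial_of_mem_span (e : ℤ) {f : Kˣ → A⟦X⟧}
    (hf : f ∈ Submodule.span K {f : Kˣ → A⟦X⟧ | ∃ x y : A⟦X⟧,
      f = (fun c => x * seriesScale e c y) ∨ f = fun c => seriesScale e c y * x})
    (n : ℕ) (φ : Module.Dual K A) :
    ∃ P : Polynomial K, ∀ c, φ (coeff n (f c)) = P.eval ((c ^ e : Kˣ) : K) := by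
  have hpow : ∀ (c : Kˣ) (j : ℕ), ((c ^ (e * j) : Kˣ) : K) = ((c ^ e : Kˣ) : K) ^ j := by
    intro c j
    rw [zpow_mul, zpow_natCast, Units.val_pow_eq_pow_val]
  induction hf using Submodule.span_induction with
  | mem f hf =>
    obtain ⟨x, y, rfl | rfl⟩ := hf
    · refine ⟨∑ p ∈ Finset.HasAntidiagonal.antidiagonal n,
        Polynomial.C (φ (coeff p.1 x * coeff p.2 y)) * Polynomial.X ^ p.2, fun c => ?_⟩
      simp only [coeff_mul, map_sum, Polynomial.eval_finsetSum, coeff_seriesScale,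
        mul_smul_comm, map_smul, Polynomial.eval_mul, Polynomial.eval_C, Polynomial.eval_pow,
        Polynomial.eval_X, hpow, smul_eq_mul, mul_comm]
    · refine ⟨∑ p ∈ Finset.HasAntidiagonal.antidiagonal n,
        Polynomial.C (φ (coeff p.1 y * coeff p.2 x)) * Polynomial.X ^ p.1, fun c => ?_⟩
      simp only [coeff_mul, map_sum, Polynomial.eval_finsetSum, coeff_seriesScale,
        smul_mul_assoc, map_smul, Polynomial.eval_mul, Polynomial.eval_C, Polynomial.eval_pow,
        Polynomial.eval_X, hpow, smul_eq_mul, mul_comm]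
  | zero => exact ⟨0, fun c => by simp⟩
  | add f g _ _ hf hg =>
    obtain ⟨P, hP⟩ := hf
    obtain ⟨P', hP'⟩ := hg
    exact ⟨P + P', fun c => by simp [hP, hP']⟩
  | smul a f _ hf =>
    obtain ⟨P, hP⟩ := hf
    exact ⟨Polynomial.C a * P, fun c => by
      rw [Pi.smul_apply, coeff_smul, map_smul, hP, Polynomial.eval_mul, Polynomial.eval_C,
        smul_eq_mul]⟩

/-- The rescalings of series in `z` or in `z⁻¹`. Density holds because a polynomial over an infinite
field with at most two nonroots is zero. -/
noncomputable def seriesScaling (K A : Type*) [Field K] [Infinite K] [Ring A] [Algebra K A] (e : ℤ)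
    (he : e * e = 1) : Scaling K A⟦X⟧ where
  scale := seriesScale e
  scale_one F := by ext r; simp [coeff_seriesScale]
  scale_scale a b F := by
    ext r
    rw [coeff_seriesScale, coeff_seriesScale, coeff_seriesScale, smul_smul, mul_zpow, Units.val_mul]
  dense f hf c₀ h := by
    ext n
    rw [map_zero]
    refine (Module.forall_dual_apply_eq_zero_iff K _).1 fun φ => ?_
    obtain ⟨P, hP⟩ := exists_polynomial_of_mem_span e hf n φ
    have : P = 0 := by
      refine Polynomial.eq_zero_of_infinite_isRoot P ?_
      -- Every `x` other than `0` and `c₀^e` is of the form `c^e` with `c ≠ c₀`, as `e² = 1`.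
      refine (Set.Finite.infinite_compl (s := {0, ((c₀ ^ e : Kˣ) : K)})
        (Set.toFinite _)).mono fun x hx => ?_
      simp only [Set.mem_compl_iff, Set.mem_insert_iff, Set.mem_singleton_iff, not_or] at hx
      have hc : (((Units.mk0 x hx.1) ^ e) ^ e : Kˣ) = Units.mk0 x hx.1 := by
        rw [← zpow_mul, he, zpow_one]
      have hne : (Units.mk0 x hx.1) ^ e ≠ c₀ := by
        intro h'
        rw [h'] at hc
        exact hx.2 (by rw [hc]; rfl)
      have := hP ((Units.mk0 x hx.1) ^ e)
      rw [h _ hne, map_zero, map_zero, hc] at this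
      exact this.symm
    rw [hP, this, Polynomial.eval_zero]

end SeriesScaling

/-! ### Triangular matrices -/

section Triangular

variable {R : Type*} [Ring R] {ι : Type*} [Fintype ι] [DecidableEq ι]

/-- A triangular matrix over a noncommutative ring is invertible if its diagonal entries are. The
indices are ordered by a function `f` with values below `n`. -/
theorem isUnit_of_triangular (f : ι → ℕ) (n : ℕ) (hf : ∀ i, f i < n) {T : Matrix ι ι R}
    (h : ∀ i j, i ≠ j → ¬ f i < f j → T i j = 0) (hd : ∀ i, IsUnit (T i i)) : IsUnit T := by
  choose d hd using hd
  let V : Matrix ι ι R := fun i j => if i = j then 0 else ((d i)⁻¹ : Rˣ) * T i j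
  -- The matrix is a diagonal matrix times `1 + V`, where `V` is nilpotent: its power `V ^ k`
  -- raises the value of `f` by at least `k`.
  have hV : ∀ k i j, f j < f i + k → (V ^ k) i j = 0 := by
    intro k
    induction k with
    | zero =>
      intro i j hij
      rw [pow_zero, Matrix.one_apply_ne]
      rintro rfl
      omega
    | succ k ih =>
      intro i j hij
      rw [pow_succ, Matrix.mul_apply]
      refine Finset.sum_eq_zero fun l _ => ?_
      by_cases hl : f l < f i + k
      · rw [ih i l hl, zero_mul]
      · by_cases hlj : l = j
        · simp [V, hlj]
        · simp [V, hlj, h l j hlj (by omega)]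
  have hnil : IsNilpotent V := ⟨n, by
    ext i j
    exact hV n i j (by have := hf j; omega)⟩
  have hdiag : IsUnit (Matrix.diagonal fun i => (d i : R)) := by
    refine isUnit_iff_exists.2 ⟨Matrix.diagonal fun i => ((d i)⁻¹ : Rˣ), ?_, ?_⟩ <;>
      simp [Matrix.diagonal_mul_diagonal]
  have hT : T = Matrix.diagonal (fun i => (d i : R)) * (1 + V) := by
    ext i j
    rw [Matrix.diagonal_mul, Matrix.add_apply]
    by_cases hij : i = j
    · subst hij
      simp [V, hd]
    · simp [V, hij]
  rw [hT]
  exact hdiag.mul hnil.isUnit_one_add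

/-- The matrix of power series that corresponds to a power series with matrix coefficients. -/
noncomputable def matrixOfSeries : (Matrix ι ι R)⟦X⟧ →+* Matrix ι ι R⟦X⟧ where
  toFun F := Matrix.of fun i j => PowerSeries.mk fun r => (coeff r F) i j
  map_one' := by
    ext i j r
    rw [Matrix.of_apply, coeff_mk, coeff_one, Matrix.one_apply]
    by_cases hr : r = 0 <;> by_cases hij : i = j <;> simp [hr, hij, coeff_one, Matrix.one_apply]
  map_zero' := by ext i j r; simp
  map_add' F G := by ext i j r; simp
  map_mul' F G := by
    ext i j r
    simp only [Matrix.of_apply, coeff_mk, coeff_mul, Matrix.mul_apply, map_sum, Matrix.sum_apply]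
    rw [Finset.sum_comm]

/-- A matrix of power series is invertible if the matrix of its constant terms is. -/
theorem isUnit_of_isUnit_constantCoeff {T : Matrix ι ι R⟦X⟧}
    (h : IsUnit (T.map (constantCoeff (R := R)))) : IsUnit T := by
  have hT : T = matrixOfSeries (PowerSeries.mk fun r => T.map (coeff r)) := by
    ext i j r
    simp [matrixOfSeries]
  rw [hT]
  refine IsUnit.map _ (PowerSeries.isUnit_iff_constantCoeff.2 ?_)
  convert h using 1
  ext i j
  simp

end Triangular

/-! ### From the graded product to the ordinary matrix product -/

section Hat

variable {K A : Type*} [Field K] [Ring A] [Algebra K A] {M N : ℕ}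

theorem par_evenOdd (i : Fin (M + N)) :
    par i = 0 ∧ evenOdd M i = false ∨ par i = 1 ∧ evenOdd M i = true := by
  by_cases h : (i : ℕ) < M
  · exact Or.inl ⟨if_pos h, decide_eq_false h.not_ge⟩
  · exact Or.inr ⟨if_neg h, decide_eq_true (not_lt.1 h)⟩

theorem neg_one_pow_mul (K : Type*) [Field K] [Algebra K A] (n : ℕ) (x : A) :
    (-1) ^ n * x = ((-1) ^ n : K) • x := by
  rcases neg_one_pow_eq_or A n with h | h <;> rcases Nat.even_or_odd n with h' | h' <;>
    simp [h'.neg_one_pow]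

/-- The sign `(-1)^{(i + 1) j}` by which the entry `(i,j)` is multiplied to turn the graded
product into the ordinary one. -/
def hatSign (K : Type*) [Field K] (i j : Fin (M + N)) : K := (-1) ^ ((par i + 1) * par j)

theorem hatSign_mul_self (i j : Fin (M + N)) : hatSign K i j * hatSign K i j = 1 := by
  rw [hatSign, ← mul_pow]
  norm_num

theorem hatSign_self (i : Fin (M + N)) : hatSign K i i = 1 := by
  rcases par_evenOdd i with ⟨h, _⟩ | ⟨h, _⟩ <;> simp [hatSign, h]

theorem hatSign_mul (i j k : Fin (M + N)) :
    hatSign K i k * (-1) ^ ((par i + par j) * (par j + par k)) =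
      hatSign K i j * hatSign K j k := by
  rcases par_evenOdd i with ⟨h, _⟩ | ⟨h, _⟩ <;> rcases par_evenOdd j with ⟨h2, _⟩ | ⟨h2, _⟩ <;>
    rcases par_evenOdd k with ⟨h3, _⟩ | ⟨h3, _⟩ <;> norm_num [hatSign, h, h2, h3]

/-- The ordinary matrix of an element of the graded tensor product. -/
def hat (K : Type*) [Field K] [Algebra K A] (X : SuperMat M N A) :
    Matrix (Fin (M + N)) (Fin (M + N)) A :=
  fun i j => hatSign K i j • X i j

theorem superMul₂_leg₁_leg₂ (X Y : SuperMat M N A) (a c b d : Fin (M + N)) :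
    superMul₂ (leg₁ X) (leg₂ Y) (a, c) (b, d) =
      ((-1) ^ ((par a + par b) * (par c + par d)) : K) • (X a b * Y c d) := by
  simp only [superMul₂, leg₁, leg₂, Fintype.sum_prod_type]
  rw [Finset.sum_eq_single b, Finset.sum_eq_single c]
  · simp only [if_true]
    rw [neg_one_pow_mul K]
    congr 1
    rcases par_evenOdd a with ⟨h, _⟩ | ⟨h, _⟩ <;> rcases par_evenOdd b with ⟨h2, _⟩ | ⟨h2, _⟩ <;>
    rcases par_evenOdd c with ⟨h3, _⟩ | ⟨h3, _⟩ <;> rcases par_evenOdd d with ⟨h4, _⟩ | ⟨h4, _⟩ <;>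
    norm_num [h, h2, h3, h4]
  · intro e _ he
    rw [if_neg (Ne.symm he), zero_mul, mul_zero]
  · simp
  · intro e _ he
    refine Finset.sum_eq_zero fun f _ => ?_
    rw [if_neg he, mul_zero, mul_zero]
  · simp

theorem superMul₂_leg₂_leg₁ (X Y : SuperMat M N A) (a c b d : Fin (M + N)) :
    superMul₂ (leg₂ Y) (leg₁ X) (a, c) (b, d) = Y c d * X a b := by
  simp only [superMul₂, leg₁, leg₂, Fintype.sum_prod_type]
  rw [Finset.sum_eq_single a, Finset.sum_eq_single d]
  · simp only [if_true]
    rcases par_evenOdd a with ⟨h, _⟩ | ⟨h, _⟩ <;> rcases par_evenOdd b with ⟨h2, _⟩ | ⟨h2, _⟩ <;>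
    rcases par_evenOdd c with ⟨h3, _⟩ | ⟨h3, _⟩ <;> rcases par_evenOdd d with ⟨h4, _⟩ | ⟨h4, _⟩ <;>
    norm_num [h, h2, h3, h4]
  · intro e _ he
    rw [if_neg he, mul_zero, mul_zero]
  · simp
  · intro e _ he
    refine Finset.sum_eq_zero fun f _ => ?_
    rw [if_neg (Ne.symm he), zero_mul, mul_zero]
  · simp

theorem rMat_apply (q z w : K) (x y : Fin (M + N) × Fin (M + N)) :
    rMat q M N z w x y = (if y = x then rDiag (evenOdd M) q z w x.1 x.2 else 0) +
      if y = x.swap then sg K (evenOdd M) x.2 x.2 * rOff q z w x.1 x.2 else 0 := by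
  obtain ⟨a, c⟩ := x
  obtain ⟨b, d⟩ := y
  have hqi : ∀ i : Fin (M + N), qi q i = qpar (evenOdd M) q i := by
    intro i
    rcases par_evenOdd i with ⟨h, h'⟩ | ⟨h, h'⟩ <;> simp [qi, qpar, h, h']
  simp only [rMat, rDiag, rOff, hqi, Prod.swap_prod_mk, Prod.mk.injEq, smul_eq_mul, qpar_sub_inv]
  by_cases h1 : a = b
  · subst h1
    by_cases h2 : c = d
    · subst h2
      by_cases h3 : a = c
      · subst h3
        simp [mul_comm]
      · simp [h3]
    · by_cases h3 : a = c
      · subst h3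
        simp [h2, Ne.symm h2]
      · have : ¬ (a = d ∧ c = a) := fun h => h3 h.2.symm
        have : ¬ (a = c ∧ d = a) := fun h => h3 h.1
        simp [h2, h3, Ne.symm h2, Ne.symm h3]
  · by_cases h2 : a = d ∧ c = b
    · obtain ⟨rfl, rfl⟩ := h2
      simp [h1, Ne.symm h1, mul_assoc]
    · have : ¬ (b = c ∧ d = a) := fun h => h2 ⟨h.2.symm, h.1.symm⟩
      simp [h1, Ne.symm h1, h2, this]

/-- Multiplication with the R-matrix in the graded sense mixes two entries only. -/
theorem superMul₂_rMat_left (q z w : K) (V : Mat₂ M N A) (a c b d : Fin (M + N)) :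
    superMul₂ (fun x y => algebraMap K A (rMat q M N z w x y)) V (a, c) (b, d) =
      rDiag (evenOdd M) q z w a c • V (a, c) (b, d) +
        ((-1) ^ ((par a + par c) * (par c + par b)) * sg K (evenOdd M) c c * rOff q z w a c) •
          V (c, a) (b, d) := by
  simp only [superMul₂, rMat_apply, map_add, add_mul, mul_add, Finset.sum_add_distrib]
  simp only [apply_ite (algebraMap K A), map_zero, ite_mul, zero_mul, mul_ite, mul_zero,
    Finset.sum_ite_eq', Finset.mem_univ, if_true, Prod.swap_prod_mk]
  simp only [← Algebra.smul_def, neg_one_pow_mul K, smul_smul]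
  congr 2 <;>
  rcases par_evenOdd a with ⟨h, _⟩ | ⟨h, _⟩ <;> rcases par_evenOdd b with ⟨h2, _⟩ | ⟨h2, _⟩ <;>
    rcases par_evenOdd c with ⟨h3, _⟩ | ⟨h3, _⟩ <;> rcases par_evenOdd d with ⟨h4, _⟩ | ⟨h4, _⟩ <;>
    norm_num [h, h2, h3, h4]

theorem superMul₂_rMat_right (q z w : K) (V : Mat₂ M N A) (a c b d : Fin (M + N)) :
    superMul₂ V (fun x y => algebraMap K A (rMat q M N z w x y)) (a, c) (b, d) =
      rDiag (evenOdd M) q z w b d • V (a, c) (b, d) +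
        ((-1) ^ ((par b + par c) * (par b + par d)) * sg K (evenOdd M) b b * rOff q z w d b) •
          V (a, c) (d, b) := by
  have h : ∀ y : Fin (M + N) × Fin (M + N), ((b, d) = y.swap) ↔ y = (d, b) := by
    rintro ⟨y1, y2⟩; simp only [Prod.swap_prod_mk, Prod.mk.injEq]; tauto
  simp only [superMul₂, rMat_apply, map_add, mul_add, Finset.sum_add_distrib, h]
  simp only [apply_ite (algebraMap K A), map_zero, mul_ite, mul_zero, Finset.sum_ite_eq,
    Finset.sum_ite_eq', Finset.mem_univ, if_true]
  simp only [← Algebra.commutes, ← Algebra.smul_def, neg_one_pow_mul K, smul_smul]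
  congr 2 <;>
  rcases par_evenOdd a with ⟨h, _⟩ | ⟨h, _⟩ <;> rcases par_evenOdd b with ⟨h2, _⟩ | ⟨h2, _⟩ <;>
    rcases par_evenOdd c with ⟨h3, _⟩ | ⟨h3, _⟩ <;> rcases par_evenOdd d with ⟨h4, _⟩ | ⟨h4, _⟩ <;>
    norm_num [h, h2, h3, h4]

/-- The sign `(-1)^{(a + c + 1)(b + d) + b (c + d)}` of the entry in row `(a, c)` and column
`(b, d)` for two legs. -/
def hatSign₂ (K : Type*) [Field K] (a c b d : Fin (M + N)) : K :=
  (-1) ^ ((par a + par c + 1) * (par b + par d) + par b * (par c + par d))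

/-- The signs of `hatSign₂` turn the left-hand side of the graded exchange relation into the one for
the ordinary product. -/
theorem rMatrix_mul_hat (q z w : K) (X Y : SuperMat M N A) (a c b d : Fin (M + N)) :
    (rMatrix (evenOdd M (n := M + N)) q A z w *
      (legOne (evenOdd M (n := M + N)) (K := K) (hat K X) * legTwo (hat K Y))) (a, c) (b, d) =
    hatSign₂ K a c b d • superMul₂ (fun x y => algebraMap K A (rMat q M N z w x y))
      (superMul₂ (leg₁ X) (leg₂ Y)) (a, c) (b, d) := by
  rw [rMatrix_mul_apply, legOne_mul_legTwo_apply, legOne_mul_legTwo_apply, superMul₂_rMat_left,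
    superMul₂_leg₁_leg₂ (K := K), superMul₂_leg₁_leg₂ (K := K)]
  simp only [hat, smul_mul_smul_comm, smul_smul, smul_add]
  congr 2 <;>
  rcases par_evenOdd a with ⟨h, g⟩ | ⟨h, g⟩ <;> rcases par_evenOdd b with ⟨h2, g2⟩ | ⟨h2, g2⟩ <;>
    rcases par_evenOdd c with ⟨h3, g3⟩ | ⟨h3, g3⟩ <;>
    rcases par_evenOdd d with ⟨h4, g4⟩ | ⟨h4, g4⟩ <;>
    norm_num [hatSign, hatSign₂, sg, h, h2, h3, h4, g, g2, g3, g4]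

/-- The signs of `hatSign₂` turn the right-hand side of the graded exchange relation into the one
for the ordinary product. -/
theorem hat_mul_rMatrix (q z w : K) (X Y : SuperMat M N A) (a c b d : Fin (M + N)) :
    (legTwo (hat K Y) * legOne (evenOdd M (n := M + N)) (K := K) (hat K X) *
      rMatrix (evenOdd M (n := M + N)) q A z w) (a, c) (b, d) =
    hatSign₂ K a c b d • superMul₂ (superMul₂ (leg₂ Y) (leg₁ X))
      (fun x y => algebraMap K A (rMat q M N z w x y)) (a, c) (b, d) := by
  rw [mul_rMatrix_apply, legTwo_mul_legOne_apply, legTwo_mul_legOne_apply, superMul₂_rMat_right,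
    superMul₂_leg₂_leg₁, superMul₂_leg₂_leg₁]
  simp only [hat, smul_mul_smul_comm, smul_smul, smul_add]
  congr 2 <;>
  rcases par_evenOdd a with ⟨h, g⟩ | ⟨h, g⟩ <;> rcases par_evenOdd b with ⟨h2, g2⟩ | ⟨h2, g2⟩ <;>
    rcases par_evenOdd c with ⟨h3, g3⟩ | ⟨h3, g3⟩ <;>
    rcases par_evenOdd d with ⟨h4, g4⟩ | ⟨h4, g4⟩ <;>
    norm_num [hatSign, hatSign₂, sg, h, h2, h3, h4, g, g2, g3, g4]

end Hat

/-! ### The exchange relation for the generating series -/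

section SeriesExchange

variable {K A : Type*} [Field K] [Ring A] [Algebra K A]

section

variable {ι : Type*} [LinearOrder ι] [Fintype ι] (p : ι → Bool) (q : K)

/-- The difference of the two sides of the relation `R(z,w) X₁ Y₂ = Y₂ X₁ R(z,w)`. -/
def rllDefect (z w : K) (X Y : Matrix ι ι A) : Matrix (ι × ι) (ι × ι) A :=
  rMatrix p q A z w * (legOne p (K := K) X * legTwo Y) -
    legTwo Y * legOne p (K := K) X * rMatrix p q A z w

variable {p q}

theorem rllDefect_apply (z w : K) (X Y : Matrix ι ι A) (a c b d : ι) :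
    rllDefect p q z w X Y (a, c) (b, d) =
      (rDiag p q z w a c * (sg K p c a * sg K p c b)) • (X a b * Y c d) +
        (sg K p a c * rOff q z w a c * (sg K p a c * sg K p a b)) • (X c b * Y a d) -
      ((rDiag p q z w b d * (sg K p d a * sg K p d b)) • (Y c d * X a b) +
        (sg K p b d * rOff q z w d b * (sg K p b a * sg K p b d)) • (Y c b * X a d)) := by
  rw [rllDefect, Matrix.sub_apply, rMatrix_mul_apply, mul_rMatrix_apply, legOne_mul_legTwo_apply,
    legOne_mul_legTwo_apply, legTwo_mul_legOne_apply, legTwo_mul_legOne_apply]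
  simp only [smul_smul]

theorem rllDefect_zero_left (z w : K) (Y : Matrix ι ι A) : rllDefect p q z w 0 Y = 0 := by
  ext ⟨a, c⟩ ⟨b, d⟩
  simp [rllDefect_apply]

theorem rllDefect_zero_right (z w : K) (X : Matrix ι ι A) : rllDefect p q z w X 0 = 0 := by
  ext ⟨a, c⟩ ⟨b, d⟩
  simp [rllDefect_apply]

/-- The exchange relation is linear and homogeneous in `z` and `w`. -/
theorem rllDefect_eq (z w : K) (X Y : Matrix ι ι A) :
    rllDefect p q z w X Y = z • rllDefect p q 1 0 X Y + w • rllDefect p q 0 1 X Y := by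
  ext ⟨a, c⟩ ⟨b, d⟩
  have hd : ∀ a c : ι, rDiag p q z w a c = z * rDiag p q 1 0 a c + w * rDiag p q 0 1 a c := by
    intro a c
    unfold rDiag
    split_ifs <;> ring
  have ho : ∀ a c : ι, rOff q z w a c = z * rOff q 1 0 a c + w * rOff q 0 1 a c := by
    intro a c
    unfold rOff
    split_ifs <;> ring
  simp only [Matrix.add_apply, Matrix.smul_apply, rllDefect_apply, hd a c, hd b d, ho a c, ho d b]
  module

/-- The coefficients of the exchange relation for two series with arguments `z` and `w`. -/
theorem coeff_rllDefect (e : ℤ) (z w : Kˣ) (F G : Matrix ι ι A⟦X⟧) (n : ℕ) (x y : ι × ι) :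
    coeff n (rllDefect p q (z : K) w (F.map (seriesScale e z)) (G.map (seriesScale e w)) x y) =
      ∑ k ∈ Finset.HasAntidiagonal.antidiagonal n,
        (((z ^ (e * k.1) : Kˣ) : K) * ((w ^ (e * k.2) : Kˣ) : K)) •
          rllDefect p q (z : K) w (F.map (coeff k.1)) (G.map (coeff k.2)) x y := by
  obtain ⟨a, c⟩ := x
  obtain ⟨b, d⟩ := y
  have h1 : ∀ P Q : A⟦X⟧, coeff n (seriesScale e z P * seriesScale e w Q) =
      ∑ k ∈ Finset.HasAntidiagonal.antidiagonal n,
        (((z ^ (e * k.1) : Kˣ) : K) * ((w ^ (e * k.2) : Kˣ) : K)) • (coeff k.1 P * coeff k.2 Q) := by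
    intro P Q
    simp only [coeff_mul, coeff_seriesScale, smul_mul_smul_comm]
  have h2 : ∀ P Q : A⟦X⟧, coeff n (seriesScale e w Q * seriesScale e z P) =
      ∑ k ∈ Finset.HasAntidiagonal.antidiagonal n,
        (((z ^ (e * k.1) : Kˣ) : K) * ((w ^ (e * k.2) : Kˣ) : K)) • (coeff k.2 Q * coeff k.1 P) := by
    intro P Q
    rw [coeff_mul, ← Finset.Nat.sum_antidiagonal_swap]
    simp only [coeff_seriesScale, smul_mul_smul_comm, Prod.fst_swap, Prod.snd_swap, mul_comm]
  simp only [rllDefect_apply, Matrix.map_apply, map_sub, map_add, coeff_smul, h1, h2,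
    Finset.smul_sum, smul_sub, smul_add, Finset.sum_add_distrib, Finset.sum_sub_distrib]
  simp only [smul_comm (_ : K) (((z ^ (e * _) : Kˣ) : K) * _) (_ : A)]

end

/-- The homogeneous part of degree `n + 1` of the series `∑ (z g i j + w g' i j) z^i w^j` is zero if
the coefficient of each monomial is. -/
theorem sum_antidiagonal_eq_zero {V : Type*} [AddCommGroup V] [Module K V] {g g' : ℕ → ℕ → V}
    (h0 : ∀ j, g' 0 j = 0) (h0' : ∀ i, g i 0 = 0) (h : ∀ i j, g i (j + 1) + g' (i + 1) j = 0)
    (z w : K) (n : ℕ) :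
    ∑ k ∈ Finset.HasAntidiagonal.antidiagonal n,
      (z ^ k.1 * w ^ k.2) • (z • g k.1 k.2 + w • g' k.1 k.2) = 0 := by
  -- The terms of total degree `n + 1`, sorted by monomials.
  let f : ℕ × ℕ → V := fun k => (z ^ k.1 * w ^ k.2) • (if k.1 = 0 then 0 else g (k.1 - 1) k.2)
  let f' : ℕ × ℕ → V := fun k => (z ^ k.1 * w ^ k.2) • (if k.2 = 0 then 0 else g' k.1 (k.2 - 1))
  have e1 := Finset.Nat.sum_antidiagonal_succ (n := n) (f := f)
  have e2 := Finset.Nat.sum_antidiagonal_succ' (n := n) (f := f')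
  have e3 : ∀ k ∈ Finset.HasAntidiagonal.antidiagonal (n + 1), f k + f' k = 0 := by
    rintro ⟨i, j⟩ -
    rcases i with _ | i <;> rcases j with _ | j <;> simp [f, f', h0, h0', ← smul_add, h]
  calc _ = ∑ k ∈ Finset.HasAntidiagonal.antidiagonal n, f (k.1 + 1, k.2) +
        ∑ k ∈ Finset.HasAntidiagonal.antidiagonal n, f' (k.1, k.2 + 1) := by
        rw [← Finset.sum_add_distrib]
        refine Finset.sum_congr rfl fun k _ => ?_
        simp only [f, f', Nat.add_eq_zero_iff, one_ne_zero, and_false, if_false,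
          Nat.add_sub_cancel, smul_add, smul_smul, pow_succ]
        congr 2 <;> ring
    _ = 0 := by
        have z1 : f (0, n + 1) = 0 := by simp [f]
        have z2 : f' (n + 1, 0) = 0 := by simp [f']
        rw [z1, zero_add] at e1
        rw [z2, zero_add] at e2
        rw [← e1, ← e2, ← Finset.sum_add_distrib]
        exact Finset.sum_eq_zero e3

end SeriesExchange

section Generators

variable {K : Type*} [Field K] (q : K) (M N : ℕ)

theorem map_superMul₂ {A B : Type*} [Ring A] [Algebra K A] [Ring B] [Algebra K B] (f : A →ₐ[K] B)
    {M N : ℕ} (X Y : Mat₂ M N A) (x y : Fin (M + N) × Fin (M + N)) :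
    f (superMul₂ X Y x y) = superMul₂ (X.map f) (Y.map f) x y := by
  simp [superMul₂]

/-- The coefficient of `z^m` in `L^±(z)`, for an integer `m`. -/
noncomputable def lCoeff (s : PM) (m : ℤ) : SuperMat M N (Uq q M N) :=
  fun i j => Uq.mk q M N (genLz K M N s m i j)

theorem leg₁_map {A B : Type*} [Ring A] [Algebra K A] [Ring B] [Algebra K B] (f : A →ₐ[K] B)
    {M N : ℕ} (X : SuperMat M N A) :
    (leg₁ X).map f = leg₁ (fun i j => f (X i j) : SuperMat M N B) := by
  ext x y
  simp only [Matrix.map_apply, leg₁]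
  split_ifs <;> simp

theorem leg₂_map {A B : Type*} [Ring A] [Algebra K A] [Ring B] [Algebra K B] (f : A →ₐ[K] B)
    {M N : ℕ} (X : SuperMat M N A) :
    (leg₂ X).map f = leg₂ (fun i j => f (X i j) : SuperMat M N B) := by
  ext x y
  simp only [Matrix.map_apply, leg₂]
  split_ifs <;> simp

/-- The coefficient of `z^m w^n` in the defining exchange relation, for the ordinary product. -/
theorem rllDefect_lCoeff (s : PM) (m n : ℤ) :
    rllDefect (evenOdd M) q 1 0 (hat K (lCoeff q M N s (m - 1))) (hat K (lCoeff q M N s n)) +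
      rllDefect (evenOdd M) q 0 1 (hat K (lCoeff q M N s m)) (hat K (lCoeff q M N s (n - 1))) =
        0 := by
  ext ⟨a, c⟩ ⟨b, d⟩
  have h : Uq.mk q M N (rllLeft q M N s m n (a, c) (b, d)) =
      Uq.mk q M N (rllRight q M N s m n (a, c) (b, d)) :=
    RingQuot.mkAlgHom_rel K (Rel.rll s m n (a, c) (b, d))
  have hs : ∀ R : Mat₂ M N K, (scal R).map (Uq.mk q M N) =
      fun x y => algebraMap K (Uq q M N) (R x y) := by
    intro R
    ext x y
    simp [scal]
  have hm : ∀ X Y : Mat₂ M N (Free K M N), (superMul₂ X Y).map (Uq.mk q M N) =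
      superMul₂ (X.map (Uq.mk q M N)) (Y.map (Uq.mk q M N)) := by
    intro X Y
    ext x y
    exact map_superMul₂ _ _ _ _ _
  rw [rllLeft, rllRight, Matrix.add_apply, Matrix.add_apply, map_add, map_add] at h
  simp only [map_superMul₂, hm, hs, leg₁_map, leg₂_map] at h
  simp only [rllDefect, Matrix.add_apply, Matrix.sub_apply, rMatrix_mul_hat, hat_mul_rMatrix,
    Matrix.zero_apply]
  have h := congrArg (fun t => hatSign₂ K a c b d • t) h
  simp only [smul_add] at h
  rw [sub_add_sub_comm, sub_eq_zero]
  exact h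

theorem coeff_L (s : PM) (r : ℕ) (i j : Fin (M + N)) :
    (coeff r (L q M N s) : SuperMat M N (Uq q M N)) i j = Uq.mk q M N (genL K M N s r i j) :=
  congrFun (congrFun (coeff_mk (R := SuperMat M N (Uq q M N)) _ _) i) j

theorem lCoeff_minus (r : ℕ) : lCoeff q M N .minus r = coeff r (L q M N .minus) := by
  ext i j
  simp [coeff_L, lCoeff, genLz, PM.expo]

theorem lCoeff_plus (r : ℕ) : lCoeff q M N .plus (-r) = coeff r (L q M N .plus) := by
  ext i j
  simp [coeff_L, lCoeff, genLz, PM.expo]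

theorem lCoeff_eq_zero (s : PM) (m : ℤ) (h : s.expo * m < 0) : lCoeff q M N s m = 0 := by
  ext i j
  simp [lCoeff, genLz, h.not_ge, SuperMat.zero_apply]

end Generators

/-! ### The system of the generating series -/

section HatSeries

variable {K A : Type*} [Field K] [Ring A] [Algebra K A] {M N : ℕ}

/-- The ordinary matrix of series for a series with coefficients in the graded tensor product. -/
noncomputable def hatSeries (K : Type*) [Field K] [Algebra K A] (F : (SuperMat M N A)⟦X⟧) :
    Matrix (Fin (M + N)) (Fin (M + N)) A⟦X⟧ :=
  fun i j => hatSign K i j • entry F i j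

theorem coeff_entry (F : (SuperMat M N A)⟦X⟧) (i j : Fin (M + N)) (r : ℕ) :
    coeff r (entry F i j) = (coeff r F : SuperMat M N A) i j := by
  rw [entry, coeff_mk]

theorem hatSeries_map_coeff (F : (SuperMat M N A)⟦X⟧) (r : ℕ) :
    (hatSeries K F).map (coeff r) = hat K (coeff r F) := by
  ext i j
  rw [Matrix.map_apply, hatSeries, coeff_smul, coeff_entry, hat]

theorem hatSeries_injective : Function.Injective
    (hatSeries K : (SuperMat M N A)⟦X⟧ → Matrix (Fin (M + N)) (Fin (M + N)) A⟦X⟧) := by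
  intro F G h
  refine PowerSeries.ext fun r => ?_
  have := congrArg (fun T => T.map (coeff r)) h
  simp only [hatSeries_map_coeff] at this
  ext i j
  have := congrArg (fun T => hatSign K i j • T i j) this
  simpa only [hat, smul_smul, hatSign_mul_self, one_smul] using this

theorem hatSeries_surjective : Function.Surjective
    (hatSeries K : (SuperMat M N A)⟦X⟧ → Matrix (Fin (M + N)) (Fin (M + N)) A⟦X⟧) := by
  intro V
  let F : (SuperMat M N A)⟦X⟧ :=
    PowerSeries.mk (R := SuperMat M N A) fun r i j => hatSign K i j • coeff r (V i j)
  have hF : ∀ r i j, (coeff r F : SuperMat M N A) i j = hatSign K i j • coeff r (V i j) :=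
    fun r i j => congrFun (congrFun (coeff_mk (R := SuperMat M N A) _ _) i) j
  refine ⟨F, ?_⟩
  ext i j r
  rw [hatSeries, coeff_smul, coeff_entry, hF, smul_smul, hatSign_mul_self, one_smul]

theorem entry_mul (F G : (SuperMat M N A)⟦X⟧) (i k : Fin (M + N)) :
    entry (F * G) i k = ∑ j, ((-1) ^ ((par i + par j) * (par j + par k)) : K) •
      (entry F i j * entry G j k) := by
  have hsum : ∀ (s : Finset (ℕ × ℕ)) (f : ℕ × ℕ → SuperMat M N A),
      (∑ x ∈ s, f x) i k = ∑ x ∈ s, f x i k := by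
    intro s f
    exact Matrix.sum_apply i k s f
  ext r
  rw [coeff_entry, coeff_mul, hsum]
  simp only [SuperMat.mul_apply, map_sum, coeff_smul, coeff_mul, coeff_entry, Finset.smul_sum,
    neg_one_pow_mul K]
  rw [Finset.sum_comm]

theorem hatSeries_mul (F G : (SuperMat M N A)⟦X⟧) :
    hatSeries K (F * G) = hatSeries K F * hatSeries K G := by
  ext1 i k
  rw [hatSeries, entry_mul (K := K), Matrix.mul_apply, Finset.smul_sum]
  refine Finset.sum_congr rfl fun j _ => ?_
  rw [hatSeries, hatSeries, smul_mul_smul_comm, smul_smul, hatSign_mul]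

theorem coeff_scalarSeries (Z : A⟦X⟧) (r : ℕ) (i j : Fin (M + N)) :
    (coeff r (scalarSeries M N Z) : SuperMat M N A) i j = if i = j then coeff r Z else 0 :=
  congrFun (congrFun (coeff_mk (R := SuperMat M N A) _ _) i) j

theorem coeff_stSeries (F : (SuperMat M N A)⟦X⟧) (r : ℕ) (i j : Fin (M + N)) :
    (coeff r (stSeries F) : SuperMat M N A) i j =
      (-1) ^ (par i * (par i + par j)) * (coeff r F : SuperMat M N A) j i :=
  congrFun (congrFun (coeff_mk (R := SuperMat M N A) _ _) i) j

theorem hatSeries_scalarSeries (Z : A⟦X⟧) :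
    hatSeries K (scalarSeries M N Z) = Matrix.diagonal fun _ => Z := by
  ext i j r
  rw [hatSeries, coeff_smul, coeff_entry, coeff_scalarSeries]
  by_cases h : i = j
  · subst h
    simp [hatSign_self]
  · simp [h]

theorem scalarSeries_one : scalarSeries M N (1 : A⟦X⟧) = 1 := by
  refine PowerSeries.ext fun r => ?_
  ext i j
  rw [coeff_scalarSeries, coeff_one]
  by_cases hr : r = 0
  · subst hr
    simp [SuperMat.one_apply]
  · simp [hr, coeff_one, SuperMat.zero_apply]

theorem hatSeries_one : hatSeries K (1 : (SuperMat M N A)⟦X⟧) = 1 := by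
  rw [← scalarSeries_one, hatSeries_scalarSeries]
  rfl

/-- The matrix that represents the supertranspose. -/
theorem hatSeries_stSeries (F : (SuperMat M N A)⟦X⟧) (i j : Fin (M + N)) :
    hatSeries K (stSeries F) i j =
      (sg K (evenOdd M) i j * sg K (evenOdd M) j j) • hatSeries K F j i := by
  ext r
  rw [hatSeries, hatSeries, coeff_smul, coeff_smul, coeff_smul, coeff_entry, coeff_entry,
    coeff_stSeries, neg_one_pow_mul K, smul_smul, smul_smul]
  congr 1
  rcases par_evenOdd i with ⟨h, g⟩ | ⟨h, g⟩ <;> rcases par_evenOdd j with ⟨h2, g2⟩ | ⟨h2, g2⟩ <;>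
    norm_num [hatSign, sg, h, h2, g, g2]

theorem PM.expo_mul_self (s : PM) : s.expo * s.expo = 1 := by
  cases s <;> rfl

theorem shift_eq_seriesScale (Q : Kˣ) (s : PM) (k : ℤ) (F : A⟦X⟧) :
    shift (Q : K) s k F = seriesScale s.expo (Q ^ k) F := by
  ext r
  rw [shift, coeff_mk, coeff_seriesScale, ← zpow_mul, Units.val_zpow_eq_zpow_val]
  congr 2
  ring

theorem entry_shift (Q : Kˣ) (s : PM) (k : ℤ) (F : (SuperMat M N A)⟦X⟧) (i j : Fin (M + N)) :
    entry (shift (Q : K) s k F) i j = seriesScale s.expo (Q ^ k) (entry F i j) := by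
  rw [← shift_eq_seriesScale]
  ext r
  rw [coeff_entry, shift, shift, coeff_mk, coeff_mk, coeff_entry]
  rfl

theorem hatSeries_shift (Q : Kˣ) (s : PM) (k : ℤ) (F : (SuperMat M N A)⟦X⟧) :
    hatSeries K (shift (Q : K) s k F) = (hatSeries K F).map (seriesScale s.expo (Q ^ k)) := by
  ext1 i j
  rw [hatSeries, entry_shift, Matrix.map_apply, hatSeries, map_smul]

end HatSeries

section System

variable {K : Type*} [Field K] (q : K) (M N : ℕ) (s : PM)

/-- The exchange relation for the generating series with arguments `az` and `bz`, obtained by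
comparing coefficients with the defining relations. -/
theorem isRLL_hatSeries_L (a b : Kˣ) : IsRLL (evenOdd M) q (a : K) b
    ((hatSeries K (L q M N s)).map (seriesScale s.expo a))
    ((hatSeries K (L q M N s)).map (seriesScale s.expo b)) := by
  suffices h : rllDefect (evenOdd M) q (a : K) b
      ((hatSeries K (L q M N s)).map (seriesScale s.expo a))
      ((hatSeries K (L q M N s)).map (seriesScale s.expo b)) = 0 from sub_eq_zero.1 h
  ext x y n
  rw [coeff_rllDefect]
  simp only [hatSeries_map_coeff, Matrix.zero_apply, map_zero]
  have h0 : ∀ m : ℤ, s.expo * m < 0 → hat K (lCoeff q M N s m) = 0 := fun m hm => by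
    rw [lCoeff_eq_zero q M N s m hm]
    ext i j
    simp [hat, SuperMat.zero_apply]
  cases s with
  | minus =>
    have hz : lCoeff q M N .minus 0 = coeff 0 (L q M N .minus) := by
      exact_mod_cast lCoeff_minus q M N 0
    have key := sum_antidiagonal_eq_zero (K := K)
      (g := fun i j => rllDefect (evenOdd M) q 1 0 (hat K (coeff i (L q M N .minus)))
        (hat K (coeff j (L q M N .minus))) x y)
      (g' := fun i j => rllDefect (evenOdd M) q 0 1 (hat K (coeff i (L q M N .minus)))
        (hat K (coeff j (L q M N .minus))) x y)
      (fun j => by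
        have := congrFun (congrFun (rllDefect_lCoeff q M N .minus 0 (j + 1)) x) y
        rw [h0 (0 - 1) (by simp [PM.expo]), rllDefect_zero_left, zero_add, add_sub_cancel_right,
          hz, lCoeff_minus] at this
        exact this)
      (fun i => by
        have := congrFun (congrFun (rllDefect_lCoeff q M N .minus (i + 1) 0) x) y
        rw [h0 (0 - 1) (by simp [PM.expo]), rllDefect_zero_right, add_zero, add_sub_cancel_right,
          hz, lCoeff_minus] at this
        exact this)
      (fun i j => by
        have := congrFun (congrFun
          (rllDefect_lCoeff q M N .minus ((i + 1 : ℕ) : ℤ) ((j + 1 : ℕ) : ℤ)) x) y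
        rw [show ((i + 1 : ℕ) : ℤ) - 1 = (i : ℕ) by simp,
          show ((j + 1 : ℕ) : ℤ) - 1 = (j : ℕ) by simp, lCoeff_minus, lCoeff_minus, lCoeff_minus,
          lCoeff_minus] at this
        exact this) (a : K) b n
    rw [← key]
    refine Finset.sum_congr rfl fun k _ => ?_
    rw [rllDefect_eq (a : K) b]
    simp [PM.expo]
  | plus =>
    -- The variable stands for `z⁻¹` here. After division by `zw`, the coefficients of `z` and `w`
    -- in the R-matrix belong to `w⁻¹` and `z⁻¹`, so that their roles are exchanged.
    have key := sum_antidiagonal_eq_zero (K := K)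
      (g := fun i j => rllDefect (evenOdd M) q 0 1 (hat K (coeff i (L q M N .plus)))
        (hat K (coeff j (L q M N .plus))) x y)
      (g' := fun i j => rllDefect (evenOdd M) q 1 0 (hat K (coeff i (L q M N .plus)))
        (hat K (coeff j (L q M N .plus))) x y)
      (fun j => by
        have := congrFun (congrFun (rllDefect_lCoeff q M N .plus 1 (-(j : ℕ))) x) y
        rw [h0 1 (by simp [PM.expo]), rllDefect_zero_left, add_zero,
          show (1 - 1 : ℤ) = -(0 : ℕ) by simp, lCoeff_plus, lCoeff_plus] at this
        exact this)
      (fun i => by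
        have := congrFun (congrFun (rllDefect_lCoeff q M N .plus (-(i : ℕ)) 1) x) y
        rw [h0 1 (by simp [PM.expo]), rllDefect_zero_right, zero_add,
          show (1 - 1 : ℤ) = -(0 : ℕ) by simp, lCoeff_plus, lCoeff_plus] at this
        exact this)
      (fun i j => by
        have := congrFun (congrFun
          (rllDefect_lCoeff q M N .plus (-(i : ℕ)) (-(j : ℕ))) x) y
        rw [show (-(i : ℕ) : ℤ) - 1 = -((i + 1 : ℕ) : ℤ) by push_cast; ring,
          show (-(j : ℕ) : ℤ) - 1 = -((j + 1 : ℕ) : ℤ) by push_cast; ring, lCoeff_plus, lCoeff_plus,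
          lCoeff_plus, lCoeff_plus, add_comm] at this
        exact this) (a : K)⁻¹ (b : K)⁻¹ n
    have key := congrArg (fun t => ((a : K) * b) • t) key
    simp only [smul_zero] at key
    rw [← key, Finset.smul_sum]
    refine Finset.sum_congr rfl fun k _ => ?_
    rw [rllDefect_eq (a : K) b]
    have ha := a.ne_zero
    have hb := b.ne_zero
    simp only [PM.expo, Matrix.add_apply, Matrix.smul_apply, neg_mul, one_mul, zpow_neg,
      zpow_natCast, inv_pow, Units.val_inv_eq_inv_val, Units.val_pow_eq_pow_val, smul_add, smul_smul]
    rw [add_comm]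
    congr 2 <;> field_simp

/-- The leading submatrices are invertible, since their constant terms are triangular. -/
theorem isUnit_submatrix_hatSeries_L {k m : ℕ} (h : k + m = M + N) :
    IsUnit ((hatSeries K (L q M N s)).submatrix (firstIdx h) (firstIdx h)) := by
  refine isUnit_of_isUnit_constantCoeff ?_
  have hc : ∀ i j, constantCoeff (hatSeries K (L q M N s) i j) =
      hatSign K i j • Uq.mk q M N (genL K M N s 0 i j) := by
    intro i j
    rw [← coeff_zero_eq_constantCoeff_apply, hatSeries, coeff_smul, coeff_entry,
      coeff_L]
  have hd : ∀ i, IsUnit (constantCoeff (hatSeries K (L q M N s) i i)) := by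
    intro i
    rw [hc, hatSign_self, one_smul]
    have h1 := RingQuot.mkAlgHom_rel K (Rel.diagLeft (q := q) (M := M) (N := N) i)
    have h2 := RingQuot.mkAlgHom_rel K (Rel.diagRight (q := q) (M := M) (N := N) i)
    rw [map_mul, map_one] at h1 h2
    cases s with
    | plus => exact isUnit_iff_exists.2 ⟨_, h2, h1⟩
    | minus => exact isUnit_iff_exists.2 ⟨_, h1, h2⟩
  cases s with
  | plus =>
    refine isUnit_of_triangular (fun i : Fin k => (i : ℕ)) k (fun i => i.isLt)
      (fun i j hij hlt => ?_) (fun i => hd _)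
    have hji : firstIdx h j < firstIdx h i := by
      have : (i : ℕ) ≠ j := fun e => hij (Fin.ext e)
      change (j : ℕ) < i
      omega
    have : Uq.mk q M N (genL K M N .plus 0 (firstIdx h i) (firstIdx h j)) = 0 :=
      (RingQuot.mkAlgHom_rel K (Rel.triPlus (q := q) _ _ hji)).trans (map_zero _)
    change constantCoeff (hatSeries K (L q M N .plus) (firstIdx h i) (firstIdx h j)) = 0
    rw [hc, this, smul_zero]
  | minus =>
    refine isUnit_of_triangular (fun i : Fin k => (i.rev : ℕ)) k (fun i => i.rev.isLt)
      (fun i j hij hlt => ?_) (fun i => hd _)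
    have hji : firstIdx h i < firstIdx h j := by
      have : (i : ℕ) ≠ j := fun e => hij (Fin.ext e)
      change (i : ℕ) < j
      simp only [Fin.val_rev] at hlt
      omega
    have : Uq.mk q M N (genL K M N .minus 0 (firstIdx h i) (firstIdx h j)) = 0 :=
      (RingQuot.mkAlgHom_rel K (Rel.triMinus (q := q) _ _ hji)).trans (map_zero _)
    change constantCoeff (hatSeries K (L q M N .minus) (firstIdx h i) (firstIdx h j)) = 0
    rw [hc, this, smul_zero]

theorem hasLastMinors_of_mul_eq_one {A : Type*} [Ring A] {n : ℕ} {L L' : Matrix (Fin n) (Fin n) A}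
    (h : L * L' = 1) (h' : L' * L = 1)
    (hL : ∀ {k m : ℕ} (hk : k + m = n), IsUnit (L.submatrix (firstIdx hk) (firstIdx hk))) :
    HasLastMinors L' := by
  intro k m hk
  refine isUnit_submatrix_of_compl (g := firstIdx hk) ?_ h' h (hL hk)
  have := (bijective_firstIdx_lastIdx hk).comp (Equiv.sumComm (Fin m) (Fin k)).bijective
  convert this using 1
  ext i
  rcases i with i | i <;> rfl

theorem isUnit_L : IsUnit (L q M N s) := by
  have hk : M + N + 0 = M + N := rfl
  have h := isUnit_submatrix_hatSeries_L q M N s hk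
  obtain ⟨V, h1, h2⟩ := isUnit_iff_exists.1 h
  obtain ⟨F, rfl⟩ := hatSeries_surjective (K := K) V
  have e : (hatSeries K (L q M N s)).submatrix (firstIdx hk) (firstIdx hk) =
      hatSeries K (L q M N s) := rfl
  rw [e, ← hatSeries_mul, ← hatSeries_one (K := K)] at h1 h2
  exact isUnit_iff_exists.2 ⟨F, hatSeries_injective h1, hatSeries_injective h2⟩

theorem L_mul_Linv : L q M N s * Linv q M N s = 1 :=
  Ring.mul_inverse_cancel _ (isUnit_L q M N s)

theorem Linv_mul_L : Linv q M N s * L q M N s = 1 :=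
  Ring.inverse_mul_cancel _ (isUnit_L q M N s)

theorem isSystem_L [Infinite K] :
    IsSystem (seriesScaling K (Uq q M N) s.expo (PM.expo_mul_self s)) (evenOdd M) q
      (hatSeries K (L q M N s)) (hatSeries K (Linv q M N s)) where
  mul_inv := by rw [← hatSeries_mul, L_mul_Linv, hatSeries_one]
  inv_mul := by rw [← hatSeries_mul, Linv_mul_L, hatSeries_one]
  rll a b := isRLL_hatSeries_L q M N s a b

theorem hasLastMinors_Linv : HasLastMinors (hatSeries K (Linv q M N s)) :=
  hasLastMinors_of_mul_eq_one (by rw [← hatSeries_mul, L_mul_Linv, hatSeries_one])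
    (by rw [← hatSeries_mul, Linv_mul_L, hatSeries_one]) (isUnit_submatrix_hatSeries_L q M N s)

end System

/-! ### The scalar series and the Berezinian of the generating series -/

section GeneratingSeries

variable {K : Type*} [Field K] (Q : Kˣ) (M N : ℕ) (s : PM)

/-- The weights `ω_i`, which are `q^{-2i}` for `i ≤ M` and `q^{-2M + 2(i - M)}` beyond. -/
def weight (i : ℕ) : K := ((Q ^ (if i ≤ M then -2 * (i : ℤ) else 2 * (i : ℤ) - 4 * M) : Kˣ) : K)

theorem isWeight_weight (n : ℕ) : IsWeight (n := n) (evenOdd M) (Q : K) (weight Q M) where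
  ne_zero i := Units.ne_zero _
  succ i := by
    by_cases h : M ≤ i
    · have h1 : ¬ (i : ℕ) + 1 ≤ M := by omega
      have e : (if (i : ℕ) ≤ M then -2 * ((i : ℕ) : ℤ) else 2 * ((i : ℕ) : ℤ) - 4 * M) =
          2 * ((i : ℕ) : ℤ) - 4 * M := by
        split_ifs
        · omega
        · rfl
      simp only [weight, h1, if_false, e, qpar, evenOdd, h, decide_true, if_true, inv_inv]
      rw [← Units.val_mul, ← Units.val_mul]
      congr 1
      rw [← pow_two, ← zpow_natCast, ← zpow_add]
      congr 1
      push_cast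
      ring
    · have h1 : (i : ℕ) + 1 ≤ M := by omega
      have h2 : (i : ℕ) ≤ M := by omega
      simp only [weight, h1, h2, if_true, qpar, evenOdd, h, decide_false, Bool.false_eq_true,
        if_false]
      rw [← Units.val_inv_eq_inv_val, ← Units.val_mul, ← Units.val_mul]
      congr 1
      rw [← zpow_neg_one, ← zpow_add, ← zpow_add]
      congr 1
      push_cast
      ring

theorem weight_zero : weight Q M 0 = 1 := by
  simp [weight]

theorem weight_add : weight Q M (M + N) = ((Q ^ (2 * (N : ℤ) - 2 * M) : Kˣ) : K) := by
  rw [weight]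
  congr 2
  split_ifs with h
  · obtain rfl : N = 0 := by omega
    push_cast
    ring
  · push_cast
    ring

/-- The entries of `D` agree with the weights up to the factor `q⁻¹` and the signs, which come from
the supertransposition. -/
theorem zpow_dExpo (i : Fin (M + N)) : (Q : K) ^ (dExpo i) =
    (Q : K)⁻¹ * (sg K (evenOdd M) i i * dWeight (evenOdd M) (Q : K) (weight Q M) i) := by
  rw [dWeight, ← mul_assoc (sg K _ _ _), sg_mul_self, one_mul]
  by_cases h : M ≤ i
  · have h1 : ¬ (i : ℕ) < M := by omega
    have e : (if (i : ℕ) ≤ M then -2 * ((i : ℕ) : ℤ) else 2 * ((i : ℕ) : ℤ) - 4 * M) =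
        2 * ((i : ℕ) : ℤ) - 4 * M := by
      split_ifs
      · omega
      · rfl
    simp only [weight, e, qpar, evenOdd, h, decide_true, if_true, inv_inv, dExpo, h1, if_false,
      Units.val_zpow_eq_zpow_val]
    field_simp
  · have h1 : (i : ℕ) < M := by omega
    have h2 : (i : ℕ) ≤ M := by omega
    simp only [weight, h2, qpar, evenOdd, h, decide_false, if_true, dExpo, h1, if_false,
      Bool.false_eq_true, Units.val_zpow_eq_zpow_val]
    rw [← zpow_neg_one, ← zpow_add₀ Q.ne_zero, ← zpow_add₀ Q.ne_zero]
    congr 1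
    ring

theorem coeff_Dmat (e : ℤ) (r : ℕ) (i j : Fin (M + N)) :
    (coeff r (Dmat (Q : K) M N e) : SuperMat M N (Uq (Q : K) M N)) i j =
      if r = 0 then if i = j then algebraMap K _ ((Q : K) ^ (e * dExpo i)) else 0 else 0 := by
  have h : coeff r (Dmat (Q : K) M N e) = if r = 0 then (fun i j =>
      if i = j then algebraMap K _ ((Q : K) ^ (e * dExpo i)) else 0 :
        SuperMat M N (Uq (Q : K) M N)) else 0 := coeff_C _ _
  rw [h]
  split_ifs with hr hij
  · exact if_pos hij
  · exact if_neg hij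
  · rfl

theorem hatSeries_Dmat (e : ℤ) : hatSeries K (Dmat (Q : K) M N e) =
    Matrix.diagonal fun i => ((Q : K) ^ (e * dExpo i)) • (1 : (Uq (Q : K) M N)⟦X⟧) := by
  ext i j r
  rw [hatSeries, coeff_smul, coeff_entry, coeff_Dmat]
  by_cases hr : r = 0 <;> by_cases h : i = j
  · subst h hr
    simp [hatSign_self, Algebra.algebraMap_eq_smul_one]
  · simp [h]
  · subst h
    simp [coeff_one, hr]
  · simp [h]

theorem mul_smul_diagonal_mul_apply {A : Type*} [Ring A] [Algebra K A] {ι : Type*} [Fintype ι]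
    [DecidableEq ι] (V W : Matrix ι ι A) (d : ι → K) (i k : ι) :
    (V * Matrix.diagonal (fun i => d i • (1 : A)) * W) i k = ∑ j, d j • (V i j * W j k) := by
  rw [Matrix.mul_apply]
  simp only [Matrix.mul_diagonal, mul_smul_one, smul_mul_assoc]

/-- The two equations that characterize the scalar series, for the ordinary matrix product. The
signs and the powers of `q` that depend on the row and the column only are cancelled. -/
theorem isZSeries_iff [Infinite K] (Z : (Uq (Q : K) M N)⟦X⟧) :
    IsZSeries (Q : K) M N s Z ↔
    (∀ i k, twistedProd (seriesScaling K (Uq (Q : K) M N) s.expo (PM.expo_mul_self s)) (evenOdd M)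
      (Q : K) (weight Q M) (hatSeries K (L (Q : K) M N s)) (hatSeries K (Linv (Q : K) M N s)) i k
      (Q ^ (2 * (N : ℤ) - 2 * M)) =
        if i = k then dWeight (evenOdd M) (Q : K) (weight Q M) i • Z else 0) ∧
    (∀ i k, ∑ j, (sg K (evenOdd M) j i * sg K (evenOdd M) j k *
      (dWeight (evenOdd M) (Q : K) (weight Q M) j)⁻¹) •
        (hatSeries K (Linv (Q : K) M N s) j k * seriesScale s.expo (Q ^ (2 * (N : ℤ) - 2 * M))
          (hatSeries K (L (Q : K) M N s) i j)) =
        if i = k then (dWeight (evenOdd M) (Q : K) (weight Q M) i)⁻¹ • Z else 0) := by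
  have hd := (isWeight_weight Q M (M + N)).dWeight_ne_zero Q.ne_zero
  have hq := Q.ne_zero
  have hs := sg_mul_self (K := K) (evenOdd M (n := M + N))
  have hinv : ∀ i : Fin (M + N), (Q : K) ^ (-1 * dExpo i) =
      (Q : K) * (sg K (evenOdd M) i i * (dWeight (evenOdd M) (Q : K) (weight Q M) i)⁻¹) := by
    intro i
    have h0 := sg_ne_zero (K := K) (evenOdd M (n := M + N)) i i
    rw [neg_one_mul, zpow_neg, zpow_dExpo]
    have := hs i i
    have hd := hd i
    field_simp
    linear_combination -this
  unfold IsZSeries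
  rw [← (hatSeries_injective (K := K)).eq_iff, ← (hatSeries_injective (K := K)).eq_iff]
  rw [← Matrix.ext_iff, ← Matrix.ext_iff]
  simp only [hatSeries_mul, hatSeries_Dmat, hatSeries_scalarSeries, mul_smul_diagonal_mul_apply,
    Matrix.diagonal_mul_diagonal, hatSeries_stSeries,
    hatSeries_shift, Matrix.map_apply, Matrix.diagonal_apply, one_mul]
  refine and_congr ?_ ?_
  · refine forall_congr' fun i => forall_congr' fun k => ?_
    have hc : (Q : K)⁻¹ * sg K (evenOdd M) k k ≠ 0 :=
      mul_ne_zero (inv_ne_zero hq) (sg_ne_zero _ _ _)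
    rw [← (smul_right_injective _ hc).eq_iff (a := twistedProd _ _ _ _ _ _ _ _ _)]
    refine iff_of_eq (congrArg₂ (· = ·) ?_ ?_)
    · rw [twistedProd, Finset.smul_sum]
      refine Finset.sum_congr rfl fun j _ => ?_
      rw [zpow_dExpo, smul_mul_smul_comm, smul_smul, smul_smul, sg_comm _ i j]
      congr 1
      linear_combination (sg K (evenOdd M) j i * sg K (evenOdd M) j k * sg K (evenOdd M) k k *
        (Q : K)⁻¹ * dWeight (evenOdd M) (Q : K) (weight Q M) j) * hs j j
    · by_cases h : i = k
      · subst h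
        rw [if_pos rfl, if_pos rfl, mul_smul_one, zpow_dExpo, smul_smul, mul_assoc]
      · rw [if_neg h, if_neg h, smul_zero]
  -- The supertransposition of the second equation exchanges the two indices.
  · rw [forall_comm]
    refine forall_congr' fun i => forall_congr' fun k => ?_
    have hc : (Q : K) * sg K (evenOdd M) i i ≠ 0 := mul_ne_zero hq (sg_ne_zero _ _ _)
    rw [← (smul_right_injective _ hc).eq_iff (a := ∑ j, (_ * _ * _⁻¹) • _)]
    refine iff_of_eq (congrArg₂ (· = ·) ?_ ?_)
    · rw [Finset.smul_sum]
      refine Finset.sum_congr rfl fun j _ => ?_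
      rw [hinv, smul_mul_smul_comm, smul_smul, smul_smul, sg_comm _ k j]
      congr 1
      linear_combination (sg K (evenOdd M) j k * sg K (evenOdd M) j i * sg K (evenOdd M) i i *
        (Q : K) * (dWeight (evenOdd M) (Q : K) (weight Q M) j)⁻¹) * hs j j
    · by_cases h : i = k
      · subst h
        rw [if_pos rfl, if_pos rfl, mul_smul_one, hinv, smul_smul, mul_assoc]
      · rw [if_neg h, if_neg (Ne.symm h), smul_zero]

theorem berezinian_eq [Infinite K] : berezinian (Q : K) M N s =
    ber (seriesScaling K (Uq (Q : K) M N) s.expo (PM.expo_mul_self s)) Q (rfl : M + N = M + N)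
      (hatSeries K (L (Q : K) M N s)) (hatSeries K (Linv (Q : K) M N s)) := by
  have h1 : ∀ (F : (SuperMat M N (Uq (Q : K) M N))⟦X⟧) (i j : Fin M),
      hatSeries K F (firstIdx rfl i) (firstIdx rfl j) = entry F (Fin.castAdd N i) (Fin.castAdd N j)
      := by
    intro F i j
    -- Between indices of the same parity there are no signs.
    have : hatSign K (Fin.castAdd N i) (Fin.castAdd N j) = 1 := by
      simp [hatSign, par]
    change hatSeries K F (Fin.castAdd N i) (Fin.castAdd N j) = _
    rw [hatSeries, this, one_smul]
  have h2 : ∀ (F : (SuperMat M N (Uq (Q : K) M N))⟦X⟧) (i j : Fin N),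
      hatSeries K F (lastIdx rfl i) (lastIdx rfl j) = entry F (Fin.natAdd M i) (Fin.natAdd M j)
      := by
    intro F i j
    have : hatSign K (Fin.natAdd M i) (Fin.natAdd M j) = 1 := by
      simp [hatSign, par]
    change hatSeries K F (Fin.natAdd M i) (Fin.natAdd M j) = _
    rw [hatSeries, this, one_smul]
  rw [berezinian, ber, colDet, qdet, rowDet, map_sum]
  congr 1
  · refine Finset.sum_congr rfl fun τ _ => ?_
    congr 3
    funext i
    rw [entry_shift, Matrix.submatrix_apply, h1, ← zpow_natCast]
    push_cast
    rfl
  · refine Finset.sum_congr rfl fun τ _ => ?_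
    rw [map_smul, map_list_prod, List.map_ofFn]
    congr 3
    funext i
    rw [entry_shift, Function.comp_apply, Matrix.submatrix_apply, h2, Scaling.scale_scale,
      ← zpow_natCast, ← zpow_add]
    push_cast
    rw [show 2 * (M : ℤ) - 2 - 2 * i = 2 * M + (-2 - 2 * i) by ring]
    rfl

end GeneratingSeries

end QuantumLiouville

theorem mainTheorem2 {K : Type*} [Field K] [CharZero K] (q : K) (hq0 : q ≠ 0)
    (hq : ∀ n : ℕ, 0 < n → q ^ n ≠ 1) (M N : ℕ) (hMN : 0 < M + N)
    (s : QuantumAffineSuper.PM) :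
    IsUnit (QuantumAffineSuper.L q M N s) ∧
    (∃! Z : PowerSeries (QuantumAffineSuper.Uq q M N), QuantumAffineSuper.IsZSeries q M N s Z) ∧
    ∀ Z : PowerSeries (QuantumAffineSuper.Uq q M N), QuantumAffineSuper.IsZSeries q M N s Z →
      QuantumAffineSuper.shift q s (-2) (QuantumAffineSuper.berezinian q M N s) =
        QuantumAffineSuper.shift q s (2 * (M : ℤ) - 2 * N - 2) Z *
          QuantumAffineSuper.berezinian q M N s := by
  obtain ⟨Q, rfl⟩ : ∃ Q : Kˣ, (Q : K) = q := ⟨Units.mk0 q hq0, rfl⟩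
  have hQ := hq 2 two_pos
  have hS := QuantumLiouville.isSystem_L (Q : K) M N s
  have hL' : QuantumLiouville.HasLastMinors _ := QuantumLiouville.hasLastMinors_Linv (Q : K) M N s
  have hω := QuantumLiouville.isWeight_weight Q M (M + N)
  have hu : ((Q ^ (2 * (N : ℤ) - 2 * M) : Kˣ) : K) * QuantumLiouville.weight Q M 0 =
      QuantumLiouville.weight Q M (M + N) := by
    rw [QuantumLiouville.weight_zero, mul_one, QuantumLiouville.weight_add]
  refine ⟨QuantumLiouville.isUnit_L (Q : K) M N s, ?_, fun Z hZ => ?_⟩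
  · obtain ⟨Z, hZ⟩ := hS.exists_twistedProd_eq hω hq0 hu
    obtain ⟨Z', hZ'⟩ := hS.exists_twistedProd'_eq hω hq0 hu
    obtain rfl := QuantumLiouville.scalar_eq hQ hMN hS hL' hω hZ hZ'
    refine ⟨Z', (QuantumLiouville.isZSeries_iff Q M N s Z').2 ⟨hZ, hZ'⟩, fun W hW => ?_⟩
    have h1 := ((QuantumLiouville.isZSeries_iff Q M N s W).1 hW).1 ⟨0, hMN⟩ ⟨0, hMN⟩
    rw [hZ, if_pos rfl, if_pos rfl] at h1
    exact (smul_right_injective _ (hω.dWeight_ne_zero hq0 _) h1).symm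
  · have := (QuantumLiouville.hasLiouville hQ M N hMN _ _ hS hL' _ Z hω
      ((QuantumLiouville.isZSeries_iff Q M N s Z).1 hZ).1).1
    rw [QuantumLiouville.berezinian_eq, QuantumLiouville.shift_eq_seriesScale,
      QuantumLiouville.shift_eq_seriesScale]
    exact this
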